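/- Let $d\ge 2$ and $m>0$. For a cut-off $\Lambda>0$ with $\log\Lambda\ge 1$ put $$C_\Lambda(x):=\int_{\mathbb R^d}\frac{dp}{(2\pi)^d}\,e^{ipx}\,\frac{e^{-(p^2+m^2)/\Lambda^2}}{p^2+m^2},\qquad x\in\mathbb R^d,$$ and for $Z>0$ let $\tilde C_\Lambda:=Z\,C_\Lambda$. Let $\nu_{\tilde C_\Lambda}$ be the centred Gaussian probability measure on $S'(\mathbb R^d;\mathbb R)$ with covariance $\tilde C_\Lambda$, i.e. $\int e^{i\phi(J)}\,d\nu_{\tilde C_\Lambda}(\phi)=e^{-\frac12\langle J,\tilde C_\Lambda J\rangle}$ for all $J\in S(\mathbb R^d;\mathbb R)$, where $\langle J,\tilde C_\Lambda J\rangle=\int\!\!\int J(x)\tilde C_\Lambda(x-y)J(y)\,dx\,dy$, and write $\langle F\rangle_{\tilde C_\Lambda}=\int F\,d\nu_{\tilde C_\Lambda}$. For $L>0$ let $B:=[-\frac L2,\frac L2]^d$, and for a bounded measurable function $V:\mathbb R\to\mathbb R$ with $\|V\|_\infty:=\sup_w|V(w)|$ let $\mathcal V(\phi):=\int_B V(\phi(x))\,dx$;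 this is defined because $\nu_{\tilde C_\Lambda}$-almost every $\phi$ is given by a continuous function on $\mathbb R^d$. Then there is a constant $c>0$ depending only on $d$ and $m$ such that for all $L>0$, all $\Lambda>0$ with $\log\Lambda\ge1$, all $Z>0$, all bounded measurable $V:\mathbb R\to\mathbb R$, all $J\in S(\mathbb R^d;\mathbb R)$ and all $\ell\in\mathbb N=\{0,1,2,\dots\}$, the functions $e^{\phi(J)}$ and $e^{\phi(J)}\mathcal V(\phi)^\ell$ are $\nu_{\tilde C_\Lambda}$-integrable and $$\left|\frac{\langle e^{\phi(J)}\,\mathcal V(\phi)^{\ell}\rangle_{\tilde C_\Lambda}}{\langle e^{\phi(J)}\rangle_{\tilde C_\Lambda}}-\left(\frac{\langle e^{\phi(J)}\,\mathcal V(\phi)\rangle_{\tilde C_\Lambda}}{\langle e^{\phi(J)}\rangle_{\tilde C_\Lambda}}\right)^{\ell}\right|\le c\,\max\{1,|B|^{-1}\}\,\ell^6\,\|V\|_\infty^{\ell}\,|B|^{\ell}\,\frac1{\sqrt{\log\Lambda}}.$$ In particular, for $|B|\ge1$ the right-hand side is $c\,\ell^6\|V\|_\infty^\ell|B|^\ell/\sqrt{\log\Lambda}$.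 -/

import Mathlib

open MeasureTheory ProbabilityTheory
open scoped SchwartzMap

noncomputable section

namespace BoundedQFT

/-- Euclidean space `ℝᵈ`. -/
abbrev Pt (d : ℕ) : Type := EuclideanSpace ℝ (Fin d)

/-- The real tempered distributions `S'(ℝᵈ; ℝ)`. -/
abbrev FieldConfig (d : ℕ) : Type := 𝓢(Pt d, ℝ) →L[ℝ] ℝ

/-- The cylinder sigma-algebra on `S'(ℝᵈ; ℝ)`, generated by the evaluations `φ ↦ φ(J)`. -/
instance instMeasurableSpaceFieldConfig (d : ℕ) : MeasurableSpace (FieldConfig d) :=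
  ⨆ J : 𝓢(Pt d, ℝ), MeasurableSpace.comap (fun φ : FieldConfig d => φ J) inferInstance

/-- The free covariance of mass `m` with ultraviolet cut-off `Λ`:
`C_Λ(x) = (2π)^{-d} ∫ e^{ipx} e^{-(p² + m²)/Λ²} / (p² + m²) dp`.
The integral is real (the integrand at `-p` is the conjugate of that at `p`),
so taking the real part only changes its type. -/
def cov (d : ℕ) (m Λ : ℝ) (x : Pt d) : ℝ :=
  (∫ p : Pt d, Complex.exp (Complex.I * ((inner ℝ p x : ℝ) : ℂ)) *
    ((Real.exp (-(‖p‖ ^ 2 + m ^ 2) / Λ ^ 2) / (‖p‖ ^ 2 + m ^ 2) / (2 * Real.pi) ^ d : ℝ) : ℂ)).re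

/-- The quadratic form `⟨J, C̃_Λ J⟩` of the renormalized covariance `C̃_Λ = Z C_Λ`. -/
def covForm (d : ℕ) (m Λ Z : ℝ) (J : 𝓢(Pt d, ℝ)) : ℝ :=
  ∫ x : Pt d, J x * ∫ y : Pt d, Z * cov d m Λ (x - y) * J y

/-- `ν` is the centred Gaussian measure on `S'(ℝᵈ; ℝ)` with covariance `C̃_Λ = Z C_Λ`:
the probability measure with characteristic functional
`∫ e^{iφ(J)} dν(φ) = e^{-⟨J, C̃_Λ J⟩/2}`. -/
structure IsFreeMeasure (d : ℕ) (m Λ Z : ℝ) (ν : Measure (FieldConfig d)) : Prop where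
  isProbabilityMeasure : IsProbabilityMeasure ν
  charFunctional : ∀ J : 𝓢(Pt d, ℝ),
    ∫ φ : FieldConfig d, Complex.exp (Complex.I * ((φ J : ℝ) : ℂ)) ∂ν =
      ((Real.exp (-(1 / 2) * covForm d m Λ Z J) : ℝ) : ℂ)

/-- The distribution `φ` is given by the continuous function `f` (tested against compactly
supported smooth functions, as `f` need not be of moderate growth). -/
def IsGivenBy {d : ℕ} (φ : FieldConfig d) (f : Pt d → ℝ) : Prop :=
  Continuous f ∧ ∀ g : 𝓢(Pt d, ℝ), HasCompactSupport (g : Pt d → ℝ) → φ g = ∫ x, f x * g x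

open Classical in
/-- The value `φ(x)` of a field at a point: the value of the continuous function by which the
distribution is given. Distributions that are not continuous functions (a null set for the
Gaussian measures in question) get the value `0`. -/
def fieldValue {d : ℕ} (φ : FieldConfig d) (x : Pt d) : ℝ :=
  if h : ∃ f : Pt d → ℝ, IsGivenBy φ f then h.choose x else 0

/-- The continuous function by which a distribution is given is unique. -/
theorem IsGivenBy.unique {d : ℕ} {φ : FieldConfig d} {f₁ f₂ : Pt d → ℝ}
    (h₁ : IsGivenBy φ f₁) (h₂ : IsGivenBy φ f₂) : f₁ = f₂ := by
  have h : ∀ᵐ x ∂(volume : Measure (Pt d)), f₁ x - f₂ x = 0 := by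
    refine ae_eq_zero_of_integral_contDiff_smul_eq_zero
      (h₁.1.sub h₂.1).locallyIntegrable ?_
    intro g hg hc
    have e₁ := h₁.2 (hc.toSchwartzMap hg) hc
    have e₂ := h₂.2 (hc.toSchwartzMap hg) hc
    have i₁ : Integrable (fun x => f₁ x * g x) :=
      (h₁.1.mul hg.continuous).integrable_of_hasCompactSupport hc.mul_left
    have i₂ : Integrable (fun x => f₂ x * g x) :=
      (h₂.1.mul hg.continuous).integrable_of_hasCompactSupport hc.mul_left
    have e : ∫ x, f₁ x * g x = ∫ x, f₂ x * g x := e₁.symm.trans e₂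
    have : (fun x => g x • (f₁ x - f₂ x)) = fun x => f₁ x * g x - f₂ x * g x := by
      funext x; simp only [smul_eq_mul]; ring
    rw [this, integral_sub i₁ i₂, e, sub_self]
  have h' : f₁ =ᵐ[(volume : Measure (Pt d))] f₂ := h.mono fun x hx => sub_eq_zero.1 hx
  exact (Continuous.ae_eq_iff_eq _ h₁.1 h₂.1).1 h'

/-- `fieldValue` is the continuous function by which the distribution is given. -/
theorem IsGivenBy.fieldValue_eq {d : ℕ} {φ : FieldConfig d} {f : Pt d → ℝ}
    (h : IsGivenBy φ f) : fieldValue φ = f := by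
  have hex : ∃ f : Pt d → ℝ, IsGivenBy φ f := ⟨f, h⟩
  funext x
  rw [fieldValue, dif_pos hex, hex.choose_spec.unique h]

/-- The box `[-L/2, L/2]ᵈ`. -/
def box (d : ℕ) (L : ℝ) : Set (Pt d) := {x | ∀ i, x i ∈ Set.Icc (-(L / 2)) (L / 2)}

/-- The interaction term `𝒱(φ) = ∫_B V(φ(x)) dx`. -/
def interaction {d : ℕ} (L : ℝ) (V : ℝ → ℝ) (φ : FieldConfig d) : ℝ :=
  ∫ x in box d L, V (fieldValue φ x)

/-- The moment `⟨e^{φ(J)} 𝒱(φ)^ℓ⟩` with respect to `ν`. -/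
def moment {d : ℕ} (ν : Measure (FieldConfig d)) (L : ℝ) (V : ℝ → ℝ) (J : 𝓢(Pt d, ℝ)) (ℓ : ℕ) : ℝ :=
  ∫ φ : FieldConfig d, Real.exp (φ J) * interaction L V φ ^ ℓ ∂ν

/-- The normalization `⟨e^{φ(J)}⟩`. -/
def normalization {d : ℕ} (ν : Measure (FieldConfig d)) (J : 𝓢(Pt d, ℝ)) : ℝ :=
  ∫ φ : FieldConfig d, Real.exp (φ J) ∂ν

/-- The supremum norm `‖V‖_∞` of a bounded function. -/
def supNorm (V : ℝ → ℝ) : ℝ := ⨆ w : ℝ, |V w|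

end BoundedQFT

end

noncomputable section

open scoped RealInnerProductSpace

namespace BoundedQFT

/-! Dividing by `⟨e^{φ(J)}⟩` amounts to taking expectations under the tilted measure, and by
Cameron–Martin tilting only moves the mean of the field (by the potential of `J`), not its
covariance. By Fubini the ℓ-th moment of the interaction is an integral over `B^ℓ` of expectations
of `∏ V(φ(x_i))`, and the ℓ-th power of the first moment is the integral of the products of
expectations. So the claim is a decorrelation bound for bounded functions of the Gaussian vector
`(φ(x_1), …, φ(x_ℓ))`, integrated over the points.

The covariance matrix of that vector has constant diagonal `s = Z C_Λ(0)`. Let `D` be the sum of its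
off-diagonal absolute values. By diagonal dominance it equals `(s - D)·1 + R` with `R` positive
semidefinite and all diagonal entries of `R` equal to `D`. Hence the vector is independent noise of
variance `s - D` plus a correlated Gaussian whose components have size about `√D`. Averaging `V`
over the noise gives functions that are Lipschitz with constant of order `‖V‖_∞ / √s`, however rough
`V` is, because a shifted Gaussian stays close in total variation. Replacing the correlated part by
zero therefore costs `O(ℓ √(D/s) ‖V‖_∞^ℓ)`, both in the expectation of the product and in the
product of expectations (`prod_decorrelation`).

It remains to see that `D/s` is small on average over the points. For `d ≥ 2` the value `C_Λ(0)`
grows at least like `log Λ` (`exists_log_le_cov_zero`), whereas `C_Λ` is positive with integral at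
most `1/m²` for every `Λ`, by its heat kernel representation (`integrable_cov_and_integral_le`). The
factor `Z` cancels in the quotient. The arithmetic–geometric mean inequality with parameter `√(log
Λ)` handles the square root.

Point values need a separate argument, since the measure lives on distributions. The spectral
measure of the covariance has finite moments of all orders, so the localized Fourier modes of the
field are almost surely integrable in the frequency; the field is then locally a Fourier integral
with integrable coefficients, hence continuous (`IsGaussianField.ae_exists_isGivenBy`). Values at
points are limits of pairings with mollifiers, which yields their measurability and their joint
Gaussian law (`IsGaussianField.charFun_map_fieldVector`). -/

/-! ### Products of bounded factors and shifts of one-dimensional Gaussians. -/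

theorem abs_prod_sub_prod_le {ι : Type*} (s : Finset ι) {a b c : ι → ℝ} {A : ℝ}
    (ha : ∀ i ∈ s, |a i| ≤ A) (hb : ∀ i ∈ s, |b i| ≤ A) (hab : ∀ i ∈ s, |a i - b i| ≤ A * c i) :
    |∏ i ∈ s, a i - ∏ i ∈ s, b i| ≤ A ^ s.card * ∑ i ∈ s, c i := by
  classical
  induction s using Finset.induction_on with
  | empty => simp
  | insert j s hj ih =>
    simp only [Finset.forall_mem_insert] at ha hb hab
    specialize ih ha.2 hb.2 hab.2
    have hA : 0 ≤ A := (abs_nonneg _).trans ha.1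
    rw [Finset.prod_insert hj, Finset.prod_insert hj, Finset.sum_insert hj,
      Finset.card_insert_of_notMem hj]
    have hp : |∏ i ∈ s, a i| ≤ A ^ s.card := by
      rw [Finset.abs_prod]
      calc ∏ i ∈ s, |a i| ≤ ∏ _i ∈ s, A := Finset.prod_le_prod (fun _ _ => abs_nonneg _) ha.2
        _ = A ^ s.card := by simp
    -- Telescoping: the factors are exchanged one at a time.
    have : a j * ∏ i ∈ s, a i - b j * ∏ i ∈ s, b i =
        (a j - b j) * ∏ i ∈ s, a i + b j * (∏ i ∈ s, a i - ∏ i ∈ s, b i) := by ring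
    rw [this]
    refine (abs_add_le _ _).trans ?_
    rw [abs_mul, abs_mul]
    calc _ ≤ (A * c j) * A ^ s.card + A * (A ^ s.card * ∑ i ∈ s, c i) := by
          refine add_le_add (mul_le_mul hab.1 hp (abs_nonneg _) ((abs_nonneg _).trans hab.1))
            (mul_le_mul hb.1 ih (abs_nonneg _) hA)
      _ = _ := by ring

/-- Cameron–Martin shift of the standard Gaussian. -/
theorem integral_comp_add_gaussianReal (V : ℝ → ℝ) (a : ℝ) :
    ∫ w, V (w + a) ∂(gaussianReal 0 1) =
      ∫ w, V w * Real.exp (a * w - a ^ 2 / 2) ∂(gaussianReal 0 1) := by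
  rw [integral_gaussianReal_eq_integral_smul one_ne_zero,
    integral_gaussianReal_eq_integral_smul one_ne_zero,
    ← integral_add_right_eq_self (fun w => gaussianPDFReal 0 1 w •
      (V w * Real.exp (a * w - a ^ 2 / 2))) a]
  congr 1
  ext w
  simp only [gaussianPDFReal, smul_eq_mul, NNReal.coe_one, sub_zero, mul_one]
  rw [show -(w ^ 2) / 2 = -(w + a) ^ 2 / 2 + (a * (w + a) - a ^ 2 / 2) by ring, Real.exp_add]
  ring

/-- The χ²-distance between the unit Gaussians with means `a` and `0`; it is of order `a²`, which
makes the effect of a shift linear in `|a|`. -/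
theorem integral_exp_sub_one_sq_gaussianReal (a : ℝ) :
    ∫ w, (Real.exp (a * w - a ^ 2 / 2) - 1) ^ 2 ∂(gaussianReal 0 1) = Real.exp (a ^ 2) - 1 := by
  have key : ∀ t : ℝ, ∫ w, Real.exp (t * w) ∂(gaussianReal 0 1) = Real.exp (t ^ 2 / 2) := by
    intro t
    have := congrFun (mgf_id_gaussianReal (μ := 0) (v := 1)) t
    simpa [mgf] using this
  have e : ∀ w : ℝ, (Real.exp (a * w - a ^ 2 / 2) - 1) ^ 2 =
      Real.exp (-a ^ 2) * Real.exp ((2 * a) * w) -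
        (2 * Real.exp (-a ^ 2 / 2)) * Real.exp (a * w) + 1 := by
    intro w
    rw [show a * w - a ^ 2 / 2 = -a ^ 2 / 2 + a * w by ring, Real.exp_add,
      show -a ^ 2 = -a ^ 2 / 2 + -a ^ 2 / 2 by ring, Real.exp_add,
      show (2 * a) * w = a * w + a * w by ring, Real.exp_add]
    ring_nf
  simp_rw [e]
  have i1 := integrable_exp_mul_gaussianReal (μ := 0) (v := 1)
  have i2 : Integrable (fun w => Real.exp (-a ^ 2) * Real.exp ((2 * a) * w) -
      (2 * Real.exp (-a ^ 2 / 2)) * Real.exp (a * w)) (gaussianReal 0 1) :=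
    ((i1 _).const_mul _).sub ((i1 _).const_mul _)
  rw [integral_add i2 (integrable_const _),
    integral_sub ((i1 _).const_mul _) ((i1 _).const_mul _), integral_const_mul, integral_const_mul,
    key, key, ← Real.exp_add, mul_assoc, ← Real.exp_add,
    show -a ^ 2 + (2 * a) ^ 2 / 2 = a ^ 2 by ring, show -a ^ 2 / 2 + a ^ 2 / 2 = 0 by ring]
  simp only [Real.exp_zero, integral_const, probReal_univ, smul_eq_mul]
  ring

theorem abs_integral_le_integral_of_abs_le {Ω : Type*} [MeasurableSpace Ω] {P : Measure Ω}
    {f g : Ω → ℝ} (hg : Integrable g P) (hfg : ∀ᵐ ω ∂P, |f ω| ≤ g ω) :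
    |∫ ω, f ω ∂P| ≤ ∫ ω, g ω ∂P := by
  rw [← Real.norm_eq_abs]
  exact norm_integral_le_of_norm_le hg hfg

/-- By Cameron–Martin the shift moves from `V` to the density, so only the bound on `V` enters and
no regularity is needed. For `|a| ≥ 1` the trivial bound `2A` suffices. -/
theorem abs_integral_comp_add_sub_le {V : ℝ → ℝ} (hV : Measurable V) {A : ℝ}
    (hA : ∀ w, |V w| ≤ A) (a : ℝ) :
    |∫ w, V (w + a) ∂(gaussianReal 0 1) - ∫ w, V w ∂(gaussianReal 0 1)| ≤ A * (2 * |a|) := by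
  have hA0 : 0 ≤ A := (abs_nonneg _).trans (hA 0)
  have bd : ∀ f : ℝ → ℝ, (∀ w, |f w| ≤ A) → |∫ w, f w ∂(gaussianReal 0 1)| ≤ A := by
    intro f hf
    simpa using norm_integral_le_of_norm_le_const (μ := gaussianReal 0 1) (f := f) (C := A)
      (ae_of_all _ hf)
  rcases le_or_gt 1 |a| with ha | ha
  · calc _ ≤ A + A := (abs_sub _ _).trans (add_le_add (bd _ fun w => hA _) (bd _ hA))
      _ ≤ _ := by nlinarith
  rcases eq_or_ne a 0 with rfl | h0
  · simp
  have ha0 : 0 < |a| := abs_pos.2 h0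
  set f : ℝ → ℝ := fun w => Real.exp (a * w - a ^ 2 / 2) - 1 with hf
  have i1 : Integrable (fun w => Real.exp (a * w - a ^ 2 / 2)) (gaussianReal 0 1) := by
    simp_rw [sub_eq_add_neg, Real.exp_add]
    exact (integrable_exp_mul_gaussianReal _).mul_const _
  -- A non-integrable function has integral `0` by convention, whereas the explicit value `exp (a²)
  -- - 1` is positive.
  have if2 : Integrable (fun w => f w ^ 2) (gaussianReal 0 1) := by
    by_contra hc
    have := integral_exp_sub_one_sq_gaussianReal a
    rw [integral_undef hc] at this
    have : (0:ℝ) < a ^ 2 := by positivity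
    have := Real.add_one_le_exp (a ^ 2)
    linarith
  have iV : Integrable V (gaussianReal 0 1) :=
    (integrable_const A).mono' hV.aestronglyMeasurable (ae_of_all _ hA)
  have iVf : Integrable (fun w => V w * f w) (gaussianReal 0 1) :=
    (i1.sub (integrable_const 1)).bdd_mul hV.aestronglyMeasurable (ae_of_all _ hA)
  have e : ∫ w, V (w + a) ∂(gaussianReal 0 1) - ∫ w, V w ∂(gaussianReal 0 1) =
      ∫ w, V w * f w ∂(gaussianReal 0 1) := by
    rw [integral_comp_add_gaussianReal, ← integral_sub _ iV]
    · congr 1; ext w; simp only [hf]; ring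
    · exact i1.bdd_mul hV.aestronglyMeasurable (ae_of_all _ hA)
  rw [e]
  -- Weighted AM–GM `|f| ≤ f² / (2|a|) + |a| / 2` replaces Cauchy–Schwarz; the weight `|a|` is the
  -- order of the `L²` norm of `f`.
  calc |∫ w, V w * f w ∂(gaussianReal 0 1)| ≤
      ∫ w, A * ((f w ^ 2) * (|a|⁻¹ / 2) + |a| / 2) ∂(gaussianReal 0 1) := by
        have i3 : Integrable (fun w => A * ((f w ^ 2) * (|a|⁻¹ / 2) + |a| / 2))
          (gaussianReal 0 1) := ((if2.mul_const _).add (integrable_const _)).const_mul _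
        refine abs_integral_le_integral_of_abs_le i3 (ae_of_all _ fun w => ?_)
        rw [abs_mul]
        refine mul_le_mul (hA w) ?_ (abs_nonneg _) hA0
        have : 0 ≤ (|f w| - |a|) ^ 2 := sq_nonneg _
        rw [show (f w ^ 2) * (|a|⁻¹ / 2) + |a| / 2 = (|f w| ^ 2 + |a| ^ 2) / (2 * |a|) by
          rw [sq_abs (f w)]; field_simp, le_div_iff₀ (by positivity)]
        nlinarith
    _ = A * ((Real.exp (a ^ 2) - 1) * (|a|⁻¹ / 2) + |a| / 2) := by
        rw [integral_const_mul, integral_add (if2.mul_const _) (integrable_const _),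
          integral_mul_const, integral_exp_sub_one_sq_gaussianReal]
        simp
    _ ≤ _ := by
        refine mul_le_mul_of_nonneg_left ?_ hA0
        have h1 : |a ^ 2| ≤ 1 := by rw [abs_pow]; nlinarith
        have h2 := Real.abs_exp_sub_one_le h1
        have h3 : Real.exp (a ^ 2) - 1 ≤ 2 * |a| ^ 2 := by
          refine (le_abs_self _).trans (h2.trans ?_)
          rw [abs_pow]
        calc _ ≤ (2 * |a| ^ 2) * (|a|⁻¹ / 2) + |a| / 2 := by gcongr
          _ = 3 / 2 * |a| := by field_simp; ring
          _ ≤ _ := by linarith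

/-- Affine rescaling: in units of the standard deviation `√v`, a shift by `y` is a shift by `y /
√v`. -/
theorem abs_integral_gaussianReal_add_sub_le {V : ℝ → ℝ} (hV : Measurable V) {A : ℝ}
    (hA : ∀ w, |V w| ≤ A) (h : ℝ) {v : ℝ} (hv : 0 < v) (y : ℝ) :
    |∫ w, V (w + y) ∂(gaussianReal h v.toNNReal) - ∫ w, V w ∂(gaussianReal h v.toNNReal)| ≤
      A * (2 * |y| / √v) := by
  have hs : 0 < √v := Real.sqrt_pos.2 hv
  have e : gaussianReal h v.toNNReal = (gaussianReal 0 1).map (fun w => √v * w + h) := by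
    have h1 := gaussianReal_map_const_mul (μ := 0) (v := 1) (√v)
    have h2 := gaussianReal_map_add_const (μ := 0) (v := v.toNNReal) h
    rw [show (fun w => √v * w + h) = (fun w => w + h) ∘ (fun w => √v * w) from rfl,
      ← Measure.map_map (by fun_prop) (by fun_prop), h1]
    have : NNReal.mk (√v ^ 2) (sq_nonneg _) * 1 = v.toNNReal := by
      ext; simp [Real.sq_sqrt hv.le, hv.le]
    rw [this, mul_zero, h2, zero_add]
  have hVy : Measurable fun w => V (w + y) := hV.comp (measurable_add_const y)
  rw [e, integral_map (by fun_prop) hVy.aestronglyMeasurable,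
    integral_map (by fun_prop) hV.aestronglyMeasurable]
  have := abs_integral_comp_add_sub_le (V := fun w => V (√v * w + h))
    (hV.comp (by fun_prop)) (fun w => hA _) (y / √v)
  have e2 : ∀ w, √v * (w + y / √v) + h = √v * w + h + y := by
    intro w; field_simp; ring
  simp only [e2] at this
  rwa [abs_div, abs_of_pos hs, ← mul_div_assoc] at this


theorem abs_integral_le_of_abs_le {Ω : Type*} [MeasurableSpace Ω] (P : Measure Ω)
    [IsProbabilityMeasure P] {f : Ω → ℝ} {A : ℝ} (hf : ∀ ω, |f ω| ≤ A) : |∫ ω, f ω ∂P| ≤ A := by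
  simpa using norm_integral_le_of_norm_le_const (μ := P) (f := f) (C := A) (ae_of_all _ hf)

theorem abs_prod_le_pow {ι : Type*} [Fintype ι] {a : ι → ℝ} {A : ℝ} (ha : ∀ i, |a i| ≤ A) :
    |∏ i, a i| ≤ A ^ Fintype.card ι := by
  rw [Finset.abs_prod]
  calc ∏ i, |a i| ≤ ∏ _i : ι, A := Finset.prod_le_prod (fun _ _ => abs_nonneg _) fun i _ => ha i
    _ = A ^ Fintype.card ι := by simp

/-! ### Decorrelation for Gaussian vectors with small off-diagonal covariance. -/

section Decorrelation

variable {ι : Type*} [Fintype ι] [DecidableEq ι]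

/-- The total absolute weight of the off-diagonal entries of a matrix. -/
def offDiagSum (S : Matrix ι ι ℝ) : ℝ := ∑ i, ∑ j, if i = j then 0 else |S i j|

theorem offDiagSum_nonneg (S : Matrix ι ι ℝ) : 0 ≤ offDiagSum S :=
  Finset.sum_nonneg fun i _ => Finset.sum_nonneg fun j _ => by split_ifs <;> positivity

/-- Diagonal dominance. -/
theorem posSemidef_sub_smul_one {S : Matrix ι ι ℝ} (hS : S.IsSymm) {s : ℝ}
    (hs : ∀ i, S i i = s) :
    (S - (s - offDiagSum S) • (1 : Matrix ι ι ℝ)).PosSemidef := by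
  refine Matrix.posSemidef_iff_dotProduct_mulVec.2 ⟨?_, fun x => ?_⟩
  · ext i j
    simp [Matrix.one_apply, hS.apply, eq_comm]
  set D := offDiagSum S with hD
  have e : star x ⬝ᵥ (S - (s - D) • (1 : Matrix ι ι ℝ)).mulVec x =
      ∑ i, ∑ j, ((if i = j then 0 else S i j * x i * x j) +
        (if i = j then D * x i ^ 2 else 0)) := by
    simp only [dotProduct, Matrix.mulVec, Finset.mul_sum, Pi.star_apply, star_trivial]
    refine Finset.sum_congr rfl fun i _ => Finset.sum_congr rfl fun j _ => ?_
    by_cases h : i = j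
    · subst h; simp [hs]; ring
    · simp [h]; ring
  rw [e]
  simp only [Finset.sum_add_distrib, Finset.sum_ite_eq, Finset.mem_univ, if_true]
  set N := ∑ i, x i ^ 2 with hN
  have hle : ∀ i, x i ^ 2 ≤ N := fun i =>
    Finset.single_le_sum (f := fun i => x i ^ 2) (fun _ _ => sq_nonneg _) (Finset.mem_univ i)
  -- Each `|x i * x j|` is at most `N = ∑ x i ^ 2`, so the off-diagonal part of the form is at least
  -- `-D * N`. This is cruder than a row-by-row estimate, but it needs only the single number `D`.
  have : ∑ i, ∑ j, (if i = j then 0 else S i j * x i * x j) ≥ -(D * N) := by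
    rw [hD, offDiagSum, Finset.sum_mul, ← Finset.sum_neg_distrib]
    refine Finset.sum_le_sum fun i _ => ?_
    rw [Finset.sum_mul, ← Finset.sum_neg_distrib]
    refine Finset.sum_le_sum fun j _ => ?_
    by_cases h : i = j
    · simp [h]
    simp only [h, if_false]
    have h1 : |x i * x j| ≤ N := by
      rw [abs_le]
      constructor <;> nlinarith [hle i, hle j, sq_nonneg (x i - x j), sq_nonneg (x i + x j)]
    have h2 : |S i j * x i * x j| ≤ |S i j| * N := by
      rw [mul_assoc, abs_mul]; gcongr
    linarith [(abs_le.1 h2).1]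
  rw [← Finset.mul_sum]
  linarith

/-- The covariance `S` splits as `(s - D) • 1` plus a positive semidefinite `R` with diagonal `D`.
Conditionally on the `R`-part the coordinates are independent with variance close to `s`, so the
conditional means of `V` hardly feel a displacement of size `√D`. -/
theorem prod_decorrelation (P : Measure (EuclideanSpace ℝ ι)) [IsProbabilityMeasure P]
    (h : EuclideanSpace ℝ ι) {S : Matrix ι ι ℝ} (hS : S.IsSymm) {s : ℝ} (hs : 0 < s)
    (hdiag : ∀ i, S i i = s)
    (hP : ∀ t, charFun P t = Complex.exp (⟪t, h⟫ * Complex.I - t ⬝ᵥ S.mulVec t / 2))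
    {V : ℝ → ℝ} (hV : Measurable V) {A : ℝ} (hA : ∀ w, |V w| ≤ A) :
    |∫ x, ∏ i, V (x i) ∂P - ∏ i, ∫ x, V (x i) ∂P| ≤
      6 * Fintype.card ι * √(offDiagSum S / s) * A ^ Fintype.card ι := by
  have hA0 : 0 ≤ A := (abs_nonneg _).trans (hA 0)
  set D := offDiagSum S with hD
  have hD0 : 0 ≤ D := offDiagSum_nonneg S
  -- If `D > s / 2`, the index type is nonempty and `6 * n * √(D / s) ≥ 2`, so the trivial bound `2
  -- * A ^ n` is enough. Otherwise the noise variance `v = s - D` is at least `s / 2`.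
  rcases le_or_gt D (s / 2) with hDs | hDs
  swap
  · have hn : 1 ≤ Fintype.card ι := by
      by_contra hc
      have : IsEmpty ι := Fintype.card_eq_zero_iff.1 (by omega)
      have : D = 0 := by simp [hD, offDiagSum]
      linarith
    have hn' : (1 : ℝ) ≤ Fintype.card ι := by exact_mod_cast hn
    have h1 : 1 / 2 ≤ √(D / s) := by
      refine Real.le_sqrt_of_sq_le ?_
      rw [le_div_iff₀ hs]; linarith
    have h2 : |∫ x, ∏ i, V (x i) ∂P| ≤ A ^ Fintype.card ι :=
      abs_integral_le_of_abs_le P fun x => abs_prod_le_pow fun i => hA _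
    have h3 : |∏ i, ∫ x, V (x i) ∂P| ≤ A ^ Fintype.card ι :=
      abs_prod_le_pow fun i => abs_integral_le_of_abs_le P fun x => hA _
    calc _ ≤ A ^ Fintype.card ι + A ^ Fintype.card ι := (abs_sub _ _).trans (add_le_add h2 h3)
      _ = 6 * 1 * (1 / 3) * A ^ Fintype.card ι := by ring
      _ ≤ _ := by gcongr; linarith
  set R := S - (s - D) • (1 : Matrix ι ι ℝ) with hR
  have hRp : R.PosSemidef := posSemidef_sub_smul_one hS hdiag
  set v := s - D with hv
  have hv0 : 0 < v := by linarith
  set Γ : Measure (ι → ℝ) := Measure.pi fun i => gaussianReal (h i) v.toNNReal with hΓ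
  set N : Measure (EuclideanSpace ℝ ι) := multivariateGaussian 0 R with hN
  -- The noise carries the mean `h`, and the correlated part is centred; equality of laws is read
  -- off from the characteristic functions.
  have hconv : P = (Γ.map (WithLp.toLp 2)) ∗ N := by
    have : IsProbabilityMeasure (Γ.map (WithLp.toLp 2)) :=
      Measure.isProbabilityMeasure_map (by fun_prop)
    refine Measure.ext_of_charFun (funext fun t => ?_)
    rw [charFun_conv, hP, hN, charFun_multivariateGaussian hRp, hΓ, charFun_pi]
    simp only [charFun_gaussianReal]
    rw [← Complex.exp_sum, ← Complex.exp_add]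
    congr 1
    rw [hR, Matrix.sub_mulVec, dotProduct_sub, Matrix.smul_mulVec, Matrix.one_mulVec,
      dotProduct_smul]
    simp only [PiLp.inner_apply, dotProduct, inner_zero_right, Real.coe_toNNReal _ hv0.le]
    push_cast
    simp only [Finset.sum_sub_distrib, Finset.sum_mul, smul_eq_mul, Finset.mul_sum, sub_div,
      Finset.sum_div]
    simp
    have a : ∑ x, (h x : ℂ) * t x * Complex.I = ∑ x, (t x : ℂ) * h x * Complex.I :=
      Finset.sum_congr rfl fun x _ => by ring
    have b : ∑ x, (v : ℂ) * (t x : ℂ) ^ 2 / 2 = (∑ x, (v : ℂ) * (t x * t x)) / 2 := by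
      rw [Finset.sum_div]; exact Finset.sum_congr rfl fun x _ => by ring
    rw [a, b]
    ring
  have key : ∀ f : EuclideanSpace ℝ ι → ℝ, Measurable f → (∃ C, ∀ x, |f x| ≤ C) →
      ∫ x, f x ∂P = ∫ y, ∫ g, f (WithLp.toLp 2 g + y) ∂Γ ∂N := by
    rintro f hf ⟨C, hC⟩
    have : IsProbabilityMeasure (Γ.map (WithLp.toLp 2)) :=
      Measure.isProbabilityMeasure_map (by fun_prop)
    have hm : Measurable fun p : EuclideanSpace ℝ ι × EuclideanSpace ℝ ι => f (p.1 + p.2) :=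
      hf.comp measurable_add
    rw [hconv, Measure.conv, integral_map measurable_add.aemeasurable hf.aestronglyMeasurable,
      integral_prod_symm]
    · refine integral_congr_ae (ae_of_all _ fun y => ?_)
      exact integral_map (by fun_prop) (hf.comp (measurable_add_const y)).aestronglyMeasurable
    · exact (integrable_const C).mono' hm.aestronglyMeasurable (ae_of_all _ fun p => hC _)
  -- `u i y` is the conditional mean of `V` at coordinate `i` when the correlated part takes the
  -- value `y` there.
  set u : ι → ℝ → ℝ := fun i y => ∫ g, V (g + y) ∂(gaussianReal (h i) v.toNNReal) with hu
  have hu1 : ∀ i y, |u i y| ≤ A := fun i y => abs_integral_le_of_abs_le _ fun g => hA _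
  have hu2 : ∀ i y, |u i y - u i 0| ≤ A * (2 * |y| / √v) := fun i y => by
    simpa [hu] using abs_integral_gaussianReal_add_sub_le hV hA (h i) hv0 y
  have hum : ∀ i, Measurable (u i) := fun i => by
    have : StronglyMeasurable fun p : ℝ × ℝ => V (p.2 + p.1) :=
      (hV.comp (measurable_snd.add measurable_fst)).stronglyMeasurable
    exact this.integral_prod_right.measurable
  have e1 : ∫ x, ∏ i, V (x i) ∂P = ∫ y, ∏ i, u i (y i) ∂N := by
    rw [key (fun x => ∏ i, V (x i))
      (Finset.measurable_prod _ fun i _ => hV.comp (by fun_prop))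
      ⟨A ^ Fintype.card ι, fun x => abs_prod_le_pow fun i => hA _⟩]
    refine integral_congr_ae (ae_of_all _ fun y => ?_)
    exact integral_fintype_prod_eq_prod (fun i g => V (g + y i))
  have e2 : ∀ i, ∫ x, V (x i) ∂P = ∫ y, u i (y i) ∂N := by
    intro i
    rw [key (fun x => V (x i)) (hV.comp (by fun_prop)) ⟨A, fun x => hA _⟩]
    refine integral_congr_ae (ae_of_all _ fun y => ?_)
    have hm : Measurable fun g => V (g + y i) := hV.comp (measurable_add_const _)
    have := (measurePreserving_eval (fun i => gaussianReal (h i) v.toNNReal) i)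
    simp only [hu]
    rw [← this.map_eq, integral_map this.measurable.aemeasurable hm.aestronglyMeasurable]
    rfl
  -- The coordinate has variance `R i i = D`; nonnegativity of the variance of `|y i|` bounds its
  -- mean by `√D`.
  have hmean : ∀ i, Integrable (fun y : EuclideanSpace ℝ ι => |y i|) N ∧ ∫ y, |y i| ∂N ≤ √D := by
    intro i
    have hp := measurePreserving_eval_multivariateGaussian (μ := 0) hRp (i := i)
    have hii : R i i = D := by simp [hR, hdiag, hv]
    rw [hii] at hp
    have hL : MemLp (fun y : EuclideanSpace ℝ ι => y i) 2 N :=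
      (memLp_id_gaussianReal' 2 (by simp)).comp_measurePreserving hp
    have hLa : MemLp (fun y : EuclideanSpace ℝ ι => |y i|) 2 N := hL.norm
    refine ⟨hLa.integrable (by norm_num), Real.le_sqrt_of_sq_le ?_⟩
    have h0 := variance_nonneg (fun y : EuclideanSpace ℝ ι => |y i|) N
    have h1 := variance_eval_multivariateGaussian (μ := 0) hRp (i := i)
    rw [variance_eq_sub hLa] at h0
    rw [variance_eq_sub hL, hii] at h1
    have h2 : ∫ y : EuclideanSpace ℝ ι, y i ∂N = 0 := by
      have := integral_map hp.measurable.aemeasurable (f := fun x : ℝ => x) (μ := N)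
        (by fun_prop)
      rw [hp.map_eq, integral_id_gaussianReal] at this
      simpa using this.symm
    simp only [h2] at h1
    simp only [Pi.pow_apply, sq_abs] at h0 h1
    linarith
  have hc : ∀ y : EuclideanSpace ℝ ι, |∏ i, u i (y i) - ∏ i, u i 0| ≤
      A ^ Fintype.card ι * ∑ i, 2 * |y i| / √v := fun y =>
    abs_prod_sub_prod_le Finset.univ (fun i _ => hu1 i _) (fun i _ => hu1 i _)
      (fun i _ => hu2 i _)
  -- From `v ≥ s / 2`, since `4 ≤ 9 / 2`.
  have hq : 2 * √D / √v ≤ 3 * √(D / s) := by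
    have h1 : 2 * √s ≤ 3 * √v := by
      rw [← Real.sqrt_sq (show (0:ℝ) ≤ 2 by norm_num), ← Real.sqrt_sq (show (0:ℝ) ≤ 3 by norm_num),
        ← Real.sqrt_mul (by positivity), ← Real.sqrt_mul (by positivity)]
      exact Real.sqrt_le_sqrt (by linarith)
    have hs' : 0 < √s := Real.sqrt_pos.2 hs
    rw [Real.sqrt_div hD0, mul_div_assoc', div_le_div_iff₀ (Real.sqrt_pos.2 hv0) hs']
    nlinarith [Real.sqrt_nonneg D]
  have hi : ∀ i, Integrable (fun y : EuclideanSpace ℝ ι => u i (y i)) N := fun i =>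
    (integrable_const A).mono' ((hum i).comp (by fun_prop)).aestronglyMeasurable
      (ae_of_all _ fun y => hu1 i _)
  -- The common reference value is `∏ i, u i 0`. Both the mean of the product and the product of the
  -- means lie within `3 * n * √(D / s) * A ^ n` of it, whence the factor 6.
  have b1 : |∫ y, ∏ i, u i (y i) ∂N - ∏ i, u i 0| ≤
      A ^ Fintype.card ι * (Fintype.card ι * (3 * √(D / s))) := by
    have i1 : Integrable (fun y : EuclideanSpace ℝ ι => ∏ i, u i (y i)) N :=
      (integrable_const (A ^ Fintype.card ι)).mono'
        (Finset.measurable_prod _ fun i _ => (hum i).comp (by fun_prop)).aestronglyMeasurable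
        (ae_of_all _ fun y => abs_prod_le_pow fun i => hu1 i _)
    have i2 : ∀ i, Integrable (fun y : EuclideanSpace ℝ ι => 2 * |y i| / √v) N := fun i =>
      ((hmean i).1.const_mul 2).div_const _
    calc _ = |∫ y, (∏ i, u i (y i) - ∏ i, u i 0) ∂N| := by
          rw [integral_sub i1 (integrable_const _)]; simp
      _ ≤ ∫ y, A ^ Fintype.card ι * ∑ i, 2 * |y i| / √v ∂N :=
          abs_integral_le_integral_of_abs_le ((integrable_finsetSum _ fun i _ => i2 i).const_mul _)
            (ae_of_all _ hc)
      _ = A ^ Fintype.card ι * ∑ i, 2 * (∫ y, |y i| ∂N) / √v := by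
          rw [integral_const_mul, integral_finsetSum _ fun i _ => i2 i]
          simp_rw [integral_div, integral_const_mul]
      _ ≤ A ^ Fintype.card ι * ∑ i : ι, 3 * √(D / s) := by
          gcongr with i _
          refine le_trans ?_ hq
          gcongr
          exact (hmean i).2
      _ = _ := by simp
  have b2 : |∏ i, u i 0 - ∏ i, ∫ y, u i (y i) ∂N| ≤
      A ^ Fintype.card ι * (Fintype.card ι * (3 * √(D / s))) := by
    refine (abs_prod_sub_prod_le Finset.univ (A := A) (c := fun _ => 3 * √(D / s))
      (fun i _ => hu1 i _) (fun i _ => abs_integral_le_of_abs_le _ fun y => hu1 i _)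
      (fun i _ => ?_)).trans (by simp)
    have i2 : Integrable (fun y : EuclideanSpace ℝ ι => A * (2 * |y i| / √v)) N :=
      (((hmean i).1.const_mul 2).div_const _).const_mul _
    calc _ = |∫ y, (u i (y i) - u i 0) ∂N| := by
          rw [integral_sub (hi i) (integrable_const _), abs_sub_comm]; simp
      _ ≤ ∫ y, A * (2 * |y i| / √v) ∂N :=
          abs_integral_le_integral_of_abs_le i2 (ae_of_all _ fun y => hu2 i _)
      _ = A * (2 * (∫ y, |y i| ∂N) / √v) := by
          rw [integral_const_mul, integral_div, integral_const_mul]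
      _ ≤ _ := by
          gcongr
          refine le_trans ?_ hq
          gcongr
          exact (hmean i).2
  rw [e1]
  simp_rw [e2]
  calc _ ≤ _ := abs_sub_le _ (∏ i, u i 0) _
    _ ≤ _ := add_le_add b1 b2
    _ = _ := by ring

end Decorrelation

/-! ### The covariance: Fourier weight, heat kernel representation, logarithmic growth at the
origin. -/

section Spectral

variable {d : ℕ} {m Λ : ℝ}

/-- The Fourier weight of the covariance `cov d m Λ`. -/
def weight (d : ℕ) (m Λ : ℝ) (p : Pt d) : ℝ :=
  Real.exp (-(‖p‖ ^ 2 + m ^ 2) / Λ ^ 2) / (‖p‖ ^ 2 + m ^ 2) / (2 * Real.pi) ^ d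

theorem weight_nonneg (p : Pt d) : 0 ≤ weight d m Λ p := by
  unfold weight; positivity

theorem continuous_weight (hm : 0 < m) : Continuous (weight d m Λ) := by
  have : ∀ p : Pt d, ‖p‖ ^ 2 + m ^ 2 ≠ 0 := fun p => by positivity
  unfold weight
  fun_prop (disch := exact this _)

theorem integrable_exp_neg_mul_norm_sq {b : ℝ} (hb : 0 < b) :
    Integrable fun p : Pt d => Real.exp (-b * ‖p‖ ^ 2) := by
  have := (GaussianFourier.integrable_cexp_neg_mul_sq_norm_add (b := (b : ℂ)) (by simpa using hb) 0
    (0 : Pt d)).norm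
  refine this.congr (ae_of_all _ fun p => ?_)
  simp only [Complex.norm_exp]
  norm_cast
  simp

/-- The Gaussian cut-off beats any polynomial: `(1 + ‖p‖) ^ N ≤ N! * exp (1 + ‖p‖)`, and completing
the square absorbs the linear exponent into half of the quadratic one. These moments are the source
of sample continuity. -/
theorem integrable_pow_mul_weight (hm : 0 < m) (hΛ : 0 < Λ) (N : ℕ) :
    Integrable fun p : Pt d => (1 + ‖p‖) ^ N * weight d m Λ p := by
  set b : ℝ := 1 / Λ ^ 2 with hb
  have hb0 : 0 < b := by positivity
  have hi := (integrable_exp_neg_mul_norm_sq (d := d) (half_pos hb0)).const_mul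
    (N.factorial * Real.exp (1 + 1 / (2 * b)) / m ^ 2 / (2 * Real.pi) ^ d)
  refine hi.mono' (Continuous.aestronglyMeasurable ?_) (ae_of_all _ fun p => ?_)
  · have := continuous_weight (d := d) (Λ := Λ) hm
    fun_prop
  have h0 := weight_nonneg (m := m) (Λ := Λ) p
  rw [Real.norm_of_nonneg (by positivity)]
  have h1 : (1 + ‖p‖) ^ N ≤ N.factorial * Real.exp (1 + ‖p‖) := by
    have := Real.pow_div_factorial_le_exp (1 + ‖p‖) (by positivity) N
    rwa [div_le_iff₀' (by positivity)] at this
  have h2 : weight d m Λ p ≤ Real.exp (-b * ‖p‖ ^ 2) / m ^ 2 / (2 * Real.pi) ^ d := by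
    unfold weight
    gcongr
    · rw [hb, neg_mul, div_mul_eq_mul_div, ← neg_div, one_mul]
      gcongr
      nlinarith [sq_nonneg m]
    · nlinarith [sq_nonneg ‖p‖]
  calc _ ≤ (N.factorial * Real.exp (1 + ‖p‖)) *
        (Real.exp (-b * ‖p‖ ^ 2) / m ^ 2 / (2 * Real.pi) ^ d) := by gcongr
    _ = (N.factorial * Real.exp (1 + ‖p‖ + -b * ‖p‖ ^ 2) / m ^ 2 / (2 * Real.pi) ^ d) := by
        rw [Real.exp_add (1 + ‖p‖)]; ring
    _ ≤ (N.factorial * Real.exp (1 + 1 / (2 * b) + -(b / 2) * ‖p‖ ^ 2) / m ^ 2 /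
          (2 * Real.pi) ^ d) := by
        have : 0 ≤ b / 2 * (‖p‖ - 1 / b) ^ 2 := by positivity
        have e : b / 2 * (‖p‖ - 1 / b) ^ 2 = b / 2 * ‖p‖ ^ 2 - ‖p‖ + 1 / (2 * b) := by
          field_simp; ring
        have h3 : 1 + ‖p‖ + -b * ‖p‖ ^ 2 ≤ 1 + 1 / (2 * b) + -(b / 2) * ‖p‖ ^ 2 := by linarith
        gcongr N.factorial * ?_ / m ^ 2 / (2 * Real.pi) ^ d
        exact Real.exp_le_exp.2 h3
    _ = _ := by rw [Real.exp_add]; ring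

theorem integrable_weight (hm : 0 < m) (hΛ : 0 < Λ) : Integrable (weight d m Λ) := by
  simpa using integrable_pow_mul_weight (d := d) hm hΛ 0

theorem integrable_cexp_mul_weight (hm : 0 < m) (hΛ : 0 < Λ) (x : Pt d) :
    Integrable fun p : Pt d => Complex.exp (Complex.I * ((⟪p, x⟫ : ℝ) : ℂ)) * (weight d m Λ p : ℂ) := by
  refine (integrable_weight (d := d) hm hΛ).ofReal.bdd_mul (c := 1)
    (Continuous.aestronglyMeasurable (by fun_prop)) (ae_of_all _ fun p => ?_)
  rw [mul_comm, Complex.norm_exp_ofReal_mul_I]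

theorem cov_eq_integral_cos (hm : 0 < m) (hΛ : 0 < Λ) (x : Pt d) :
    cov d m Λ x = ∫ p : Pt d, Real.cos ⟪p, x⟫ * weight d m Λ p := by
  unfold cov
  have := integral_re (integrable_cexp_mul_weight hm hΛ x)
  simp only [weight, RCLike.re_to_complex] at this ⊢
  rw [← this]
  congr 1; ext p
  rw [Complex.re_mul_ofReal, mul_comm Complex.I, Complex.exp_ofReal_mul_I_re]

/-- The heat kernel at time `t` damped by the mass. -/
def heat (d : ℕ) (m t : ℝ) (x : Pt d) : ℝ :=
  Real.exp (-(t * m ^ 2)) * ((Real.pi / t) ^ (d / 2 : ℝ) / (2 * Real.pi) ^ d) *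
    Real.exp (-(1 / (4 * t)) * ‖x‖ ^ 2)

theorem heat_nonneg {t : ℝ} (ht : 0 < t) (x : Pt d) : 0 ≤ heat d m t x := by
  unfold heat
  have := Real.rpow_nonneg (div_nonneg Real.pi_pos.le ht.le) (d / 2 : ℝ)
  positivity

theorem integral_heat {t : ℝ} (ht : 0 < t) :
    ∫ x : Pt d, heat d m t x = Real.exp (-(t * m ^ 2)) := by
  unfold heat
  rw [integral_const_mul, GaussianFourier.integral_rexp_neg_mul_sq_norm (by positivity),
    finrank_euclideanSpace_fin, mul_assoc, div_mul_eq_mul_div,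
    ← Real.mul_rpow (by positivity) (by positivity)]
  have : Real.pi / t * (Real.pi / (1 / (4 * t))) = (2 * Real.pi) ^ (2 : ℝ) := by
    rw [Real.rpow_two]; field_simp; ring
  rw [this, ← Real.rpow_mul (by positivity), mul_div_cancel₀ _ two_ne_zero, Real.rpow_natCast,
    div_self (by positivity), mul_one]

theorem integrable_heat {t : ℝ} (ht : 0 < t) : Integrable (heat d m t) :=
  (integrable_exp_neg_mul_norm_sq (by positivity)).const_mul _

theorem integral_exp_mul_heat_symbol {t : ℝ} (ht : 0 < t) (x : Pt d) :
    ∫ p : Pt d, Complex.exp (Complex.I * ((⟪p, x⟫ : ℝ) : ℂ)) *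
      ((Real.exp (-(t * (‖p‖ ^ 2 + m ^ 2))) / (2 * Real.pi) ^ d : ℝ) : ℂ) = heat d m t x := by
  have h := GaussianFourier.integral_cexp_neg_mul_sq_norm_add (b := (t : ℂ)) (by simpa using ht)
    Complex.I x
  have e : ∀ p : Pt d, Complex.exp (Complex.I * ((⟪p, x⟫ : ℝ) : ℂ)) *
      ((Real.exp (-(t * (‖p‖ ^ 2 + m ^ 2))) / (2 * Real.pi) ^ d : ℝ) : ℂ) =
      Complex.exp (-t * ‖p‖ ^ 2 + Complex.I * ⟪x, p⟫) *
        ((Real.exp (-(t * m ^ 2)) / (2 * Real.pi) ^ d : ℝ) : ℂ) := by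
    intro p
    push_cast
    rw [show -((t : ℂ) * (‖p‖ ^ 2 + m ^ 2)) = -t * ‖p‖ ^ 2 + -(t * m ^ 2) by ring, Complex.exp_add,
      Complex.exp_add, real_inner_comm]
    ring
  simp_rw [e]
  rw [integral_mul_const, h, heat, finrank_euclideanSpace_fin, Complex.I_sq]
  push_cast
  rw [Complex.ofReal_cpow (by positivity)]
  push_cast
  rw [show (-1 * (‖x‖ : ℂ) ^ 2 / (4 * t)) = -(1 / (4 * t)) * ‖x‖ ^ 2 by ring]
  ring

theorem integral_exp_neg_mul_Ioi {a b : ℝ} (hb : 0 < b) :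
    ∫ t in Set.Ioi a, Real.exp (-(t * b)) = Real.exp (-(a * b)) / b := by
  have := integral_exp_mul_Ioi (a := -b) (by linarith) a
  rw [show (fun t => Real.exp (-(t * b))) = fun t => Real.exp (-b * t) by ext; ring_nf, this]
  rw [neg_div_neg_eq]; ring_nf

theorem integrableOn_exp_neg_mul_Ioi {a b : ℝ} (hb : 0 < b) :
    IntegrableOn (fun t => Real.exp (-(t * b))) (Set.Ioi a) := by
  have := integrableOn_exp_mul_Ioi (a := -b) (by linarith) a
  exact this.congr_fun (fun t _ => by ring_nf) measurableSet_Ioi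

/-- Proper-time representation: with `a = 1 / Λ²`, `exp (-a (p² + m²)) / (p² + m²)` is the integral
of `exp (-t (p² + m²))` over `t > a`, and Fubini leaves a superposition of Gaussians in `x`.
Positivity and the total integral of the covariance become visible in this form. -/
theorem cov_eq_integral_heat (hm : 0 < m) (hΛ : 0 < Λ) (x : Pt d) :
    cov d m Λ x = ∫ t in Set.Ioi (1 / Λ ^ 2), heat d m t x := by
  set a := 1 / Λ ^ 2 with ha
  have ha0 : 0 < a := by positivity
  set F : Pt d → ℝ → ℂ := fun p t => Complex.exp (Complex.I * ((⟪p, x⟫ : ℝ) : ℂ)) *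
      ((Real.exp (-(t * (‖p‖ ^ 2 + m ^ 2))) / (2 * Real.pi) ^ d : ℝ) : ℂ) with hF
  have hpm : ∀ p : Pt d, 0 < ‖p‖ ^ 2 + m ^ 2 := fun p => by positivity
  have e1 : ∀ p : Pt d, ∫ t in Set.Ioi a, Real.exp (-(t * (‖p‖ ^ 2 + m ^ 2))) / (2 * Real.pi) ^ d =
      weight d m Λ p := by
    intro p
    rw [integral_div, integral_exp_neg_mul_Ioi (hpm p), weight, ha]
    congr 3
    ring
  have hFn : ∀ p t, ‖F p t‖ = Real.exp (-(t * (‖p‖ ^ 2 + m ^ 2))) / (2 * Real.pi) ^ d := by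
    intro p t
    simp only [hF]
    rw [norm_mul, mul_comm Complex.I, Complex.norm_exp_ofReal_mul_I, one_mul, Complex.norm_real,
      Real.norm_of_nonneg (by positivity)]
  have hint : Integrable (Function.uncurry F) (volume.prod (volume.restrict (Set.Ioi a))) := by
    have hc : Continuous (Function.uncurry F) := by
      simp only [hF, Function.uncurry_def]
      fun_prop
    rw [integrable_prod_iff hc.aestronglyMeasurable]
    refine ⟨ae_of_all _ fun p => ?_, ?_⟩
    · rw [← integrable_norm_iff (f := fun t => Function.uncurry F (p, t))
        (hc.comp (Continuous.prodMk_right p)).aestronglyMeasurable]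
      simp only [Function.uncurry_apply_pair, hFn]
      exact (integrableOn_exp_neg_mul_Ioi (hpm p)).div_const _
    · simp only [Function.uncurry_apply_pair, hFn, e1]
      exact integrable_weight hm hΛ
  have h := integral_integral_swap hint
  have l : ∀ p, ∫ t in Set.Ioi a, F p t =
      Complex.exp (Complex.I * ((⟪p, x⟫ : ℝ) : ℂ)) * (weight d m Λ p : ℂ) := by
    intro p
    simp only [hF]
    rw [integral_const_mul, integral_complex_ofReal, e1]
  have r : ∀ t ∈ Set.Ioi a, ∫ p, F p t = heat d m t x := fun t ht =>
    integral_exp_mul_heat_symbol (ha0.trans ht) x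
  simp_rw [l] at h
  rw [setIntegral_congr_fun measurableSet_Ioi r, integral_complex_ofReal] at h
  simp only [cov, weight] at h ⊢
  rw [h, Complex.ofReal_re]

theorem cov_nonneg (hm : 0 < m) (hΛ : 0 < Λ) (x : Pt d) : 0 ≤ cov d m Λ x := by
  rw [cov_eq_integral_heat hm hΛ]
  exact setIntegral_nonneg measurableSet_Ioi fun t ht =>
    heat_nonneg (lt_trans (by positivity) ht) x

/-- Each damped heat kernel has mass `exp (-t m²)`, and integrating over `t > 1 / Λ²` gives at most
`1 / m²`, uniformly in the cut-off. -/
theorem integrable_cov_and_integral_le (hm : 0 < m) (hΛ : 0 < Λ) :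
    Integrable (cov d m Λ) ∧ ∫ x, cov d m Λ x ≤ 1 / m ^ 2 := by
  set a := 1 / Λ ^ 2 with ha
  have ha0 : 0 < a := by positivity
  set H : ℝ → Pt d → ℝ := fun t x => heat d m t x with hH
  have hm2 : 0 < m ^ 2 := by positivity
  have hint : Integrable (Function.uncurry H) ((volume.restrict (Set.Ioi a)).prod volume) := by
    have hmeas : Measurable (Function.uncurry H) := by
      simp only [hH, heat, Function.uncurry_def]
      fun_prop
    rw [integrable_prod_iff hmeas.aestronglyMeasurable]
    refine ⟨?_, ?_⟩
    · filter_upwards [ae_restrict_mem measurableSet_Ioi] with t ht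
      exact integrable_heat (ha0.trans ht)
    · refine (integrableOn_exp_neg_mul_Ioi (a := a) hm2).congr_fun (fun t ht => ?_)
        measurableSet_Ioi
      have ht0 : 0 < t := ha0.trans ht
      simp only [Function.uncurry_apply_pair, hH, Real.norm_of_nonneg (heat_nonneg ht0 _)]
      exact (integral_heat ht0).symm
  have e : cov d m Λ = fun x => ∫ t in Set.Ioi a, H t x := by
    ext x; exact cov_eq_integral_heat hm hΛ x
  refine ⟨e ▸ hint.integral_prod_right, ?_⟩
  rw [e, ← integral_integral_swap hint,
    setIntegral_congr_fun measurableSet_Ioi fun t ht => integral_heat (ha0.trans ht),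
    integral_exp_neg_mul_Ioi hm2]
  gcongr
  rw [Real.exp_le_one_iff]
  nlinarith

/-- For `1 ≤ ‖p‖ ≤ Λ` the cut-off factor is at least `exp (-(1 + m²))` and `‖p‖² + m² ≤ (1 + m²)
‖p‖²`, so the weight dominates `c₁ / ‖p‖²`. In polar coordinates this leaves `r ^ (d - 1) / r²`,
which is at least `1 / r` because `d ≥ 2`; its integral over `[1, Λ]` is at least `log Λ`. -/
theorem exists_log_le_cov_zero (hd : 2 ≤ d) (hm : 0 < m) :
    ∃ c : ℝ, 0 < c ∧ ∀ Λ : ℝ, 0 < Λ → 1 ≤ Real.log Λ → c * Real.log Λ ≤ cov d m Λ 0 := by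
  set κ : ℝ := volume.real (Metric.ball (0 : Pt d) 1) with hκ
  have hκ0 : 0 < κ := by
    rw [hκ, measureReal_def]
    exact ENNReal.toReal_pos (Metric.measure_ball_pos _ _ one_pos).ne' measure_ball_lt_top.ne
  set c₁ : ℝ := Real.exp (-(1 + m ^ 2)) / (1 + m ^ 2) / (2 * Real.pi) ^ d with hc₁
  have hc₁0 : 0 < c₁ := by positivity
  have hd0 : (0 : ℝ) < d := by exact_mod_cast (by omega : 0 < d)
  refine ⟨d * κ * c₁, by positivity, fun Λ hΛ hlog => ?_⟩
  have hΛ1 : 1 ≤ Λ := by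
    by_contra hc
    have := Real.log_nonpos hΛ.le (not_le.1 hc).le
    linarith
  have : Nontrivial (Pt d) := by
    have : 0 < Module.finrank ℝ (Pt d) := by rw [finrank_euclideanSpace_fin]; omega
    exact Module.nontrivial_of_finrank_pos this
  set f : ℝ → ℝ := (Set.Icc 1 Λ).indicator fun r => c₁ / r ^ 2 with hf
  have hfd : ∀ r, r ∈ Set.Ioi (0 : ℝ) → r ^ (d - 1) • f r = (Set.Icc 1 Λ).indicator
      (fun r => r ^ (d - 1) * (c₁ / r ^ 2)) r := by
    intro r _
    by_cases hr : r ∈ Set.Icc 1 Λ <;> simp [hf, hr]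
  have hcont : ContinuousOn (fun r : ℝ => r ^ (d - 1) * (c₁ / r ^ 2)) (Set.Icc 1 Λ) := by
    have : ∀ r ∈ Set.Icc 1 Λ, r ^ 2 ≠ 0 := fun r hr => by have := hr.1; positivity
    fun_prop (disch := assumption)
  have hint : IntegrableOn (fun r : ℝ => r ^ (d - 1) * (c₁ / r ^ 2)) (Set.Icc 1 Λ) :=
    hcont.integrableOn_Icc
  have hfi : Integrable fun p : Pt d => f ‖p‖ := by
    rw [integrable_fun_norm_addHaar volume (f := f), finrank_euclideanSpace_fin,
      integrableOn_congr_fun hfd measurableSet_Ioi]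
    exact ((integrable_indicator_iff measurableSet_Icc).2 hint).integrableOn
  have hle : ∀ p : Pt d, f ‖p‖ ≤ weight d m Λ p := by
    intro p
    by_cases hp : ‖p‖ ∈ Set.Icc 1 Λ
    · simp only [hf, Set.indicator_of_mem hp, hc₁, weight]
      have h1 := hp.1
      rw [div_div, div_div, div_div]
      have e1 : Real.exp (-(1 + m ^ 2)) ≤ Real.exp (-(‖p‖ ^ 2 + m ^ 2) / Λ ^ 2) := by
        rw [Real.exp_le_exp, neg_div, neg_le_neg_iff, div_le_iff₀ (by positivity)]
        have : ‖p‖ ^ 2 ≤ Λ ^ 2 := by gcongr; exact hp.2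
        have : 1 ≤ Λ ^ 2 := one_le_pow₀ hΛ1
        nlinarith [sq_nonneg m]
      have e2 : ‖p‖ ^ 2 + m ^ 2 ≤ (1 + m ^ 2) * ‖p‖ ^ 2 := by
        have : 1 ≤ ‖p‖ ^ 2 := one_le_pow₀ h1
        nlinarith [sq_nonneg m]
      calc _ = Real.exp (-(1 + m ^ 2)) / (((1 + m ^ 2) * ‖p‖ ^ 2) * (2 * Real.pi) ^ d) := by
            ring_nf
        _ ≤ _ := by gcongr
    · simp only [hf, Set.indicator_of_notMem hp]
      exact weight_nonneg p
  have hval : ∫ p : Pt d, f ‖p‖ = d * κ * ∫ r in Set.Icc 1 Λ, r ^ (d - 1) * (c₁ / r ^ 2) := by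
    rw [integral_fun_norm_addHaar volume f, finrank_euclideanSpace_fin,
      setIntegral_congr_fun measurableSet_Ioi hfd, setIntegral_indicator measurableSet_Icc,
      Set.inter_eq_right.2 (show Set.Icc 1 Λ ⊆ Set.Ioi 0 from
        fun r hr => lt_of_lt_of_le one_pos hr.1)]
    simp [hκ, mul_assoc]
  have hlow : c₁ * Real.log Λ ≤ ∫ r in Set.Icc 1 Λ, r ^ (d - 1) * (c₁ / r ^ 2) := by
    have e : ∫ r in Set.Icc 1 Λ, c₁ * r⁻¹ = c₁ * Real.log Λ := by
      rw [integral_Icc_eq_integral_Ioc, ← intervalIntegral.integral_of_le hΛ1,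
        intervalIntegral.integral_const_mul, integral_inv_of_pos one_pos hΛ, div_one]
    rw [← e]
    refine setIntegral_mono_on ?_ hint measurableSet_Icc fun r hr => ?_
    · have : ∀ r ∈ Set.Icc 1 Λ, r ≠ 0 := fun r hr => by have := hr.1; positivity
      have hc : ContinuousOn (fun r : ℝ => c₁ * r⁻¹) (Set.Icc 1 Λ) := by
        fun_prop (disch := assumption)
      exact hc.integrableOn_Icc
    · have h1 : 1 ≤ r := hr.1
      have h2 : r ≤ r ^ (d - 1) := le_self_pow₀ h1 (by omega)
      calc c₁ * r⁻¹ = r * (c₁ / r ^ 2) := by field_simp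
        _ ≤ _ := by gcongr
  rw [cov_eq_integral_cos hm hΛ]
  simp only [inner_zero_right, Real.cos_zero, one_mul]
  calc d * κ * c₁ * Real.log Λ = d * κ * (c₁ * Real.log Λ) := by ring
    _ ≤ _ := mul_le_mul_of_nonneg_left hlow (by positivity)
    _ = ∫ p : Pt d, f ‖p‖ := hval.symm
    _ ≤ _ := integral_mono hfi (integrable_weight hm hΛ) hle

end Spectral

/-! ### Covariance forms expressed through a spectral measure. -/

section SpectralForm

variable {d : ℕ}

/-- The cosine transform of a test function. -/
def cosT (J : 𝓢(Pt d, ℝ)) (p : Pt d) : ℝ := ∫ x, J x * Real.cos ⟪p, x⟫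

/-- The sine transform of a test function. -/
def sinT (J : 𝓢(Pt d, ℝ)) (p : Pt d) : ℝ := ∫ x, J x * Real.sin ⟪p, x⟫

theorem integrable_mul_cos (J : 𝓢(Pt d, ℝ)) (p : Pt d) :
    Integrable fun x => J x * Real.cos ⟪p, x⟫ :=
  J.integrable.mul_bdd (c := 1) (Continuous.aestronglyMeasurable (by fun_prop))
    (ae_of_all _ fun x => Real.abs_cos_le_one _)

theorem integrable_mul_sin (J : 𝓢(Pt d, ℝ)) (p : Pt d) :
    Integrable fun x => J x * Real.sin ⟪p, x⟫ :=
  J.integrable.mul_bdd (c := 1) (Continuous.aestronglyMeasurable (by fun_prop))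
    (ae_of_all _ fun x => Real.abs_sin_le_one _)

theorem cosT_add (J K : 𝓢(Pt d, ℝ)) (p : Pt d) : cosT (J + K) p = cosT J p + cosT K p := by
  simp only [cosT, add_apply, add_mul]
  exact integral_add (integrable_mul_cos J p) (integrable_mul_cos K p)

theorem sinT_add (J K : 𝓢(Pt d, ℝ)) (p : Pt d) : sinT (J + K) p = sinT J p + sinT K p := by
  simp only [sinT, add_apply, add_mul]
  exact integral_add (integrable_mul_sin J p) (integrable_mul_sin K p)

theorem cosT_smul (c : ℝ) (J : 𝓢(Pt d, ℝ)) (p : Pt d) : cosT (c • J) p = c * cosT J p := by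
  simp only [cosT, smul_apply, smul_eq_mul, mul_assoc]
  exact integral_const_mul _ _

theorem sinT_smul (c : ℝ) (J : 𝓢(Pt d, ℝ)) (p : Pt d) : sinT (c • J) p = c * sinT J p := by
  simp only [sinT, smul_apply, smul_eq_mul, mul_assoc]
  exact integral_const_mul _ _

theorem continuous_cosT (J : 𝓢(Pt d, ℝ)) : Continuous (cosT J) := by
  refine continuous_of_dominated (bound := fun x => |J x|)
    (fun p => (integrable_mul_cos J p).aestronglyMeasurable)
    (fun p => ae_of_all _ fun x => ?_) J.integrable.norm (ae_of_all _ fun x => by fun_prop)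
  rw [Real.norm_eq_abs, abs_mul]
  exact mul_le_of_le_one_right (abs_nonneg _) (Real.abs_cos_le_one _)

theorem continuous_sinT (J : 𝓢(Pt d, ℝ)) : Continuous (sinT J) := by
  refine continuous_of_dominated (bound := fun x => |J x|)
    (fun p => (integrable_mul_sin J p).aestronglyMeasurable)
    (fun p => ae_of_all _ fun x => ?_) J.integrable.norm (ae_of_all _ fun x => by fun_prop)
  rw [Real.norm_eq_abs, abs_mul]
  exact mul_le_of_le_one_right (abs_nonneg _) (Real.abs_sin_le_one _)

theorem abs_cosT_le (J : 𝓢(Pt d, ℝ)) (p : Pt d) : |cosT J p| ≤ ∫ x, |J x| := by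
  refine abs_integral_le_integral_of_abs_le J.integrable.abs (ae_of_all _ fun x => ?_)
  rw [abs_mul]
  exact mul_le_of_le_one_right (abs_nonneg _) (Real.abs_cos_le_one _)

theorem abs_sinT_le (J : 𝓢(Pt d, ℝ)) (p : Pt d) : |sinT J p| ≤ ∫ x, |J x| := by
  refine abs_integral_le_integral_of_abs_le J.integrable.abs (ae_of_all _ fun x => ?_)
  rw [abs_mul]
  exact mul_le_of_le_one_right (abs_nonneg _) (Real.abs_sin_le_one _)

variable (μ : Measure (Pt d))

/-- The positive definite function with spectral measure `μ`. -/
def kern (x : Pt d) : ℝ := ∫ p, Real.cos ⟪p, x⟫ ∂μ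

/-- The covariance form with spectral measure `μ`. -/
def specForm (J K : 𝓢(Pt d, ℝ)) : ℝ := ∫ p, (cosT J p * cosT K p + sinT J p * sinT K p) ∂μ

/-- The potential of a test function: its convolution with `kern μ`. -/
def potential (J : 𝓢(Pt d, ℝ)) (y : Pt d) : ℝ :=
  ∫ p, (cosT J p * Real.cos ⟪p, y⟫ + sinT J p * Real.sin ⟪p, y⟫) ∂μ

theorem specForm_comm (J K : 𝓢(Pt d, ℝ)) : specForm μ J K = specForm μ K J := by
  simp only [specForm, mul_comm]

theorem specForm_smul_left (c : ℝ) (J K : 𝓢(Pt d, ℝ)) :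
    specForm μ (c • J) K = c * specForm μ J K := by
  simp only [specForm]
  rw [← integral_const_mul]
  simp only [cosT_smul, sinT_smul]
  congr 1; ext p; ring

theorem specForm_smul_right (c : ℝ) (J K : 𝓢(Pt d, ℝ)) :
    specForm μ J (c • K) = c * specForm μ J K := by
  simp only [specForm_comm μ J, specForm_smul_left]

theorem specForm_self_nonneg (J : 𝓢(Pt d, ℝ)) : 0 ≤ specForm μ J J :=
  integral_nonneg fun _ => add_nonneg (mul_self_nonneg _) (mul_self_nonneg _)

variable [IsFiniteMeasure μ]

theorem integrable_specForm (J K : 𝓢(Pt d, ℝ)) :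
    Integrable (fun p => cosT J p * cosT K p + sinT J p * sinT K p) μ := by
  have hb := fun J => ae_of_all μ (abs_cosT_le (d := d) J)
  have hb' := fun J => ae_of_all μ (abs_sinT_le (d := d) J)
  have hc := fun J => (continuous_cosT (d := d) J).aestronglyMeasurable (μ := μ)
  have hs := fun J => (continuous_sinT (d := d) J).aestronglyMeasurable (μ := μ)
  exact (((integrable_const _).mono' (hc K) (hb K)).bdd_mul (hc J) (hb J)).add
    (((integrable_const _).mono' (hs K) (hb' K)).bdd_mul (hs J) (hb' J))

theorem specForm_add_left (J J' K : 𝓢(Pt d, ℝ)) :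
    specForm μ (J + J') K = specForm μ J K + specForm μ J' K := by
  simp only [specForm]
  rw [← integral_add (integrable_specForm μ J K) (integrable_specForm μ J' K)]
  simp only [cosT_add, sinT_add]
  congr 1; ext p; ring

theorem specForm_add_right (J K K' : 𝓢(Pt d, ℝ)) :
    specForm μ J (K + K') = specForm μ J K + specForm μ J K' := by
  simp only [specForm_comm μ J, specForm_add_left]

theorem specForm_add_smul_self (t : ℝ) (J K : 𝓢(Pt d, ℝ)) :
    specForm μ (J + t • K) (J + t • K) =
      specForm μ J J + 2 * t * specForm μ J K + t ^ 2 * specForm μ K K := by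
  simp only [specForm_add_left, specForm_add_right, specForm_smul_left, specForm_smul_right,
    specForm_comm μ K J]
  ring

/-- Degenerate case of Cauchy–Schwarz: if the mixed term were nonzero, the chosen `t` would give the
form the value `-1` at `J + t • K`. -/
theorem specForm_eq_zero_of_self_eq_zero {K : 𝓢(Pt d, ℝ)} (hK : specForm μ K K = 0)
    (J : 𝓢(Pt d, ℝ)) : specForm μ J K = 0 := by
  by_contra h
  set t := -(specForm μ J J + 1) / (2 * specForm μ J K) with ht
  have h1 := specForm_self_nonneg μ (J + t • K)
  have h2 : 2 * t * specForm μ J K = -(specForm μ J J + 1) := by rw [ht]; field_simp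
  rw [specForm_add_smul_self, hK, h2] at h1
  linarith

theorem integrable_schwartz_mul_prod (J : 𝓢(Pt d, ℝ)) {F : Pt d × Pt d → ℝ}
    (hF : Continuous F) {c : ℝ} (hc : ∀ z, |F z| ≤ c) :
    Integrable (fun z : Pt d × Pt d => J z.2 * F z) (μ.prod volume) :=
  (J.integrable.comp_snd μ).mul_bdd hF.aestronglyMeasurable (ae_of_all _ hc)

theorem potential_eq_integral_kern (J : 𝓢(Pt d, ℝ)) (y : Pt d) :
    potential μ J y = ∫ x, kern μ (y - x) * J x := by
  have hint : Integrable (Function.uncurry fun p x : Pt d => J x * Real.cos ⟪p, y - x⟫)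
      (μ.prod volume) := integrable_schwartz_mul_prod μ J
        (F := fun z => Real.cos ⟪z.1, y - z.2⟫) (by fun_prop) (fun z => Real.abs_cos_le_one _)
  have h := integral_integral_swap hint
  rw [potential]
  calc _ = ∫ p, (∫ x, J x * Real.cos ⟪p, y - x⟫) ∂μ := by
        congr 1; ext p
        simp only [inner_sub_right, Real.cos_sub, mul_add]
        rw [cosT, sinT, ← integral_mul_const, ← integral_mul_const, ← integral_add
          ((integrable_mul_cos J p).mul_const _) ((integrable_mul_sin J p).mul_const _)]
        congr 1; ext x; ring
    _ = _ := by
        rw [h]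
        congr 1; ext x
        rw [integral_const_mul, kern, mul_comm]

theorem specForm_eq_integral_potential (J K : 𝓢(Pt d, ℝ)) :
    specForm μ J K = ∫ y, K y * potential μ J y := by
  have hJ : ∀ z : Pt d × Pt d, |cosT J z.1 * Real.cos ⟪z.1, z.2⟫ +
      sinT J z.1 * Real.sin ⟪z.1, z.2⟫| ≤ (∫ x, |J x|) + ∫ x, |J x| := by
    intro z
    refine (abs_add_le _ _).trans (add_le_add ?_ ?_) <;> rw [abs_mul]
    · exact (mul_le_of_le_one_right (abs_nonneg _) (Real.abs_cos_le_one _)).trans (abs_cosT_le _ _)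
    · exact (mul_le_of_le_one_right (abs_nonneg _) (Real.abs_sin_le_one _)).trans (abs_sinT_le _ _)
  have hint : Integrable (Function.uncurry fun p y : Pt d => K y *
      (cosT J p * Real.cos ⟪p, y⟫ + sinT J p * Real.sin ⟪p, y⟫)) (μ.prod volume) := by
    have h1 := continuous_cosT J
    have h2 := continuous_sinT J
    exact integrable_schwartz_mul_prod μ K (F := fun z => cosT J z.1 * Real.cos ⟪z.1, z.2⟫ +
      sinT J z.1 * Real.sin ⟪z.1, z.2⟫) (by fun_prop) hJ
  have h := integral_integral_swap hint
  rw [specForm]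
  calc _ = ∫ p, (∫ y, K y * (cosT J p * Real.cos ⟪p, y⟫ + sinT J p * Real.sin ⟪p, y⟫)) ∂μ := by
        congr 1; ext p
        rw [cosT.eq_def K, sinT.eq_def K, ← integral_const_mul, ← integral_const_mul,
          ← integral_add ((integrable_mul_cos K p).const_mul _)
            ((integrable_mul_sin K p).const_mul _)]
        congr 1; ext x; ring
    _ = _ := by
        rw [h]
        congr 1; ext y
        rw [integral_const_mul, potential]

theorem continuous_kern : Continuous (kern μ) :=
  continuous_of_dominated (bound := fun _ => 1)
    (fun x => Continuous.aestronglyMeasurable (by fun_prop))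
    (fun x => ae_of_all _ fun p => Real.abs_cos_le_one _) (integrable_const _)
    (ae_of_all _ fun p => by fun_prop)

theorem continuous_potential (J : 𝓢(Pt d, ℝ)) : Continuous (potential μ J) := by
  have h1 := continuous_cosT J
  have h2 := continuous_sinT J
  refine continuous_of_dominated (bound := fun _ => (∫ x, |J x|) + ∫ x, |J x|)
    (fun x => Continuous.aestronglyMeasurable (by fun_prop))
    (fun x => ae_of_all _ fun p => ?_) (integrable_const _)
    (ae_of_all _ fun p => by fun_prop)
  refine (norm_add_le _ _).trans (add_le_add ?_ ?_) <;> rw [norm_mul]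
  · exact (mul_le_of_le_one_right (abs_nonneg _) (Real.abs_cos_le_one _)).trans (abs_cosT_le _ _)
  · exact (mul_le_of_le_one_right (abs_nonneg _) (Real.abs_sin_le_one _)).trans (abs_sinT_le _ _)

theorem abs_potential_le (J : 𝓢(Pt d, ℝ)) (y : Pt d) :
    |potential μ J y| ≤ (2 * ∫ x, |J x|) * μ.real Set.univ := by
  rw [← Real.norm_eq_abs, potential]
  refine (norm_integral_le_of_norm_le_const (C := 2 * ∫ x, |J x|) (ae_of_all μ fun p => ?_))
  rw [two_mul]
  refine (norm_add_le _ _).trans (add_le_add ?_ ?_) <;> rw [norm_mul]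
  · exact (mul_le_of_le_one_right (abs_nonneg _) (Real.abs_cos_le_one _)).trans (abs_cosT_le _ _)
  · exact (mul_le_of_le_one_right (abs_nonneg _) (Real.abs_sin_le_one _)).trans (abs_sinT_le _ _)

end SpectralForm

/-! ### The free measure as a Gaussian field with finite spectral measure. -/

section FreeMeasure

variable {d : ℕ} {m Λ Z : ℝ}

/-- The spectral measure of the covariance `Z C_Λ`. -/
def specMeas (d : ℕ) (m Λ Z : ℝ) : Measure (Pt d) :=
  volume.withDensity fun p => ENNReal.ofReal (Z * weight d m Λ p)

theorem isFiniteMeasure_specMeas (hm : 0 < m) (hΛ : 0 < Λ) :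
    IsFiniteMeasure (specMeas d m Λ Z) :=
  isFiniteMeasure_withDensity_ofReal ((integrable_weight hm hΛ).const_mul Z).2

theorem integral_specMeas (hm : 0 < m) (hZ : 0 < Z) (f : Pt d → ℝ) :
    ∫ p, f p ∂(specMeas d m Λ Z) = ∫ p, Z * weight d m Λ p * f p := by
  have hw := (continuous_weight (d := d) (Λ := Λ) hm).measurable
  rw [specMeas, integral_withDensity_eq_integral_toReal_smul (by fun_prop)
    (ae_of_all _ fun _ => ENNReal.ofReal_lt_top)]
  congr 1; ext p
  rw [ENNReal.toReal_ofReal (mul_nonneg hZ.le (weight_nonneg p)), smul_eq_mul]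

theorem kern_specMeas (hm : 0 < m) (hΛ : 0 < Λ) (hZ : 0 < Z) (x : Pt d) :
    kern (specMeas d m Λ Z) x = Z * cov d m Λ x := by
  rw [kern, integral_specMeas hm hZ, cov_eq_integral_cos hm hΛ, ← integral_const_mul]
  congr 1; ext p; ring

theorem integrable_pow_specMeas (hm : 0 < m) (hΛ : 0 < Λ) (hZ : 0 < Z) (N : ℕ) :
    Integrable (fun p : Pt d => (1 + ‖p‖) ^ N) (specMeas d m Λ Z) := by
  have hw := (continuous_weight (d := d) (Λ := Λ) hm).measurable
  rw [specMeas, integrable_withDensity_iff (by fun_prop)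
    (ae_of_all _ fun _ => ENNReal.ofReal_lt_top)]
  refine ((integrable_pow_mul_weight (d := d) hm hΛ N).const_mul Z).congr (ae_of_all _ fun p => ?_)
  simp only [ENNReal.toReal_ofReal (mul_nonneg hZ.le (weight_nonneg (m := m) (Λ := Λ) p))]
  ring

/-- Fubini turns the position-space double integral into a spectral integral of squares of cosine
and sine transforms, which makes its nonnegativity evident. -/
theorem covForm_eq_specForm (hm : 0 < m) (hΛ : 0 < Λ) (hZ : 0 < Z) (J : 𝓢(Pt d, ℝ)) :
    covForm d m Λ Z J = specForm (specMeas d m Λ Z) J J := by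
  have := isFiniteMeasure_specMeas (d := d) (Z := Z) hm hΛ
  rw [specForm_eq_integral_potential, covForm]
  simp only [potential_eq_integral_kern, kern_specMeas hm hΛ hZ]

/-- `ν` is the centred Gaussian measure with spectral measure `μ`. -/
structure IsGaussianField (μ : Measure (Pt d)) (ν : Measure (FieldConfig d)) : Prop where
  isProbabilityMeasure : IsProbabilityMeasure ν
  charFunctional : ∀ J : 𝓢(Pt d, ℝ),
    ∫ φ : FieldConfig d, Complex.exp (Complex.I * ((φ J : ℝ) : ℂ)) ∂ν =
      Complex.exp (-(1 / 2) * (specForm μ J J : ℝ))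

theorem IsFreeMeasure.isGaussianField (hm : 0 < m) (hΛ : 0 < Λ) (hZ : 0 < Z)
    {ν : Measure (FieldConfig d)} (h : IsFreeMeasure d m Λ Z ν) :
    IsGaussianField (specMeas d m Λ Z) ν where
  isProbabilityMeasure := h.isProbabilityMeasure
  charFunctional J := by
    rw [h.charFunctional, covForm_eq_specForm hm hΛ hZ]
    push_cast
    rfl

end FreeMeasure

/-! ### Marginals, independence and the Cameron–Martin shift of the field. -/

section GaussianField

variable {d : ℕ} {μ : Measure (Pt d)} {ν : Measure (FieldConfig d)}

theorem measurable_eval (J : 𝓢(Pt d, ℝ)) : Measurable fun φ : FieldConfig d => φ J :=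
  (comap_measurable (fun φ : FieldConfig d => φ J)).mono
    (le_iSup (fun J : 𝓢(Pt d, ℝ) =>
      MeasurableSpace.comap (fun φ : FieldConfig d => φ J) inferInstance) J) le_rfl

namespace IsGaussianField

theorem map_eval (h : IsGaussianField μ ν) (J : 𝓢(Pt d, ℝ)) :
    ν.map (fun φ => φ J) = gaussianReal 0 (specForm μ J J).toNNReal := by
  have := h.isProbabilityMeasure
  have hm := measurable_eval J
  have := Measure.isProbabilityMeasure_map (μ := ν) hm.aemeasurable
  refine Measure.ext_of_charFun (funext fun t => ?_)
  rw [charFun_gaussianReal, charFun_apply_real, integral_map hm.aemeasurable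
    (Continuous.aestronglyMeasurable (by fun_prop))]
  have := h.charFunctional (t • J)
  simp only [map_smul, specForm_smul_left, specForm_smul_right, smul_eq_mul] at this
  rw [Real.coe_toNNReal _ (specForm_self_nonneg μ J)]
  convert! this using 1
  · congr 1; ext φ; push_cast; ring_nf
  · push_cast; ring_nf

theorem memLp_eval (h : IsGaussianField μ ν) (J : 𝓢(Pt d, ℝ)) :
    MemLp (fun φ : FieldConfig d => φ J) 2 ν := by
  have : MeasurePreserving (fun φ : FieldConfig d => φ J) ν
    (gaussianReal 0 (specForm μ J J).toNNReal) := ⟨measurable_eval J, h.map_eval J⟩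
  exact (memLp_id_gaussianReal' 2 (by simp)).comp_measurePreserving this

theorem integral_eval_sq (h : IsGaussianField μ ν) (J : 𝓢(Pt d, ℝ)) :
    ∫ φ : FieldConfig d, φ J ^ 2 ∂ν = specForm μ J J := by
  have e := integral_map (μ := ν) (measurable_eval J).aemeasurable (f := fun x : ℝ => x ^ 2)
    (by fun_prop)
  rw [← e, h.map_eval J]
  have := variance_id_gaussianReal (μ := 0) (v := (specForm μ J J).toNNReal)
  rw [variance_eq_sub (memLp_id_gaussianReal' 2 (by simp))] at this
  simpa [integral_id_gaussianReal, specForm_self_nonneg μ J] using this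

theorem integral_eval_mul_eval [IsFiniteMeasure μ] (h : IsGaussianField μ ν)
    (J K : 𝓢(Pt d, ℝ)) : ∫ φ : FieldConfig d, φ J * φ K ∂ν = specForm μ J K := by
  have e1 := h.integral_eval_sq (J + (1 : ℝ) • K)
  rw [specForm_add_smul_self] at e1
  have i1 := (h.memLp_eval J).integrable_sq
  have i2 := (h.memLp_eval K).integrable_sq
  have i3 : Integrable (fun φ : FieldConfig d => φ J * φ K) ν := (h.memLp_eval J).integrable_mul (h.memLp_eval K)
  have e2 : ∀ φ : FieldConfig d, φ (J + (1 : ℝ) • K) ^ 2 =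
      (φ J ^ 2 + φ K ^ 2) + 2 * (φ J * φ K) := by
    intro φ
    rw [map_add, map_smul, one_smul]; ring
  have i4 : Integrable (fun φ : FieldConfig d => φ J ^ 2 + φ K ^ 2) ν := i1.add i2
  simp_rw [e2] at e1
  rw [integral_add i4 (i3.const_mul 2), integral_add i1 i2, h.integral_eval_sq,
    h.integral_eval_sq, integral_const_mul] at e1
  linarith

theorem integrable_exp_eval (h : IsGaussianField μ ν) (J : 𝓢(Pt d, ℝ)) :
    Integrable (fun φ : FieldConfig d => Real.exp (φ J)) ν := by
  have := integrable_exp_mul_gaussianReal (μ := 0) (v := (specForm μ J J).toNNReal) 1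
  rw [← h.map_eval J] at this
  simpa [Function.comp_def] using this.comp_measurable (measurable_eval J)

/-- Uncorrelated jointly Gaussian variables: without the cross term the joint characteristic
function factorizes. -/
theorem indepFun_eval [IsFiniteMeasure μ] (h : IsGaussianField μ ν) {J K : 𝓢(Pt d, ℝ)}
    (hJK : specForm μ J K = 0) :
    IndepFun (fun φ : FieldConfig d => φ J) (fun φ : FieldConfig d => φ K) ν := by
  have := h.isProbabilityMeasure
  have hJ := measurable_eval J
  have hK := measurable_eval K
  have hpair : Measurable fun φ : FieldConfig d => WithLp.toLp 2 (φ J, φ K) :=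
    (WithLp.measurable_toLp 2 (ℝ × ℝ)).comp (hJ.prodMk hK)
  rw [indepFun_iff_charFun_prod hJ.aemeasurable hK.aemeasurable]
  intro t
  rw [h.map_eval, h.map_eval, charFun_gaussianReal, charFun_gaussianReal, charFun_apply,
    integral_map hpair.aemeasurable (Continuous.aestronglyMeasurable (by fun_prop)), ← Complex.exp_add,
    Real.coe_toNNReal _ (specForm_self_nonneg μ J), Real.coe_toNNReal _ (specForm_self_nonneg μ K)]
  have := h.charFunctional (t.ofLp.1 • J + t.ofLp.2 • K)
  rw [specForm_add_smul_self, specForm_smul_left, specForm_smul_left, specForm_smul_right, hJK]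
    at this
  simp only [map_add, map_smul, smul_eq_mul] at this
  convert! this using 1
  · congr 1; ext φ
    simp only [WithLp.prod_inner_apply, RCLike.inner_apply, conj_trivial]
    push_cast; ring_nf
  · push_cast; ring_nf

/-- Cameron–Martin for the field: `K` splits into a multiple of `J` and a part `K'` orthogonal to
`J`. Then `φ K'` is independent of `φ J` and unaffected by the tilt, while the rest is a
one-dimensional Gaussian moment generating function at a complex argument. The covariance stays and
a mean `specForm μ K J` appears. -/
theorem integral_cexp_tilted [IsFiniteMeasure μ] (h : IsGaussianField μ ν) (J K : 𝓢(Pt d, ℝ)) :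
    ∫ φ : FieldConfig d, Complex.exp (Complex.I * ((φ K : ℝ) : ℂ)) ∂(ν.tilted fun φ => φ J) =
      Complex.exp (-(1 / 2) * (specForm μ K K : ℝ) + Complex.I * (specForm μ K J : ℝ)) := by
  have := h.isProbabilityMeasure
  set s := specForm μ J J with hs
  -- If `s = 0` the quotient is `0` by convention, and `a * s = specForm μ K J` still holds because
  -- `J` is then orthogonal to everything.
  set a : ℝ := specForm μ K J / s with ha
  have has : a * s = specForm μ K J := by
    rcases eq_or_ne s 0 with h0 | h0
    · rw [h0, mul_zero, specForm_eq_zero_of_self_eq_zero μ h0]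
    · rw [ha]; field_simp
  set K' := K + (-a) • J with hK'
  have h0 : specForm μ K' J = 0 := by
    rw [hK', specForm_add_left, specForm_smul_left, ← has]; ring
  have hK'K' : specForm μ K' K' = specForm μ K K - a * specForm μ K J := by
    rw [hK', specForm_add_smul_self, ← hs]
    linear_combination (a) * has
  have hmgf : ∀ z : ℂ, ∫ φ : FieldConfig d, Complex.exp (z * ((φ J : ℝ) : ℂ)) ∂ν =
      Complex.exp (s * z ^ 2 / 2) := by
    intro z
    have := complexMGF_gaussianReal (h.map_eval J) z
    rw [Real.coe_toNNReal _ (specForm_self_nonneg μ J)] at this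
    simpa [complexMGF] using this
  have hnorm : ((∫ φ : FieldConfig d, Real.exp (φ J) ∂ν : ℝ) : ℂ) = Complex.exp (s / 2) := by
    rw [← integral_complex_ofReal]
    simpa using hmgf 1
  have hind := (h.indepFun_eval h0).comp
    (φ := fun x : ℝ => Complex.exp (Complex.I * x))
    (ψ := fun x : ℝ => Complex.exp ((1 + Complex.I * a) * x)) (by fun_prop) (by fun_prop)
  have hprod := hind.integral_mul_eq_mul_integral
    ((by fun_prop : Measurable fun x : ℝ => Complex.exp (Complex.I * x)).comp
      (measurable_eval K')).aestronglyMeasurable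
    ((by fun_prop : Measurable fun x : ℝ => Complex.exp ((1 + Complex.I * a) * x)).comp
      (measurable_eval J)).aestronglyMeasurable
  simp only [Function.comp_def, Pi.mul_apply] at hprod
  rw [h.charFunctional K', hmgf] at hprod
  rw [integral_tilted]
  have e : ∀ φ : FieldConfig d, (Real.exp (φ J) / ∫ φ : FieldConfig d, Real.exp (φ J) ∂ν) •
      Complex.exp (Complex.I * ((φ K : ℝ) : ℂ)) = Complex.exp (-(s / 2)) *
      (Complex.exp (Complex.I * ((φ K' : ℝ) : ℂ)) *
        Complex.exp ((1 + Complex.I * a) * ((φ J : ℝ) : ℂ))) := by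
    intro φ
    rw [Complex.real_smul, Complex.ofReal_div, hnorm, Complex.ofReal_exp, ← Complex.exp_sub,
      ← Complex.exp_add, ← Complex.exp_add, ← Complex.exp_add]
    congr 1
    simp only [hK', map_add, map_smul, smul_eq_mul]
    push_cast; ring
  simp_rw [e]
  rw [integral_const_mul, hprod, hK'K', ← Complex.exp_add, ← Complex.exp_add, ← has]
  congr 1
  push_cast
  linear_combination (-(a : ℂ) ^ 2 * s / 2) * (-1) * Complex.I_sq
  
end IsGaussianField

end GaussianField

/-! ### Topology of Schwartz space: translations and separability on balls. -/

section Schwartz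

open Filter Topology

variable {V F : Type*} [NormedAddCommGroup V] [NormedSpace ℝ V]
  [NormedAddCommGroup F] [NormedSpace ℝ F]

/-- Translation is a continuous family of operators on Schwartz space. -/
theorem continuous_compSubConstCLM (f : 𝓢(V, F)) :
    Continuous fun a : V => f.compSubConstCLM ℝ a := by
  rw [continuous_iff_continuousAt]
  intro a₀
  rw [ContinuousAt, (schwartz_withSeminorms ℝ V F).tendsto_nhds]
  rintro ⟨k, n⟩ ε hε
  set S : ℝ := 2 ^ k * (Finset.Iic (k, n + 1)).sup (fun m => SchwartzMap.seminorm ℝ m.1 m.2) f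
    with hS
  have hS0 : 0 ≤ S := by rw [hS]; positivity
  have hf : ∀ x, (1 + ‖x‖) ^ k * ‖iteratedFDeriv ℝ (n + 1) f x‖ ≤ S := fun x =>
    SchwartzMap.one_add_le_sup_seminorm_apply (𝕜 := ℝ) (m := (k, n + 1)) le_rfl le_rfl f x
  set C : ℝ := S * (2 + ‖a₀‖) ^ k with hC
  have hC0 : 0 ≤ C := by positivity
  -- Mean value inequality on the unit ball about `x - a₀`: one more derivative is spent, and the
  -- weight at `x` is comparable with the weight at every point of that ball.
  have key : ∀ a, ‖a - a₀‖ ≤ 1 →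
      SchwartzMap.seminorm ℝ k n (f.compSubConstCLM ℝ a - f.compSubConstCLM ℝ a₀) ≤
        C * ‖a - a₀‖ := by
    intro a ha
    refine SchwartzMap.seminorm_le_bound ℝ k n _ (by positivity) fun x => ?_
    have e : iteratedFDeriv ℝ n (f.compSubConstCLM ℝ a - f.compSubConstCLM ℝ a₀ : 𝓢(V, F)) x =
        iteratedFDeriv ℝ n f (x - a) - iteratedFDeriv ℝ n f (x - a₀) := by
      rw [← iteratedFDeriv_comp_sub, ← iteratedFDeriv_comp_sub]
      exact iteratedFDeriv_sub_apply
        ((f.compSubConstCLM ℝ a).contDiffAt n) ((f.compSubConstCLM ℝ a₀).contDiffAt n)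
    have hd : ∀ y ∈ Metric.closedBall (x - a₀) 1, ‖fderiv ℝ (iteratedFDeriv ℝ n f) y‖ ≤
        C / (1 + ‖x‖) ^ k := by
      intro y hy
      rw [norm_fderiv_iteratedFDeriv, le_div_iff₀ (by positivity)]
      have h1 : 1 + ‖x‖ ≤ (1 + ‖y‖) * (2 + ‖a₀‖) := by
        have : ‖x‖ ≤ ‖y‖ + ‖a₀‖ + 1 := by
          have h2 : ‖x - a₀ - y‖ ≤ 1 := by
            rw [← dist_eq_norm, dist_comm]; exact hy
          calc ‖x‖ = ‖y + a₀ + (x - a₀ - y)‖ := by congr 1; abel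
            _ ≤ _ := (norm_add_le _ _).trans (add_le_add (norm_add_le _ _) h2)
        nlinarith [norm_nonneg y, norm_nonneg a₀]
      calc _ ≤ ‖iteratedFDeriv ℝ (n + 1) f y‖ * ((1 + ‖y‖) * (2 + ‖a₀‖)) ^ k := by gcongr
        _ = ((1 + ‖y‖) ^ k * ‖iteratedFDeriv ℝ (n + 1) f y‖) * (2 + ‖a₀‖) ^ k := by
          rw [mul_pow]; ring
        _ ≤ _ := by rw [hC]; gcongr; exact hf y
    have hmv := (convex_closedBall (x - a₀) 1).norm_image_sub_le_of_norm_fderiv_le (𝕜 := ℝ)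
      (f := iteratedFDeriv ℝ n f) (x := x - a₀) (y := x - a)
      (fun y _ => ((f.smooth (n + 1 : ℕ)).differentiable_iteratedFDeriv
        (by exact_mod_cast Nat.lt_succ_self n)) y) hd (by simp)
      (by rw [Metric.mem_closedBall, dist_eq_norm, sub_sub_sub_cancel_left, norm_sub_rev]; exact ha)
    rw [e]
    rw [sub_sub_sub_cancel_left, norm_sub_rev a₀ a] at hmv
    calc _ ≤ (1 + ‖x‖) ^ k * (C / (1 + ‖x‖) ^ k * ‖a - a₀‖) := by
          gcongr
          linarith
      _ = _ := by field_simp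
  have ht : Tendsto (fun a => C * ‖a - a₀‖) (𝓝 a₀) (𝓝 0) := by
    have : Continuous fun a => C * ‖a - a₀‖ := by fun_prop
    simpa using this.tendsto a₀
  filter_upwards [ht.eventually_lt_const hε, Metric.closedBall_mem_nhds a₀ one_pos] with a h1 h2
  exact (key a (by rwa [← dist_eq_norm])).trans_lt h1

variable [FiniteDimensional ℝ V]

/-- The derivatives of a Schwartz function as continuous maps. -/
def derivSeq (f : 𝓢(V, F)) (n : ℕ) : C(V, ContinuousMultilinearMap ℝ (fun _ : Fin n => V) F) :=
  ⟨iteratedFDeriv ℝ n f, (f.smooth n).continuous_iteratedFDeriv le_rfl⟩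

/-- On functions supported in a fixed ball, the Schwartz topology is that of locally uniform
convergence of all derivatives. -/
theorem tendsto_of_tendsto_derivSeq {r : ℝ} {s : Set 𝓢(V, F)}
    (hs : ∀ f ∈ s, tsupport f ⊆ Metric.closedBall 0 r) {g : 𝓢(V, F)} (hg : g ∈ s) :
    Tendsto id (comap derivSeq (𝓝 (derivSeq g)) ⊓ 𝓟 s) (𝓝 g) := by
  rw [(schwartz_withSeminorms ℝ V F).tendsto_nhds]
  rintro ⟨k, n⟩ ε hε
  have h1 : Tendsto (fun f : 𝓢(V, F) => derivSeq f n) (comap derivSeq (𝓝 (derivSeq g)))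
      (𝓝 (derivSeq g n)) :=
    ((continuous_apply n).tendsto (derivSeq g)).comp tendsto_comap
  rw [ContinuousMap.tendsto_iff_forall_isCompact_tendstoUniformlyOn] at h1
  have := FiniteDimensional.proper_real V
  have h2 := h1 _ (isCompact_closedBall (0 : V) r)
  rw [Metric.tendstoUniformlyOn_iff] at h2
  set δ := ε / 2 / (|r| ^ k + 1) with hδ
  have hδ0 : 0 < δ := by positivity
  filter_upwards [mem_inf_of_left (h2 δ hδ0), mem_inf_of_right (mem_principal_self s)] with f hf hfs
  refine lt_of_le_of_lt (SchwartzMap.seminorm_le_bound ℝ k n _ (half_pos hε).le fun x => ?_)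
    (half_lt_self hε)
  have e : iteratedFDeriv ℝ n (f - g : 𝓢(V, F)) x =
      iteratedFDeriv ℝ n f x - iteratedFDeriv ℝ n g x :=
    iteratedFDeriv_sub_apply (f.contDiffAt n) (g.contDiffAt n)
  rw [id, e]
  by_cases hx : x ∈ Metric.closedBall (0 : V) r
  · have h3 : ‖iteratedFDeriv ℝ n f x - iteratedFDeriv ℝ n g x‖ ≤ δ := by
      have := hf x hx
      rw [dist_comm, dist_eq_norm] at this
      exact this.le
    have h4 : ‖x‖ ≤ |r| := (mem_closedBall_zero_iff.1 hx).trans (le_abs_self r)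
    calc _ ≤ |r| ^ k * δ := by gcongr
      _ ≤ (|r| ^ k + 1) * δ := by gcongr; linarith
      _ = ε / 2 := by rw [hδ]; field_simp
  · have z : ∀ f ∈ s, iteratedFDeriv ℝ n f x = 0 := fun f hf => by
      by_contra hne
      exact hx (hs f hf (support_iteratedFDeriv_subset n hne))
    rw [z f hfs, z g hg]
    simpa using (half_pos hε).le

variable [FiniteDimensional ℝ F]

/-- Schwartz functions supported in a fixed ball form a separable set. -/
theorem exists_countable_dense_of_tsupport_subset {r : ℝ} {s : Set 𝓢(V, F)}
    (hs : ∀ f ∈ s, tsupport f ⊆ Metric.closedBall 0 r) :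
    ∃ D ⊆ s, D.Countable ∧ s ⊆ closure D := by
  have := FiniteDimensional.proper_real V
  have : ∀ n : ℕ, SecondCountableTopology (ContinuousMultilinearMap ℝ (fun _ : Fin n => V) F) :=
    fun n => by
      have : FiniteDimensional ℝ (ContinuousMultilinearMap ℝ (fun _ : Fin n => V) F) :=
        FiniteDimensional.of_injective (ContinuousMultilinearMap.toMultilinearMapLinear :
          ContinuousMultilinearMap ℝ (fun _ : Fin n => V) F →ₗ[ℝ]
            MultilinearMap ℝ (fun _ : Fin n => V) F)
          ContinuousMultilinearMap.toMultilinearMap_injective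
      have := FiniteDimensional.proper_real (ContinuousMultilinearMap ℝ (fun _ : Fin n => V) F)
      infer_instance
  -- The sequences of derivatives live in a second countable space, so the image of `s` is
  -- separable. A countable dense set there is lifted by chosen preimages, and
  -- `tendsto_of_tendsto_derivSeq` transfers its density back to `s`.
  obtain ⟨c, hc, hcd⟩ := TopologicalSpace.exists_countable_dense
    ((derivSeq : 𝓢(V, F) → _) '' s)
  choose! pre hpre using fun y : (derivSeq : 𝓢(V, F) → _) '' s => y.2
  refine ⟨pre '' c, ?_, hc.image _, fun g hg => ?_⟩
  · rintro _ ⟨y, _, rfl⟩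
    exact (hpre y).1
  have hgc : derivSeq g ∈ closure (derivSeq '' (pre '' c)) := by
    have h1 := hcd ⟨derivSeq g, Set.mem_image_of_mem _ hg⟩
    have h2 := image_closure_subset_closure_image continuous_subtype_val
      (Set.mem_image_of_mem Subtype.val h1)
    have e : derivSeq '' (pre '' c) = Subtype.val '' c := by
      rw [Set.image_image]
      exact Set.image_congr fun y _ => (hpre y).2
    rw [e]
    exact h2
  have hsub : pre '' c ⊆ s := by
    rintro _ ⟨y, _, rfl⟩
    exact (hpre y).1
  have hne : (comap derivSeq (𝓝 (derivSeq g)) ⊓ 𝓟 (pre '' c)).NeBot := by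
    rw [mem_closure_iff_clusterPt, ClusterPt] at hgc
    exact (comap_inf_principal_neBot_of_image_mem hgc
      (mem_inf_of_right (mem_principal_self _))).mono (inf_le_inf_right _ (comap_mono inf_le_left))
  refine mem_closure_of_tendsto ((tendsto_of_tendsto_derivSeq hs hg).mono_left
    (inf_le_inf_left _ (principal_mono.2 hsub))) (mem_inf_of_right (mem_principal_self _))

end Schwartz

/-! ### Modulated test functions and the decay of their variances in the frequency. -/

section Modulation

open scoped FourierTransform

variable {d : ℕ}

/-- A real Schwartz function regarded as a complex one. -/
def complexify (J : 𝓢(Pt d, ℝ)) : 𝓢(Pt d, ℂ) := J.postcompCLM (𝕜 := ℝ) Complex.ofRealCLM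

theorem complexify_apply (J : 𝓢(Pt d, ℝ)) (x : Pt d) : complexify J x = (J x : ℂ) := rfl

theorem fourier_complexify (J : 𝓢(Pt d, ℝ)) (k : Pt d) :
    𝓕 (complexify J) k = (cosT J ((2 * Real.pi) • k) : ℂ) - Complex.I * sinT J ((2 * Real.pi) • k) := by
  rw [SchwartzMap.fourier_coe, Real.fourier_eq', cosT, sinT, ← integral_complex_ofReal,
    ← integral_complex_ofReal, ← integral_const_mul,
    ← integral_sub (integrable_mul_cos J _).ofReal ((integrable_mul_sin J _).ofReal.const_mul _)]
  congr 1; ext x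
  rw [complexify_apply, Complex.exp_mul_I, smul_eq_mul, real_inner_smul_left, real_inner_comm,
    show -2 * Real.pi * ⟪k, x⟫ = -(2 * Real.pi * ⟪k, x⟫) by ring]
  push_cast
  rw [Complex.cos_neg, Complex.sin_neg]
  ring

theorem integrable_fourier_complexify (J : 𝓢(Pt d, ℝ)) :
    Integrable fun k => 𝓕 (complexify J) k := (𝓕 (complexify J)).integrable

theorem re_fourier_complexify (J : 𝓢(Pt d, ℝ)) (k : Pt d) :
    (𝓕 (complexify J) k).re = cosT J ((2 * Real.pi) • k) := by
  rw [fourier_complexify]; simp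

theorem im_fourier_complexify (J : 𝓢(Pt d, ℝ)) (k : Pt d) :
    (𝓕 (complexify J) k).im = -sinT J ((2 * Real.pi) • k) := by
  rw [fourier_complexify]; simp

theorem integrable_cosT (J : 𝓢(Pt d, ℝ)) : Integrable fun k => cosT J ((2 * Real.pi) • k) := by
  simpa only [RCLike.re_to_complex, re_fourier_complexify]
    using (integrable_fourier_complexify J).re

theorem integrable_sinT (J : 𝓢(Pt d, ℝ)) : Integrable fun k => sinT J ((2 * Real.pi) • k) := by
  simpa [RCLike.im_to_complex, im_fourier_complexify]
    using (integrable_fourier_complexify J).im.neg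

/-- Real form of the Fourier inversion formula. -/
theorem integral_cosT_sinT (J : 𝓢(Pt d, ℝ)) (x : Pt d) :
    ∫ k, (cosT J ((2 * Real.pi) • k) * Real.cos (2 * Real.pi * ⟪k, x⟫) +
      sinT J ((2 * Real.pi) • k) * Real.sin (2 * Real.pi * ⟪k, x⟫)) = J x := by
  have h : 𝓕⁻ (𝓕 (complexify J)) x = complexify J x := by
    rw [FourierPair.fourierInv_fourier_eq]
  rw [SchwartzMap.fourierInv_coe, Real.fourierInv_eq', complexify_apply] at h
  have hi : Integrable fun k => Complex.exp (((2 * Real.pi * ⟪k, x⟫ : ℝ) : ℂ) * Complex.I) •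
      𝓕 (complexify J) k :=
    (integrable_fourier_complexify J).bdd_mul (c := 1)
      (Continuous.aestronglyMeasurable (by fun_prop))
      (ae_of_all _ fun k => by rw [Complex.norm_exp_ofReal_mul_I])
  have h2 := integral_re hi
  simp only [RCLike.re_to_complex] at h2
  rw [h, Complex.ofReal_re] at h2
  rw [← h2]
  congr 1; ext k
  rw [smul_eq_mul, Complex.mul_re, re_fourier_complexify, im_fourier_complexify,
    Complex.exp_ofReal_mul_I_re, Complex.exp_ofReal_mul_I_im]
  ring

theorem exists_abs_cosT_sinT_le (J : 𝓢(Pt d, ℝ)) (M : ℕ) :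
    ∃ K : ℝ, 0 < K ∧ ∀ ξ, |cosT J ξ| ≤ K / (1 + ‖ξ‖) ^ M ∧ |sinT J ξ| ≤ K / (1 + ‖ξ‖) ^ M := by
  set K₀ : ℝ := 2 ^ M * (Finset.Iic (M, 0)).sup (fun m => SchwartzMap.seminorm ℝ m.1 m.2)
    (𝓕 (complexify J)) with hK₀
  have hK0 : 0 ≤ K₀ := by rw [hK₀]; positivity
  have hp := Real.pi_pos
  have hp3 := Real.pi_gt_three
  refine ⟨(2 * Real.pi) ^ M * (K₀ + 1), by positivity, fun ξ => ?_⟩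
  set k : Pt d := (2 * Real.pi)⁻¹ • ξ with hk
  have hξ : (2 * Real.pi) • k = ξ := by rw [hk, smul_inv_smul₀ (by positivity)]
  have h := SchwartzMap.one_add_le_sup_seminorm_apply (𝕜 := ℝ) (m := (M, 0)) le_rfl le_rfl
    (𝓕 (complexify J)) k
  rw [norm_iteratedFDeriv_zero] at h
  have h1 : ‖𝓕 (complexify J) k‖ ≤ (2 * Real.pi) ^ M * (K₀ + 1) / (1 + ‖ξ‖) ^ M := by
    rw [le_div_iff₀ (by positivity)]
    have h2 : 1 + ‖ξ‖ ≤ (2 * Real.pi) * (1 + ‖k‖) := by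
      rw [← hξ, norm_smul, Real.norm_of_nonneg (by positivity)]
      nlinarith [norm_nonneg k]
    calc _ ≤ ‖𝓕 (complexify J) k‖ * ((2 * Real.pi) * (1 + ‖k‖)) ^ M := by gcongr
      _ = (2 * Real.pi) ^ M * ((1 + ‖k‖) ^ M * ‖𝓕 (complexify J) k‖) := by rw [mul_pow]; ring
      _ ≤ (2 * Real.pi) ^ M * (K₀ + 1) := by gcongr; linarith
  constructor
  · rw [← hξ, ← re_fourier_complexify, hξ]
    exact (Complex.abs_re_le_norm _).trans h1
  · rw [← hξ, ← abs_neg, ← im_fourier_complexify, hξ]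
    exact (Complex.abs_im_le_norm _).trans h1

/-- The modulated Schwartz function `x ↦ J x * exp (2 π i ⟪k, x⟫)`. -/
def modulate (J : 𝓢(Pt d, ℝ)) (k : Pt d) : 𝓢(Pt d, ℂ) :=
  𝓕⁻ ((𝓕 (complexify J)).compSubConstCLM ℝ k)

theorem modulate_apply (J : 𝓢(Pt d, ℝ)) (k x : Pt d) :
    modulate J k x = Complex.exp (((2 * Real.pi * ⟪k, x⟫ : ℝ) : ℂ) * Complex.I) * J x := by
  have h : 𝓕⁻ (𝓕 (complexify J)) x = complexify J x := by
    rw [FourierPair.fourierInv_fourier_eq]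
  rw [SchwartzMap.fourierInv_coe, Real.fourierInv_eq', complexify_apply] at h
  rw [modulate, SchwartzMap.fourierInv_coe, Real.fourierInv_eq', ← h, ← integral_const_mul,
    ← integral_add_right_eq_self _ k]
  congr 1; ext v
  simp only [SchwartzMap.compSubConstCLM_apply, add_sub_cancel_right, smul_eq_mul, inner_add_left]
  rw [← mul_assoc, ← Complex.exp_add]
  congr 2
  push_cast; ring

/-- The modulated Schwartz function `x ↦ J x * cos (2 π ⟪k, x⟫)`. -/
def cosMod (J : 𝓢(Pt d, ℝ)) (k : Pt d) : 𝓢(Pt d, ℝ) :=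
  (modulate J k).postcompCLM (𝕜 := ℝ) Complex.reCLM

/-- The modulated Schwartz function `x ↦ J x * sin (2 π ⟪k, x⟫)`. -/
def sinMod (J : 𝓢(Pt d, ℝ)) (k : Pt d) : 𝓢(Pt d, ℝ) :=
  (modulate J k).postcompCLM (𝕜 := ℝ) Complex.imCLM

theorem cosMod_apply (J : 𝓢(Pt d, ℝ)) (k x : Pt d) :
    cosMod J k x = J x * Real.cos (2 * Real.pi * ⟪k, x⟫) := by
  rw [cosMod, SchwartzMap.postcompCLM_apply, modulate_apply, Complex.reCLM_apply,
    Complex.re_mul_ofReal, Complex.exp_ofReal_mul_I_re, mul_comm]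

theorem sinMod_apply (J : 𝓢(Pt d, ℝ)) (k x : Pt d) :
    sinMod J k x = J x * Real.sin (2 * Real.pi * ⟪k, x⟫) := by
  rw [sinMod, SchwartzMap.postcompCLM_apply, modulate_apply, Complex.imCLM_apply,
    Complex.im_mul_ofReal, Complex.exp_ofReal_mul_I_im, mul_comm]

/-- Modulation is translation on the Fourier side; defining `modulate` that way reduces continuity
in `k` to continuity of translation on Schwartz space. -/
theorem continuous_modulate (J : 𝓢(Pt d, ℝ)) : Continuous (modulate J) :=
  ContinuousFourierInv.continuous_fourierInv.comp (continuous_compSubConstCLM _)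

theorem continuous_cosMod (J : 𝓢(Pt d, ℝ)) : Continuous (cosMod J) :=
  (SchwartzMap.postcompCLM (𝕜 := ℝ) Complex.reCLM).continuous.comp (continuous_modulate J)

theorem continuous_sinMod (J : 𝓢(Pt d, ℝ)) : Continuous (sinMod J) :=
  (SchwartzMap.postcompCLM (𝕜 := ℝ) Complex.imCLM).continuous.comp (continuous_modulate J)

theorem cosT_cosMod (J : 𝓢(Pt d, ℝ)) (k p : Pt d) : cosT (cosMod J k) p =
    (cosT J ((2 * Real.pi) • k - p) + cosT J ((2 * Real.pi) • k + p)) / 2 := by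
  simp only [cosT]
  rw [← integral_add (integrable_mul_cos J _) (integrable_mul_cos J _), ← integral_div]
  congr 1; ext x
  rw [cosMod_apply, inner_sub_left, inner_add_left, real_inner_smul_left, Real.cos_sub,
    Real.cos_add]
  ring

theorem sinT_cosMod (J : 𝓢(Pt d, ℝ)) (k p : Pt d) : sinT (cosMod J k) p =
    (sinT J ((2 * Real.pi) • k + p) - sinT J ((2 * Real.pi) • k - p)) / 2 := by
  simp only [sinT]
  rw [← integral_sub (integrable_mul_sin J _) (integrable_mul_sin J _), ← integral_div]
  congr 1; ext x
  rw [cosMod_apply, inner_sub_left, inner_add_left, real_inner_smul_left, Real.sin_sub,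
    Real.sin_add]
  ring

theorem cosT_sinMod (J : 𝓢(Pt d, ℝ)) (k p : Pt d) : cosT (sinMod J k) p =
    (sinT J ((2 * Real.pi) • k - p) + sinT J ((2 * Real.pi) • k + p)) / 2 := by
  simp only [sinT, cosT]
  rw [← integral_add (integrable_mul_sin J _) (integrable_mul_sin J _), ← integral_div]
  congr 1; ext x
  rw [sinMod_apply, inner_sub_left, inner_add_left, real_inner_smul_left, Real.sin_sub,
    Real.sin_add]
  ring

theorem sinT_sinMod (J : 𝓢(Pt d, ℝ)) (k p : Pt d) : sinT (sinMod J k) p =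
    (cosT J ((2 * Real.pi) • k - p) - cosT J ((2 * Real.pi) • k + p)) / 2 := by
  simp only [sinT, cosT]
  rw [← integral_sub (integrable_mul_cos J _) (integrable_mul_cos J _), ← integral_div]
  congr 1; ext x
  rw [sinMod_apply, inner_sub_left, inner_add_left, real_inner_smul_left, Real.cos_sub,
    Real.cos_add]
  ring

theorem one_add_norm_pow_le_peetre (k p : Pt d) (M : ℕ) :
    (1 + ‖k‖) ^ M ≤ (1 + ‖(2 * Real.pi) • k + p‖) ^ M * (1 + ‖p‖) ^ M := by
  rw [← mul_pow]
  have hp3 := Real.pi_gt_three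
  have h1 : ‖(2 * Real.pi) • k‖ ≤ ‖(2 * Real.pi) • k + p‖ + ‖p‖ := by
    simpa using norm_sub_le ((2 * Real.pi) • k + p) p
  rw [norm_smul, Real.norm_of_nonneg (by positivity)] at h1
  gcongr
  nlinarith [norm_nonneg k, norm_nonneg p, norm_nonneg ((2 * Real.pi) • k + p)]

theorem div_one_add_norm_pow_le {K : ℝ} (hK : 0 < K) (k p : Pt d) (M : ℕ) :
    K / (1 + ‖(2 * Real.pi) • k + p‖) ^ M ≤ K * (1 + ‖p‖) ^ M / (1 + ‖k‖) ^ M := by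
  rw [div_le_div_iff₀ (by positivity) (by positivity)]
  have := one_add_norm_pow_le_peetre k p M
  calc _ ≤ K * ((1 + ‖(2 * Real.pi) • k + p‖) ^ M * (1 + ‖p‖) ^ M) := by gcongr
    _ = _ := by ring

/-- The transforms of the modulated function are those of `J` recentred at `±2πk`. Peetre's
inequality trades their decay away from these centres for decay in `k`, at the price of a polynomial
in `p` that the moments of `μ` absorb. -/
theorem exists_specForm_mod_le {μ : Measure (Pt d)} [IsFiniteMeasure μ]
    (hμ : ∀ N : ℕ, Integrable (fun p : Pt d => (1 + ‖p‖) ^ N) μ) (J : 𝓢(Pt d, ℝ)) (M : ℕ) :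
    ∃ K : ℝ, 0 < K ∧ ∀ k, specForm μ (cosMod J k) (cosMod J k) ≤ (K / (1 + ‖k‖) ^ M) ^ 2 ∧
      specForm μ (sinMod J k) (sinMod J k) ≤ (K / (1 + ‖k‖) ^ M) ^ 2 := by
  obtain ⟨K, hK, hJ⟩ := exists_abs_cosT_sinT_le J M
  set I : ℝ := ∫ p, (1 + ‖p‖) ^ (2 * M) ∂μ with hI
  have hI0 : 0 ≤ I := integral_nonneg fun p => by positivity
  have hb : ∀ k p : Pt d, ∀ σ : Pt d, ‖σ‖ = ‖p‖ → K / (1 + ‖(2 * Real.pi) • k + σ‖) ^ M ≤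
      K * (1 + ‖p‖) ^ M / (1 + ‖k‖) ^ M := fun k p σ h => by
    rw [← h]; exact div_one_add_norm_pow_le hK k σ M
  have habs : ∀ a b B : ℝ, |a| ≤ B → |b| ≤ B → |(a + b) / 2| ≤ B ∧ |(a - b) / 2| ≤ B := by
    intro a b B ha hb
    rw [abs_le] at ha hb
    constructor <;> rw [abs_le] <;> constructor <;> linarith
  have hc : ∀ k p : Pt d, |cosT J ((2 * Real.pi) • k + p)| ≤ K * (1 + ‖p‖) ^ M / (1 + ‖k‖) ^ M ∧
      |cosT J ((2 * Real.pi) • k - p)| ≤ K * (1 + ‖p‖) ^ M / (1 + ‖k‖) ^ M ∧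
      |sinT J ((2 * Real.pi) • k + p)| ≤ K * (1 + ‖p‖) ^ M / (1 + ‖k‖) ^ M ∧
      |sinT J ((2 * Real.pi) • k - p)| ≤ K * (1 + ‖p‖) ^ M / (1 + ‖k‖) ^ M := by
    intro k p
    rw [sub_eq_add_neg]
    exact ⟨(hJ _).1.trans (hb k p p rfl), (hJ _).1.trans (hb k p _ (norm_neg p)),
      (hJ _).2.trans (hb k p p rfl), (hJ _).2.trans (hb k p _ (norm_neg p))⟩
  have main : ∀ (k : Pt d) (E : 𝓢(Pt d, ℝ)),
      (∀ p, |cosT E p| ≤ K * (1 + ‖p‖) ^ M / (1 + ‖k‖) ^ M) →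
      (∀ p, |sinT E p| ≤ K * (1 + ‖p‖) ^ M / (1 + ‖k‖) ^ M) →
      specForm μ E E ≤ (√(2 * K ^ 2 * (I + 1)) / (1 + ‖k‖) ^ M) ^ 2 := by
    intro k E h1 h2
    rw [div_pow, Real.sq_sqrt (by positivity)]
    have hi : Integrable (fun p : Pt d => 2 * K ^ 2 / ((1 + ‖k‖) ^ M) ^ 2 * (1 + ‖p‖) ^ (2 * M)) μ :=
      (hμ (2 * M)).const_mul _
    calc specForm μ E E ≤ ∫ p, 2 * K ^ 2 / ((1 + ‖k‖) ^ M) ^ 2 * (1 + ‖p‖) ^ (2 * M) ∂μ := by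
          refine integral_mono (integrable_specForm μ E E) hi fun p => ?_
          have h3 := mul_self_le_mul_self (abs_nonneg _) (h1 p)
          have h4 := mul_self_le_mul_self (abs_nonneg _) (h2 p)
          rw [abs_mul_abs_self] at h3 h4
          refine (add_le_add h3 h4).trans (le_of_eq ?_)
          rw [mul_comm 2 M, pow_mul]
          field_simp; ring
      _ = 2 * K ^ 2 / ((1 + ‖k‖) ^ M) ^ 2 * I := by rw [integral_const_mul]
      _ ≤ 2 * K ^ 2 / ((1 + ‖k‖) ^ M) ^ 2 * (I + 1) := by gcongr; linarith
      _ = _ := by ring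
  refine ⟨√(2 * K ^ 2 * (I + 1)), Real.sqrt_pos.2 (by positivity), fun k => ⟨?_, ?_⟩⟩
  · refine main k _ (fun p => ?_) (fun p => ?_)
    · rw [cosT_cosMod]; exact (habs _ _ _ (hc k p).2.1 (hc k p).1).1
    · rw [sinT_cosMod]; exact (habs _ _ _ (hc k p).2.2.1 (hc k p).2.2.2).2
  · refine main k _ (fun p => ?_) (fun p => ?_)
    · rw [cosT_sinMod]; exact (habs _ _ _ (hc k p).2.2.2 (hc k p).2.2.1).1
    · rw [sinT_sinMod]; exact (habs _ _ _ (hc k p).2.1 (hc k p).1).2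

end Modulation

/-! ### Interchanging the field with integrals of test functions. -/

section AveragedFields

variable {d : ℕ} {μ : Measure (Pt d)} {ν : Measure (FieldConfig d)}

theorem IsGaussianField.integral_abs_eval_mul_le [IsFiniteMeasure μ] (h : IsGaussianField μ ν)
    {J K : 𝓢(Pt d, ℝ)} {A B : ℝ} (hA : 0 < A) (hB : 0 < B) (hJ : specForm μ J J ≤ A ^ 2)
    (hK : specForm μ K K ≤ B ^ 2) : ∫ φ : FieldConfig d, |φ J * φ K| ∂ν ≤ A * B := by
  have i1 := ((h.memLp_eval J).integrable_sq).const_mul (B / A / 2)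
  have i2 := ((h.memLp_eval K).integrable_sq).const_mul (A / B / 2)
  have i3 : Integrable (fun φ : FieldConfig d => B / A / 2 * φ J ^ 2 + A / B / 2 * φ K ^ 2) ν :=
    i1.add i2
  have i4 : Integrable (fun φ : FieldConfig d => φ J * φ K) ν :=
    (h.memLp_eval J).integrable_mul (h.memLp_eval K)
  calc ∫ φ : FieldConfig d, |φ J * φ K| ∂ν
      ≤ ∫ φ : FieldConfig d, (B / A / 2 * φ J ^ 2 + A / B / 2 * φ K ^ 2) ∂ν := by
        refine integral_mono i4.abs i3 fun φ => ?_
        have h1 : (0 : ℝ) ≤ (B * |φ J| - A * |φ K|) ^ 2 / (2 * A * B) := by positivity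
        have h2 : B / A / 2 * φ J ^ 2 + A / B / 2 * φ K ^ 2 - |φ J * φ K| =
            (B * |φ J| - A * |φ K|) ^ 2 / (2 * A * B) := by
          rw [abs_mul, ← sq_abs (φ J), ← sq_abs (φ K)]; field_simp; ring
        show |φ J * φ K| ≤ B / A / 2 * φ J ^ 2 + A / B / 2 * φ K ^ 2
        linarith
    _ = B / A / 2 * specForm μ J J + A / B / 2 * specForm μ K K := by
        rw [integral_add i1 i2, integral_const_mul, integral_const_mul, h.integral_eval_sq,
          h.integral_eval_sq]
    _ ≤ B / A / 2 * A ^ 2 + A / B / 2 * B ^ 2 := by gcongr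
    _ = A * B := by field_simp; ring

theorem IsGaussianField.integral_abs_eval_le (h : IsGaussianField μ ν)
    {J : 𝓢(Pt d, ℝ)} {A : ℝ} (hA : 0 < A) (hJ : specForm μ J J ≤ A ^ 2) :
    ∫ φ : FieldConfig d, |φ J| ∂ν ≤ A := by
  have := h.isProbabilityMeasure
  have i1 := ((h.memLp_eval J).integrable_sq).const_mul (1 / A / 2)
  have i3 : Integrable (fun φ : FieldConfig d => 1 / A / 2 * φ J ^ 2 + A / 2) ν :=
    i1.add (integrable_const _)
  have i4 : Integrable (fun φ : FieldConfig d => φ J) ν :=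
    (h.memLp_eval J).integrable (by norm_num)
  calc ∫ φ : FieldConfig d, |φ J| ∂ν
      ≤ ∫ φ : FieldConfig d, (1 / A / 2 * φ J ^ 2 + A / 2) ∂ν := by
        refine integral_mono i4.abs i3 fun φ => ?_
        have h1 : (0 : ℝ) ≤ (|φ J| - A) ^ 2 / (2 * A) := by positivity
        have h2 : 1 / A / 2 * φ J ^ 2 + A / 2 - |φ J| = (|φ J| - A) ^ 2 / (2 * A) := by
          rw [← sq_abs (φ J)]; field_simp; ring
        show |φ J| ≤ 1 / A / 2 * φ J ^ 2 + A / 2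
        linarith
    _ = 1 / A / 2 * specForm μ J J + A / 2 := by
        rw [integral_add i1 (integrable_const _), integral_const_mul, h.integral_eval_sq]
        simp
    _ ≤ 1 / A / 2 * A ^ 2 + A / 2 := by gcongr
    _ = A := by field_simp; ring

/-- A Carathéodory function: continuous in the parameter because each `φ` is a continuous
functional, and measurable in `φ` by the choice of the cylinder sigma-algebra. -/
theorem measurable_eval_uncurry {α : Type*} [TopologicalSpace α] [TopologicalSpace.MetrizableSpace α]
    [SecondCountableTopology α] [MeasurableSpace α] [OpensMeasurableSpace α]
    {H : α → 𝓢(Pt d, ℝ)} (hH : Continuous H) :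
    Measurable fun z : α × FieldConfig d => z.2 (H z.1) :=
  measurable_uncurry_of_continuous_of_measurable (u := fun k (φ : FieldConfig d) => φ (H k))
    (fun φ => φ.continuous.comp hH) fun k => measurable_eval (H k)

theorem integrable_prod_of_integral_abs_le {α Ω : Type*} [MeasurableSpace α] [MeasurableSpace Ω]
    {ρ : Measure α} {P : Measure Ω} [SFinite ρ] [SFinite P] {F : α × Ω → ℝ} (hF : Measurable F)
    (hi : ∀ k, Integrable (fun ω => F (k, ω)) P) {b : α → ℝ} (hb : Integrable b ρ)
    (hFb : ∀ k, ∫ ω, |F (k, ω)| ∂P ≤ b k) : Integrable F (ρ.prod P) := by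
  rw [integrable_prod_iff hF.aestronglyMeasurable]
  refine ⟨ae_of_all _ hi, hb.mono' ?_ (ae_of_all _ fun k => ?_)⟩
  · exact (hF.norm.stronglyMeasurable.integral_prod_right').aestronglyMeasurable
  · rw [Real.norm_eq_abs, abs_of_nonneg (integral_nonneg fun _ => norm_nonneg _)]
    exact hFb k

/-- A weak integral of test functions may be pulled out of the field. -/
theorem IsGaussianField.ae_eval_eq_integral [IsFiniteMeasure μ] (h : IsGaussianField μ ν)
    {H : Pt d → 𝓢(Pt d, ℝ)} (hH : Continuous H) {B : Pt d → ℝ} (hB : ∀ k, 0 < B k)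
    (hBi : Integrable B) (hHB : ∀ k, specForm μ (H k) (H k) ≤ B k ^ 2) {g : 𝓢(Pt d, ℝ)}
    (hg : ∀ J, specForm μ J g = ∫ k, specForm μ J (H k)) :
    (∀ᵐ φ ∂ν, Integrable fun k => φ (H k)) ∧ ∀ᵐ φ ∂ν, φ g = ∫ k, φ (H k) := by
  have := h.isProbabilityMeasure
  have hm := measurable_eval_uncurry hH
  have i1 : Integrable (fun z : Pt d × FieldConfig d => z.2 (H z.1)) (volume.prod ν) :=
    integrable_prod_of_integral_abs_le hm
      (fun k => (h.memLp_eval (H k)).integrable (by norm_num)) hBi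
      fun k => h.integral_abs_eval_le (hB k) (hHB k)
  refine ⟨i1.prod_left_ae, ?_⟩
  -- The summand 1 keeps `A` positive when `φ g` is degenerate.
  set A : ℝ := √(specForm μ g g + 1) with hA
  have hgg := specForm_self_nonneg μ g
  have hA0 : 0 < A := Real.sqrt_pos.2 (by linarith)
  have hgA : specForm μ g g ≤ A ^ 2 := by rw [hA, Real.sq_sqrt (by linarith)]; linarith
  have i2 : Integrable (fun z : Pt d × FieldConfig d => z.2 g * z.2 (H z.1)) (volume.prod ν) :=
    integrable_prod_of_integral_abs_le (((measurable_eval g).comp measurable_snd).mul hm)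
      (fun k => (h.memLp_eval g).integrable_mul (h.memLp_eval (H k))) (hBi.const_mul A)
      fun k => h.integral_abs_eval_mul_le hA0 (hB k) hgA (hHB k)
  have hm3 : Measurable fun z : (Pt d × Pt d) × FieldConfig d => z.2 (H z.1.1) * z.2 (H z.1.2) :=
    (hm.comp (measurable_fst.fst.prodMk measurable_snd)).mul
      (hm.comp (measurable_fst.snd.prodMk measurable_snd))
  have i3 : Integrable (fun z : (Pt d × Pt d) × FieldConfig d => z.2 (H z.1.1) * z.2 (H z.1.2))
      ((volume.prod volume).prod ν) :=
    integrable_prod_of_integral_abs_le hm3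
      (fun k => (h.memLp_eval (H k.1)).integrable_mul (h.memLp_eval (H k.2))) (hBi.mul_prod hBi)
      fun k => h.integral_abs_eval_mul_le (hB k.1) (hB k.2) (hHB k.1) (hHB k.2)
  have j2 : Integrable (fun φ : FieldConfig d => φ g * ∫ k, φ (H k)) ν := by
    simpa only [integral_const_mul] using i2.integral_prod_right
  have e2 : ∫ φ : FieldConfig d, (φ g * ∫ k, φ (H k)) ∂ν = specForm μ g g := by
    rw [hg g]
    simp only [← integral_const_mul]
    rw [← integral_integral_swap (f := fun k (φ : FieldConfig d) => φ g * φ (H k)) i2]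
    simp only [h.integral_eval_mul_eval]
  have hprod : ∀ φ : FieldConfig d, ∫ z : Pt d × Pt d, φ (H z.1) * φ (H z.2) =
      (∫ k, φ (H k)) ^ 2 := fun φ => by
    rw [sq]
    exact integral_prod_mul (fun k => φ (H k)) (fun k => φ (H k))
  have j3 : Integrable (fun φ : FieldConfig d => (∫ k, φ (H k)) ^ 2) ν := by
    have := i3.integral_prod_right
    simp only [← Measure.volume_eq_prod, hprod] at this
    exact this
  have e3 : ∫ φ : FieldConfig d, (∫ k, φ (H k)) ^ 2 ∂ν = specForm μ g g := by
    simp only [← hprod, Measure.volume_eq_prod]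
    rw [← integral_integral_swap
      (f := fun (z : Pt d × Pt d) (φ : FieldConfig d) => φ (H z.1) * φ (H z.2)) i3]
    simp only [h.integral_eval_mul_eval]
    have i4 := i3.integral_prod_left
    simp only [h.integral_eval_mul_eval] at i4
    rw [integral_prod _ i4]
    simp only [← hg]
    simp only [specForm_comm μ _ g, ← hg]
  have j1 := (h.memLp_eval g).integrable_sq
  -- The second moments of `φ g` and of `∫ k, φ (H k)` and their mixed moment all equal `specForm μ
  -- g g`, so the two variables coincide in `L²`.
  have hint : ∫ φ : FieldConfig d, (φ g - ∫ k, φ (H k)) ^ 2 ∂ν = 0 := by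
    have j12 : Integrable (fun φ : FieldConfig d => φ g ^ 2 - 2 * (φ g * ∫ k, φ (H k))) ν :=
      j1.sub (j2.const_mul 2)
    calc ∫ φ : FieldConfig d, (φ g - ∫ k, φ (H k)) ^ 2 ∂ν
        = ∫ φ : FieldConfig d, ((φ g ^ 2 - 2 * (φ g * ∫ k, φ (H k))) + (∫ k, φ (H k)) ^ 2) ∂ν := by
          congr 1; ext φ; ring
      _ = 0 := by
          rw [integral_add j12 j3, integral_sub j1 (j2.const_mul 2), integral_const_mul, e2, e3,
            h.integral_eval_sq]
          ring
  have jint : Integrable (fun φ : FieldConfig d => (φ g - ∫ k, φ (H k)) ^ 2) ν := by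
    refine ((j1.sub (j2.const_mul 2)).add j3).congr (ae_of_all _ fun φ => ?_)
    simp only [Pi.add_apply, Pi.sub_apply]
    ring
  rw [integral_eq_zero_iff_of_nonneg (fun φ => sq_nonneg _) jint] at hint
  filter_upwards [hint] with φ hφ
  exact sub_eq_zero.1 (pow_eq_zero_iff (two_ne_zero) |>.1 hφ)

end AveragedFields

/-! ### Fourier integrals with integrable coefficients. -/

section TrigonometricIntegrals

variable {d : ℕ} {a b : Pt d → ℝ}

/-- The inverse Fourier transform in real form. -/
def trigSum (a b : Pt d → ℝ) (x : Pt d) : ℝ :=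
  ∫ k, (a k * Real.cos (2 * Real.pi * ⟪k, x⟫) + b k * Real.sin (2 * Real.pi * ⟪k, x⟫))

theorem abs_add_mul_trig_le (α β t : ℝ) :
    |α * Real.cos t + β * Real.sin t| ≤ |α| + |β| := by
  refine (abs_add_le _ _).trans (add_le_add ?_ ?_) <;> rw [abs_mul]
  · exact mul_le_of_le_one_right (abs_nonneg _) (Real.abs_cos_le_one _)
  · exact mul_le_of_le_one_right (abs_nonneg _) (Real.abs_sin_le_one _)

theorem continuous_trigSum (ha : Integrable a) (hb : Integrable b) :
    Continuous (trigSum a b) := by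
  have ha' := ha.aestronglyMeasurable
  have hb' := hb.aestronglyMeasurable
  refine continuous_of_dominated (bound := fun k => |a k| + |b k|) (fun x => ?_)
    (fun x => ae_of_all _ fun k => abs_add_mul_trig_le _ _ _) (ha.abs.add hb.abs)
    (ae_of_all _ fun k => by fun_prop)
  exact (ha'.mul (Continuous.aestronglyMeasurable (by fun_prop))).add
    (hb'.mul (Continuous.aestronglyMeasurable (by fun_prop)))

theorem abs_trigSum_le (ha : Integrable a) (hb : Integrable b) (x : Pt d) :
    |trigSum a b x| ≤ ∫ k, (|a k| + |b k|) :=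
  abs_integral_le_integral_of_abs_le (ha.abs.add hb.abs)
    (ae_of_all _ fun _ => abs_add_mul_trig_le _ _ _)

theorem integral_trigSum_mul (ha : Integrable a) (hb : Integrable b) (g : 𝓢(Pt d, ℝ)) :
    ∫ x, trigSum a b x * g x =
      ∫ k, (a k * cosT g ((2 * Real.pi) • k) + b k * sinT g ((2 * Real.pi) • k)) := by
  have hi : Integrable (fun z : Pt d × Pt d => (a z.1 * Real.cos (2 * Real.pi * ⟪z.1, z.2⟫) +
      b z.1 * Real.sin (2 * Real.pi * ⟪z.1, z.2⟫)) * g z.2) (volume.prod volume) := by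
    have h1 := (ha.mul_prod g.integrable (ν := volume)).mul_bdd (c := 1)
      (g := fun z : Pt d × Pt d => Real.cos (2 * Real.pi * ⟪z.1, z.2⟫))
      (Continuous.aestronglyMeasurable (by fun_prop))
      (ae_of_all _ fun z => Real.abs_cos_le_one _)
    have h2 := (hb.mul_prod g.integrable (ν := volume)).mul_bdd (c := 1)
      (g := fun z : Pt d × Pt d => Real.sin (2 * Real.pi * ⟪z.1, z.2⟫))
      (Continuous.aestronglyMeasurable (by fun_prop))
      (ae_of_all _ fun z => Real.abs_sin_le_one _)
    refine (h1.add h2).congr (ae_of_all _ fun z => ?_)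
    simp only [Pi.add_apply]; ring
  simp only [trigSum, ← integral_mul_const]
  rw [← integral_integral_swap (f := fun k x : Pt d => (a k * Real.cos (2 * Real.pi * ⟪k, x⟫) +
      b k * Real.sin (2 * Real.pi * ⟪k, x⟫)) * g x) hi]
  congr 1; ext k
  simp only [cosT, sinT, ← integral_const_mul]
  rw [← integral_add ((integrable_mul_cos g _).const_mul _)
    ((integrable_mul_sin g _).const_mul _)]
  congr 1; ext x
  rw [real_inner_smul_left]
  ring

end TrigonometricIntegrals

/-! ### Almost sure continuity of the field. -/

section LocalModes

variable {d : ℕ} {μ : Measure (Pt d)} {ν : Measure (FieldConfig d)}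

/-- The Fourier modes of `g`, localized by `χ`. -/
def localMode (χ g : 𝓢(Pt d, ℝ)) (k : Pt d) : 𝓢(Pt d, ℝ) :=
  cosT g ((2 * Real.pi) • k) • cosMod χ k + sinT g ((2 * Real.pi) • k) • sinMod χ k

theorem continuous_localMode (χ g : 𝓢(Pt d, ℝ)) : Continuous (localMode χ g) :=
  (((continuous_cosT g).comp (continuous_const_smul _)).smul (continuous_cosMod χ)).add
    (((continuous_sinT g).comp (continuous_const_smul _)).smul (continuous_sinMod χ))

theorem localMode_apply (χ g : 𝓢(Pt d, ℝ)) (k x : Pt d) : localMode χ g k x =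
    χ x * (cosT g ((2 * Real.pi) • k) * Real.cos (2 * Real.pi * ⟪k, x⟫) +
      sinT g ((2 * Real.pi) • k) * Real.sin (2 * Real.pi * ⟪k, x⟫)) := by
  rw [localMode, add_apply, smul_apply, smul_apply, cosMod_apply, sinMod_apply, smul_eq_mul,
    smul_eq_mul]
  ring

theorem integral_localMode (χ g : 𝓢(Pt d, ℝ)) (x : Pt d) :
    ∫ k, localMode χ g k x = χ x * g x := by
  simp only [localMode_apply, integral_const_mul, integral_cosT_sinT]

theorem integrable_localMode (χ g : 𝓢(Pt d, ℝ)) :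
    Integrable (fun z : Pt d × Pt d => localMode χ g z.1 z.2) (volume.prod volume) := by
  have h1 := ((integrable_cosT g).mul_prod χ.integrable (ν := volume)).mul_bdd (c := 1)
    (g := fun z : Pt d × Pt d => Real.cos (2 * Real.pi * ⟪z.1, z.2⟫))
    (Continuous.aestronglyMeasurable (by fun_prop))
    (ae_of_all _ fun z => Real.abs_cos_le_one _)
  have h2 := ((integrable_sinT g).mul_prod χ.integrable (ν := volume)).mul_bdd (c := 1)
    (g := fun z : Pt d × Pt d => Real.sin (2 * Real.pi * ⟪z.1, z.2⟫))
    (Continuous.aestronglyMeasurable (by fun_prop))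
    (ae_of_all _ fun z => Real.abs_sin_le_one _)
  refine (h1.add h2).congr (ae_of_all _ fun z => ?_)
  simp only [Pi.add_apply, localMode_apply]; ring

theorem specForm_eq_integral_specForm [IsFiniteMeasure μ] {H : Pt d → 𝓢(Pt d, ℝ)}
    {g : 𝓢(Pt d, ℝ)} (hi : Integrable (fun z : Pt d × Pt d => H z.1 z.2) (volume.prod volume))
    (hg : ∀ x, ∫ k, H k x = g x) (J : 𝓢(Pt d, ℝ)) :
    specForm μ J g = ∫ k, specForm μ J (H k) := by
  simp only [specForm_eq_integral_potential]
  have h : Integrable (fun z : Pt d × Pt d => H z.1 z.2 * potential μ J z.2)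
      (volume.prod volume) :=
    hi.mul_bdd (c := (2 * ∫ x, |J x|) * μ.real Set.univ)
      ((continuous_potential μ J).comp continuous_snd).aestronglyMeasurable
      (ae_of_all _ fun z => abs_potential_le μ J z.2)
  rw [integral_integral_swap (f := fun k y : Pt d => H k y * potential μ J y) h]
  simp only [integral_mul_const, hg]

theorem specForm_add_self_le [IsFiniteMeasure μ] (J K : 𝓢(Pt d, ℝ)) :
    specForm μ (J + K) (J + K) ≤ 2 * specForm μ J J + 2 * specForm μ K K := by
  have h1 := specForm_self_nonneg μ (J + (-1 : ℝ) • K)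
  have h2 := specForm_add_smul_self μ 1 J K
  rw [one_smul] at h2
  rw [specForm_add_smul_self] at h1
  rw [h2]
  linarith

theorem exists_specForm_localMode_le [IsFiniteMeasure μ]
    (hμ : ∀ N : ℕ, Integrable (fun p : Pt d => (1 + ‖p‖) ^ N) μ) (χ g : 𝓢(Pt d, ℝ)) (M : ℕ) :
    ∃ K : ℝ, 0 < K ∧ ∀ k,
      specForm μ (localMode χ g k) (localMode χ g k) ≤ (K / (1 + ‖k‖) ^ M) ^ 2 := by
  obtain ⟨K, hK, h⟩ := exists_specForm_mod_le hμ χ M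
  set G : ℝ := (∫ x, |g x|) + 1 with hG
  have hG0 : 0 ≤ ∫ x, |g x| := integral_nonneg fun x => abs_nonneg _
  refine ⟨2 * G * K, by positivity, fun k => ?_⟩
  have hsq : ∀ t : ℝ, |t| ≤ ∫ x, |g x| → t * t ≤ G ^ 2 := fun t ht => by
    rw [← abs_mul_abs_self, ← sq]
    have := abs_nonneg t
    gcongr; linarith
  have h1 := hsq _ (abs_cosT_le g ((2 * Real.pi) • k))
  have h2 := hsq _ (abs_sinT_le g ((2 * Real.pi) • k))
  refine (specForm_add_self_le _ _).trans ?_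
  simp only [specForm_smul_left, specForm_smul_right, ← mul_assoc (cosT g _),
    ← mul_assoc (sinT g _)]
  calc _ ≤ 2 * (G ^ 2 * (K / (1 + ‖k‖) ^ M) ^ 2) + 2 * (G ^ 2 * (K / (1 + ‖k‖) ^ M) ^ 2) := by
        have h3 := specForm_self_nonneg μ (cosMod χ k)
        have h4 := specForm_self_nonneg μ (sinMod χ k)
        have h5 := (h k).1
        have h6 := (h k).2
        gcongr
    _ = (2 * G * K / (1 + ‖k‖) ^ M) ^ 2 := by ring

theorem integrable_div_one_add_norm_pow (K : ℝ) :
    Integrable fun k : Pt d => K / (1 + ‖k‖) ^ (d + 1) := by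
  have h := integrable_one_add_norm (E := Pt d) (μ := volume) (r := ((d + 1 : ℕ) : ℝ)) (by simp)
  refine (h.const_mul K).congr (ae_of_all _ fun k => ?_)
  simp only [Real.rpow_neg (show 0 ≤ 1 + ‖k‖ by positivity), Real.rpow_natCast, div_eq_mul_inv]

theorem IsGaussianField.ae_integrable_cosMod [IsFiniteMeasure μ] (h : IsGaussianField μ ν)
    (hμ : ∀ N : ℕ, Integrable (fun p : Pt d => (1 + ‖p‖) ^ N) μ) (χ : 𝓢(Pt d, ℝ)) :
    ∀ᵐ φ ∂ν, Integrable (fun k => φ (cosMod χ k)) ∧ Integrable (fun k => φ (sinMod χ k)) := by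
  have := h.isProbabilityMeasure
  obtain ⟨K, hK, hb⟩ := exists_specForm_mod_le hμ χ (d + 1)
  have key : ∀ H : Pt d → 𝓢(Pt d, ℝ), Continuous H →
      (∀ k, specForm μ (H k) (H k) ≤ (K / (1 + ‖k‖) ^ (d + 1)) ^ 2) →
      ∀ᵐ φ ∂ν, Integrable (fun k => φ (H k)) := fun H hH hHb =>
    (integrable_prod_of_integral_abs_le (measurable_eval_uncurry hH)
      (fun k => (h.memLp_eval (H k)).integrable (by norm_num)) (integrable_div_one_add_norm_pow K)
      fun k => h.integral_abs_eval_le (by positivity) (hHb k)).prod_left_ae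
  filter_upwards [key _ (continuous_cosMod χ) fun k => (hb k).1,
    key _ (continuous_sinMod χ) fun k => (hb k).2] with φ h1 h2 using ⟨h1, h2⟩

/-- Fourier inversion writes `g = χ * g` as a weak integral of localized modes, and this integral
may be pulled out of `φ`. The exceptional null set still depends on `g`. -/
theorem IsGaussianField.ae_eval_eq_integral_trigSum [IsFiniteMeasure μ]
    (h : IsGaussianField μ ν) (hμ : ∀ N : ℕ, Integrable (fun p : Pt d => (1 + ‖p‖) ^ N) μ)
    {χ g : 𝓢(Pt d, ℝ)} (hχ : ∀ x, χ x * g x = g x) :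
    ∀ᵐ φ ∂ν, φ g =
      ∫ x, trigSum (fun k => φ (cosMod χ k)) (fun k => φ (sinMod χ k)) x * g x := by
  obtain ⟨K, hK, hb⟩ := exists_specForm_localMode_le hμ χ g (d + 1)
  have h1 := (h.ae_eval_eq_integral (continuous_localMode χ g)
    (B := fun k => K / (1 + ‖k‖) ^ (d + 1)) (fun k => by positivity)
    (integrable_div_one_add_norm_pow K) hb
    (specForm_eq_integral_specForm (integrable_localMode χ g)
      fun x => (integral_localMode χ g x).trans (hχ x))).2
  filter_upwards [h1, h.ae_integrable_cosMod hμ χ] with φ h2 h3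
  rw [h2, integral_trigSum_mul h3.1 h3.2]
  congr 1; ext k
  rw [localMode, map_add, map_smul, map_smul, smul_eq_mul, smul_eq_mul, mul_comm,
    mul_comm (sinT g _)]

/-- Schwartz space embeds continuously in `L¹`, on which a bounded function acts as a continuous
functional. -/
theorem continuous_integral_mul {f : Pt d → ℝ} (hf : Continuous f) {C : ℝ} (hC : ∀ x, |f x| ≤ C) :
    Continuous fun g : 𝓢(Pt d, ℝ) => ∫ x, f x * g x := by
  have h1 : ∀ u : Lp ℝ 1 (volume : Measure (Pt d)), Integrable fun x => f x * u x := fun u =>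
    (L1.integrable_coeFn u).bdd_mul hf.aestronglyMeasurable (ae_of_all _ hC)
  have h2 : Continuous fun u : Lp ℝ 1 (volume : Measure (Pt d)) => ∫ x, f x * u x := by
    refine (LipschitzWith.of_dist_le_mul (K := C.toNNReal) fun u v => ?_).continuous
    have hC0 : 0 ≤ C := (abs_nonneg _).trans (hC 0)
    rw [Real.dist_eq, ← integral_sub (h1 u) (h1 v), dist_eq_norm, L1.norm_eq_integral_norm,
      Real.coe_toNNReal _ hC0, ← integral_const_mul]
    refine abs_integral_le_integral_of_abs_le ((L1.integrable_coeFn _).norm.const_mul _) ?_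
    filter_upwards [Lp.coeFn_sub u v] with x hx
    rw [hx, Pi.sub_apply, ← mul_sub, abs_mul, Real.norm_eq_abs]
    exact mul_le_mul_of_nonneg_right (hC x) (abs_nonneg _)
  have h3 := h2.comp (SchwartzMap.toLpCLM ℝ ℝ 1 (volume : Measure (Pt d))).continuous
  refine h3.congr fun g => integral_congr_ae ?_
  filter_upwards [g.coeFn_toLp 1 volume] with x hx
  show f x * (g.toLp 1 volume) x = _
  rw [hx]

/-- Localizing with a bump equal to 1 on the ball represents `φ g` for each fixed `g`. A countable
dense set of such `g` needs only one null set, and both sides are continuous in `g`. -/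
theorem IsGaussianField.ae_exists_continuous_closedBall [IsFiniteMeasure μ]
    (h : IsGaussianField μ ν) (hμ : ∀ N : ℕ, Integrable (fun p : Pt d => (1 + ‖p‖) ^ N) μ)
    {r : ℝ} (hr : 0 < r) :
    ∀ᵐ φ ∂ν, ∃ f : Pt d → ℝ, Continuous f ∧ ∀ g : 𝓢(Pt d, ℝ),
      tsupport g ⊆ Metric.closedBall 0 r → φ g = ∫ x, f x * g x := by
  let χ₀ : ContDiffBump (0 : Pt d) := ⟨r, r + 1, hr, by linarith⟩
  let χ : 𝓢(Pt d, ℝ) := χ₀.hasCompactSupport.toSchwartzMap χ₀.contDiff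
  have hχ : ∀ g : 𝓢(Pt d, ℝ), tsupport g ⊆ Metric.closedBall 0 r → ∀ x, χ x * g x = g x := by
    intro g hg x
    by_cases hx : x ∈ tsupport g
    · have : χ x = 1 := χ₀.one_of_mem_closedBall (hg hx)
      rw [this, one_mul]
    · rw [image_eq_zero_of_notMem_tsupport hx, mul_zero]
  obtain ⟨D, hDs, hDc, hD⟩ := exists_countable_dense_of_tsupport_subset (r := r)
    (s := {g : 𝓢(Pt d, ℝ) | tsupport g ⊆ Metric.closedBall 0 r}) fun g hg => hg
  have h1 := (ae_ball_iff hDc).2 fun g hg =>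
    h.ae_eval_eq_integral_trigSum hμ (hχ g (hDs hg))
  filter_upwards [h1, h.ae_integrable_cosMod hμ χ] with φ h2 h3
  refine ⟨_, continuous_trigSum h3.1 h3.2, fun g hg => ?_⟩
  have hclosed := isClosed_eq φ.continuous
    (continuous_integral_mul (continuous_trigSum h3.1 h3.2) (abs_trigSum_le h3.1 h3.2))
  exact closure_minimal (fun g hg => h2 g hg) hclosed (hD hg)

theorem eq_on_ball_of_integral_eq {f₁ f₂ : Pt d → ℝ} (h₁ : Continuous f₁) (h₂ : Continuous f₂)
    {r : ℝ} (h : ∀ g : 𝓢(Pt d, ℝ), HasCompactSupport (g : Pt d → ℝ) →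
      tsupport g ⊆ Metric.ball 0 r → ∫ x, f₁ x * g x = ∫ x, f₂ x * g x) :
    Set.EqOn f₁ f₂ (Metric.ball 0 r) := by
  have h3 : ∀ᵐ x ∂(volume : Measure (Pt d)), x ∈ Metric.ball (0 : Pt d) r → f₁ x - f₂ x = 0 := by
    refine Metric.isOpen_ball.ae_eq_zero_of_integral_contDiff_smul_eq_zero
      ((h₁.sub h₂).locallyIntegrable.locallyIntegrableOn _) fun g hg hc hs => ?_
    have e := h (hc.toSchwartzMap hg) hc hs
    have i₁ : Integrable (fun x => f₁ x * g x) :=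
      (h₁.mul hg.continuous).integrable_of_hasCompactSupport hc.mul_left
    have i₂ : Integrable (fun x => f₂ x * g x) :=
      (h₂.mul hg.continuous).integrable_of_hasCompactSupport hc.mul_left
    have e' : ∫ x, f₁ x * g x = ∫ x, f₂ x * g x := e
    have : (fun x => g x • (f₁ x - f₂ x)) = fun x => f₁ x * g x - f₂ x * g x := by
      funext x; simp only [smul_eq_mul]; ring
    rw [this, integral_sub i₁ i₂, e', sub_self]
  refine Measure.eqOn_open_of_ae_eq (μ := volume) ?_ Metric.isOpen_ball h₁.continuousOn
    h₂.continuousOn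
  rw [Filter.EventuallyEq, ae_restrict_iff' measurableSet_ball]
  filter_upwards [h3] with x hx hxr using sub_eq_zero.1 (hx hxr)

/-- A Gaussian field whose spectral measure has moments of all orders is almost surely given by
a continuous function. -/
theorem IsGaussianField.ae_exists_isGivenBy [IsFiniteMeasure μ]
    (h : IsGaussianField μ ν) (hμ : ∀ N : ℕ, Integrable (fun p : Pt d => (1 + ‖p‖) ^ N) μ) :
    ∀ᵐ φ ∂ν, ∃ f : Pt d → ℝ, IsGivenBy φ f := by
  have h1 := ae_all_iff.2 fun n : ℕ =>
    h.ae_exists_continuous_closedBall hμ (r := (n : ℝ) + 1) (by positivity)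
  filter_upwards [h1] with φ h2
  choose F hFc hF using h2
  have hagree : ∀ n m : ℕ, n ≤ m → Set.EqOn (F n) (F m) (Metric.ball 0 (n + 1)) := by
    intro n m hnm
    refine eq_on_ball_of_integral_eq (hFc n) (hFc m) fun g hg hs => ?_
    have hs' := hs.trans Metric.ball_subset_closedBall
    rw [← hF n g hs', ← hF m g (hs'.trans (Metric.closedBall_subset_closedBall (by gcongr)))]
  -- `x` lies in the open ball of radius `⌈‖x‖⌉₊ + 1`, on which all later `F m` agree with this one;
  -- the open ball also gives a neighbourhood for continuity.
  set f : Pt d → ℝ := fun x => F ⌈‖x‖⌉₊ x with hf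
  have hfF : ∀ n : ℕ, Set.EqOn f (F n) (Metric.ball 0 (n + 1)) := by
    intro n x hx
    rcases le_total ⌈‖x‖⌉₊ n with hle | hle
    · refine hagree _ _ hle ?_
      rw [mem_ball_zero_iff]
      exact (Nat.le_ceil _).trans_lt (lt_add_one _)
    · exact (hagree _ _ hle hx).symm
  refine ⟨f, ?_, fun g hg => ?_⟩
  · rw [continuous_iff_continuousAt]
    intro x
    obtain ⟨n, hn⟩ := exists_nat_gt ‖x‖
    have hx : x ∈ Metric.ball (0 : Pt d) (n + 1) := by rw [mem_ball_zero_iff]; linarith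
    exact (hFc n).continuousAt.congr
      (((hfF n).symm).eventuallyEq_of_mem (Metric.isOpen_ball.mem_nhds hx))
  · obtain ⟨R, hR⟩ := hg.isBounded.subset_closedBall (0 : Pt d)
    obtain ⟨n, hn⟩ := exists_nat_gt R
    have hs : tsupport g ⊆ Metric.ball (0 : Pt d) (n + 1) := fun x hx => by
      have := hR hx
      rw [mem_closedBall_zero_iff] at this
      rw [mem_ball_zero_iff]; linarith
    rw [hF n g (hs.trans Metric.ball_subset_closedBall)]
    congr 1; ext x
    by_cases hx : x ∈ tsupport g
    · rw [hfF n (hs hx)]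
    · rw [image_eq_zero_of_notMem_tsupport hx, mul_zero, mul_zero]

end LocalModes

/-! ### Point values as limits of mollified fields, and their joint Gaussian law. -/

section PointValues

open Filter Topology

variable {d : ℕ} {μ : Measure (Pt d)} {ν : Measure (FieldConfig d)}

/-- A smooth bump supported in the ball of radius `1 / (n + 1)` about the origin. -/
def bump (d n : ℕ) : ContDiffBump (0 : Pt d) :=
  ⟨1 / (2 * ((n : ℝ) + 1)), 1 / ((n : ℝ) + 1), by positivity,
    one_div_lt_one_div_of_lt (by positivity) (by linarith [(n.cast_nonneg : (0 : ℝ) ≤ n)])⟩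

/-- A nonnegative test function with integral one, supported in the ball of radius `1 / (n + 1)`
about `x`. -/
def mollifier (n : ℕ) (x : Pt d) : 𝓢(Pt d, ℝ) :=
  ((bump d n).hasCompactSupport_normed (μ := volume)
    |>.toSchwartzMap (bump d n).contDiff_normed).compSubConstCLM ℝ x

theorem mollifier_apply (n : ℕ) (x y : Pt d) :
    mollifier n x y = (bump d n).normed volume (y - x) := rfl

theorem continuous_mollifier (n : ℕ) : Continuous (mollifier (d := d) n) :=
  continuous_compSubConstCLM _

theorem mollifier_nonneg (n : ℕ) (x y : Pt d) : 0 ≤ mollifier n x y :=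
  (bump d n).nonneg_normed _

theorem integral_mollifier (n : ℕ) (x : Pt d) : ∫ y, mollifier n x y = 1 := by
  simp only [mollifier_apply]
  rw [integral_sub_right_eq_self (fun y => (bump d n).normed volume y) x]
  exact (bump d n).integral_normed

theorem integral_abs_mollifier (n : ℕ) (x : Pt d) : ∫ y, |mollifier n x y| = 1 := by
  simp only [abs_of_nonneg (mollifier_nonneg n x _), integral_mollifier]

theorem mollifier_eq_zero {n : ℕ} {x y : Pt d} (h : 1 / ((n : ℝ) + 1) ≤ dist y x) :
    mollifier n x y = 0 := by
  rw [mollifier_apply]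
  have : y - x ∉ Function.support ((bump d n).normed volume) := by
    rw [(bump d n).support_normed_eq, mem_ball_zero_iff, not_lt, ← dist_eq_norm]
    exact h
  simpa using this

theorem hasCompactSupport_mollifier (n : ℕ) (x : Pt d) :
    HasCompactSupport (mollifier n x : Pt d → ℝ) := by
  refine HasCompactSupport.intro (isCompact_closedBall x (1 / ((n : ℝ) + 1))) fun y hy => ?_
  rw [Metric.mem_closedBall, not_le] at hy
  exact mollifier_eq_zero hy.le

theorem tendsto_integral_mul_mollifier {f : Pt d → ℝ} (hf : Continuous f) (x : Pt d) :
    Tendsto (fun n => ∫ y, f y * mollifier n x y) atTop (𝓝 (f x)) := by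
  rw [Metric.tendsto_atTop]
  intro ε hε
  obtain ⟨δ, hδ, h⟩ := Metric.continuousAt_iff.1 hf.continuousAt (ε / 2) (by positivity)
  obtain ⟨N, hN⟩ := exists_nat_one_div_lt hδ
  refine ⟨N, fun n hn => ?_⟩
  have hn' : 1 / ((n : ℝ) + 1) < δ := (one_div_le_one_div_of_le (by positivity)
    (by gcongr)).trans_lt hN
  have hi : Integrable fun y => f y * mollifier n x y :=
    (hf.mul (mollifier n x).continuous).integrable_of_hasCompactSupport
      (hasCompactSupport_mollifier n x).mul_left
  have hi' : Integrable fun y => f x * mollifier n x y := (mollifier n x).integrable.const_mul _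
  have e : (∫ y, f y * mollifier n x y) - f x = ∫ y, (f y - f x) * mollifier n x y := by
    simp only [sub_mul]
    rw [integral_sub hi hi', integral_const_mul, integral_mollifier, mul_one]
  rw [Real.dist_eq, e]
  refine lt_of_le_of_lt ?_ (half_lt_self hε)
  calc _ ≤ ∫ y, ε / 2 * mollifier n x y := by
        refine abs_integral_le_integral_of_abs_le ((mollifier n x).integrable.const_mul _)
          (ae_of_all _ fun y => ?_)
        rcases lt_or_ge (dist y x) (1 / ((n : ℝ) + 1)) with hy | hy
        · rw [abs_mul, abs_of_nonneg (mollifier_nonneg n x y), ← Real.dist_eq]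
          exact mul_le_mul_of_nonneg_right (h (hy.trans hn')).le (mollifier_nonneg n x y)
        · simp [mollifier_eq_zero hy]
    _ = ε / 2 := by rw [integral_const_mul, integral_mollifier, mul_one]

theorem tendsto_eval_mollifier {φ : FieldConfig d} (hφ : ∃ f : Pt d → ℝ, IsGivenBy φ f)
    (x : Pt d) : Tendsto (fun n => φ (mollifier n x)) atTop (𝓝 (fieldValue φ x)) := by
  obtain ⟨f, hf⟩ := hφ
  rw [hf.fieldValue_eq]
  simp only [hf.2 _ (hasCompactSupport_mollifier _ x)]
  exact tendsto_integral_mul_mollifier hf.1 x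

theorem tendsto_cosT_mollifier (x p : Pt d) :
    Tendsto (fun n => cosT (mollifier n x) p) atTop (𝓝 (Real.cos ⟪p, x⟫)) := by
  simp only [cosT, mul_comm (mollifier _ x _)]
  exact tendsto_integral_mul_mollifier (f := fun x => Real.cos ⟪p, x⟫) (by fun_prop) x

theorem tendsto_sinT_mollifier (x p : Pt d) :
    Tendsto (fun n => sinT (mollifier n x) p) atTop (𝓝 (Real.sin ⟪p, x⟫)) := by
  simp only [sinT, mul_comm (mollifier _ x _)]
  exact tendsto_integral_mul_mollifier (f := fun x => Real.sin ⟪p, x⟫) (by fun_prop) x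

variable [IsFiniteMeasure μ]

theorem abs_cosT_mul_add_sinT_mul_le (J K : 𝓢(Pt d, ℝ)) (p : Pt d) :
    |cosT J p * cosT K p + sinT J p * sinT K p| ≤ 2 * ((∫ x, |J x|) * ∫ x, |K x|) := by
  rw [two_mul]
  refine (abs_add_le _ _).trans (add_le_add ?_ ?_) <;> rw [abs_mul]
  · exact mul_le_mul (abs_cosT_le _ _) (abs_cosT_le _ _) (abs_nonneg _)
      (integral_nonneg fun _ => abs_nonneg _)
  · exact mul_le_mul (abs_sinT_le _ _) (abs_sinT_le _ _) (abs_nonneg _)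
      (integral_nonneg fun _ => abs_nonneg _)

theorem tendsto_specForm_mollifier_mollifier (x y : Pt d) :
    Tendsto (fun n => specForm μ (mollifier n x) (mollifier n y)) atTop (𝓝 (kern μ (x - y))) := by
  refine tendsto_integral_of_dominated_convergence (fun _ => 2)
    (fun n => (integrable_specForm μ _ _).aestronglyMeasurable) (integrable_const _)
    (fun n => ae_of_all _ fun p => ?_) (ae_of_all _ fun p => ?_)
  · refine (abs_cosT_mul_add_sinT_mul_le _ _ _).trans (le_of_eq ?_)
    rw [integral_abs_mollifier, integral_abs_mollifier]; norm_num
  · rw [inner_sub_right, Real.cos_sub]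
    exact ((tendsto_cosT_mollifier x p).mul (tendsto_cosT_mollifier y p)).add
      ((tendsto_sinT_mollifier x p).mul (tendsto_sinT_mollifier y p))

theorem tendsto_specForm_mollifier (x : Pt d) (J : 𝓢(Pt d, ℝ)) :
    Tendsto (fun n => specForm μ (mollifier n x) J) atTop (𝓝 (potential μ J x)) := by
  refine tendsto_integral_of_dominated_convergence (fun _ => 2 * (1 * ∫ x, |J x|))
    (fun n => (integrable_specForm μ _ _).aestronglyMeasurable) (integrable_const _)
    (fun n => ae_of_all _ fun p => ?_) (ae_of_all _ fun p => ?_)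
  · refine (abs_cosT_mul_add_sinT_mul_le _ _ _).trans (le_of_eq ?_)
    rw [integral_abs_mollifier]
  · simp only [mul_comm (cosT J p), mul_comm (sinT J p)]
    exact ((tendsto_cosT_mollifier x p).mul_const _).add
      ((tendsto_sinT_mollifier x p).mul_const _)

theorem specForm_sum_left {ι : Type*} (s : Finset ι) (F : ι → 𝓢(Pt d, ℝ)) (K : 𝓢(Pt d, ℝ)) :
    specForm μ (∑ i ∈ s, F i) K = ∑ i ∈ s, specForm μ (F i) K := by
  classical
  induction s using Finset.induction_on with
  | empty => simpa using specForm_smul_left μ 0 (0 : 𝓢(Pt d, ℝ)) K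
  | insert i s hi ih => rw [Finset.sum_insert hi, Finset.sum_insert hi, specForm_add_left, ih]

theorem specForm_sum_right {ι : Type*} (s : Finset ι) (F : ι → 𝓢(Pt d, ℝ)) (K : 𝓢(Pt d, ℝ)) :
    specForm μ K (∑ i ∈ s, F i) = ∑ i ∈ s, specForm μ K (F i) := by
  simp only [specForm_comm μ K, specForm_sum_left]

/-- `fieldValue` is defined by choice, so measurability is obtained only almost everywhere, as a
limit of pairings with mollifiers. The joint version in point and field is what Fubini requires. -/
theorem aemeasurable_fieldValue_prod {α : Type*} [TopologicalSpace α]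
    [TopologicalSpace.MetrizableSpace α] [SecondCountableTopology α] [MeasurableSpace α]
    [OpensMeasurableSpace α] (ρ : Measure α) {P : Measure (FieldConfig d)} [SFinite P]
    (hP : ∀ᵐ φ ∂P, ∃ f : Pt d → ℝ, IsGivenBy φ f) {u : α → Pt d} (hu : Continuous u) :
    AEMeasurable (fun z : α × FieldConfig d => fieldValue z.2 (u z.1)) (ρ.prod P) := by
  refine aemeasurable_of_tendsto_metrizable_ae' (f := fun n z => z.2 (mollifier n (u z.1)))
    (fun n => (measurable_eval_uncurry ((continuous_mollifier n).comp hu)).aemeasurable) ?_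
  filter_upwards [Measure.quasiMeasurePreserving_snd.ae hP] with z hz
  exact tendsto_eval_mollifier hz _

theorem aemeasurable_fieldValue {P : Measure (FieldConfig d)}
    (hP : ∀ᵐ φ ∂P, ∃ f : Pt d → ℝ, IsGivenBy φ f) (x : Pt d) :
    AEMeasurable (fun φ : FieldConfig d => fieldValue φ x) P := by
  refine aemeasurable_of_tendsto_metrizable_ae' (f := fun n φ => φ (mollifier n x))
    (fun n => (measurable_eval _).aemeasurable) ?_
  filter_upwards [hP] with φ hφ using tendsto_eval_mollifier hφ _

/-- The values of the field at finitely many points. -/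
def fieldVector {ι : Type*} (x : ι → Pt d) (φ : FieldConfig d) : EuclideanSpace ℝ ι :=
  WithLp.toLp 2 fun i => fieldValue φ (x i)

theorem aemeasurable_fieldVector {ι : Type*} [Fintype ι] {P : Measure (FieldConfig d)}
    (hP : ∀ᵐ φ ∂P, ∃ f : Pt d → ℝ, IsGivenBy φ f) (x : ι → Pt d) :
    AEMeasurable (fieldVector x) P :=
  (WithLp.measurable_toLp 2 (ι → ℝ)).comp_aemeasurable
    (aemeasurable_pi_lambda _ fun i => aemeasurable_fieldValue hP (x i))

/-- Under the tilted measure the values of the field at finitely many points are jointly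
Gaussian. -/
theorem IsGaussianField.charFun_map_fieldVector {ι : Type*} [Fintype ι]
    (h : IsGaussianField μ ν) (hν : ∀ᵐ φ ∂ν, ∃ f : Pt d → ℝ, IsGivenBy φ f)
    (J : 𝓢(Pt d, ℝ)) (x : ι → Pt d) (t : EuclideanSpace ℝ ι) :
    charFun ((ν.tilted fun φ => φ J).map (fieldVector x)) t =
      Complex.exp (⟪t, WithLp.toLp 2 fun i => potential μ J (x i)⟫ * Complex.I -
        t ⬝ᵥ (Matrix.of fun i j => kern μ (x i - x j)).mulVec t / 2) := by
  have := h.isProbabilityMeasure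
  have := isProbabilityMeasure_tilted (h.integrable_exp_eval J)
  set P := ν.tilted fun φ => φ J with hP
  have hPae : ∀ᵐ φ ∂P, ∃ f : Pt d → ℝ, IsGivenBy φ f :=
    (tilted_absolutelyContinuous ν _).ae_le hν
  rw [charFun_apply, integral_map (aemeasurable_fieldVector hPae x)
    (Continuous.aestronglyMeasurable (by fun_prop))]
  -- `φ (K n)` converges to the inner product of `t` with the vector of field values. The
  -- characteristic functional at `K n` is known for each `n`, and both of its forms converge.
  set K : ℕ → 𝓢(Pt d, ℝ) := fun n => ∑ i, t i • mollifier n (x i) with hK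
  have h1 : Tendsto (fun n => ∫ φ : FieldConfig d, Complex.exp (Complex.I * ((φ (K n) : ℝ) : ℂ)) ∂P)
      atTop (𝓝 (∫ φ, Complex.exp (⟪fieldVector x φ, t⟫ * Complex.I) ∂P)) := by
    refine tendsto_integral_of_dominated_convergence (fun _ => 1) (fun n => ?_)
      (integrable_const _) (fun n => ae_of_all _ fun φ => ?_) ?_
    · have := measurable_eval (K n)
      exact (Complex.measurable_exp.comp
        ((Complex.measurable_ofReal.comp this).const_mul Complex.I)).aestronglyMeasurable
    · rw [mul_comm, Complex.norm_exp_ofReal_mul_I]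
    · filter_upwards [hPae] with φ hφ
      have h2 : Tendsto (fun n => φ (K n)) atTop (𝓝 ⟪fieldVector x φ, t⟫) := by
        simp only [hK, map_sum, map_smul, smul_eq_mul, PiLp.inner_apply, fieldVector]
        exact tendsto_finsetSum _ fun i _ => (tendsto_eval_mollifier hφ (x i)).const_mul (t i)
      simp only [mul_comm _ Complex.I]
      exact (Complex.continuous_exp.tendsto _).comp
        (((Complex.continuous_ofReal.tendsto _).comp h2).const_mul Complex.I)
  refine tendsto_nhds_unique h1 ?_
  simp only [hP, h.integral_cexp_tilted]
  have h3 : Tendsto (fun n => specForm μ (K n) (K n)) atTop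
      (𝓝 (t ⬝ᵥ (Matrix.of fun i j => kern μ (x i - x j)).mulVec t)) := by
    simp only [hK, specForm_sum_left, specForm_sum_right, specForm_smul_left,
      specForm_smul_right, dotProduct, Matrix.mulVec, Finset.mul_sum, Matrix.of_apply]
    refine tendsto_finsetSum _ fun i _ => tendsto_finsetSum _ fun j _ => ?_
    rw [mul_comm (kern μ _)]
    simp only [specForm_comm μ (mollifier _ (x j))]
    exact ((tendsto_specForm_mollifier_mollifier (x i) (x j)).const_mul _).const_mul _
  have h4 : Tendsto (fun n => specForm μ (K n) J) atTop
      (𝓝 ⟪t, WithLp.toLp 2 fun i => potential μ J (x i)⟫) := by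
    simp only [hK, specForm_sum_left, specForm_smul_left, PiLp.inner_apply]
    refine tendsto_finsetSum _ fun i _ => ?_
    have := (tendsto_specForm_mollifier (μ := μ) (x i) J).const_mul (t i)
    simpa [mul_comm] using this
  generalize (t ⬝ᵥ (Matrix.of fun i j => kern μ (x i - x j)).mulVec t) = q at h3 ⊢
  generalize ⟪t, WithLp.toLp 2 fun i => potential μ J (x i)⟫ = l at h4 ⊢
  rw [show (l : ℂ) * Complex.I - q / 2 = -(1 / 2) * q + Complex.I * l by ring]
  exact (Complex.continuous_exp.tendsto _).comp
    ((((Complex.continuous_ofReal.tendsto _).comp h3).const_mul _).add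
      (((Complex.continuous_ofReal.tendsto _).comp h4).const_mul _))

end PointValues

/-! ### Decorrelation integrated over the positions. -/

section Decorrelation

variable {d : ℕ} {μ : Measure (Pt d)} {ν : Measure (FieldConfig d)}

theorem kern_neg (x : Pt d) : kern μ (-x) = kern μ x := by
  simp only [kern, inner_neg_right, Real.cos_neg]

theorem IsGaussianField.isProbabilityMeasure_tilted (h : IsGaussianField μ ν) (J : 𝓢(Pt d, ℝ)) :
    IsProbabilityMeasure (ν.tilted fun φ => φ J) := by
  have := h.isProbabilityMeasure
  exact MeasureTheory.isProbabilityMeasure_tilted (h.integrable_exp_eval J)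

/-- Decorrelation of bounded functions of the field at finitely many points. -/
theorem IsGaussianField.abs_integral_prod_sub_prod_le [IsFiniteMeasure μ]
    (h : IsGaussianField μ ν) (hν : ∀ᵐ φ ∂ν, ∃ f : Pt d → ℝ, IsGivenBy φ f)
    (hs : 0 < kern μ 0) (J : 𝓢(Pt d, ℝ)) {V : ℝ → ℝ} (hV : Measurable V) {A : ℝ}
    (hA : ∀ w, |V w| ≤ A) {ι : Type*} [Fintype ι] [DecidableEq ι] (x : ι → Pt d) :
    |∫ φ, ∏ i, V (fieldValue φ (x i)) ∂(ν.tilted fun φ => φ J) -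
        ∏ i, ∫ φ, V (fieldValue φ (x i)) ∂(ν.tilted fun φ => φ J)| ≤
      6 * Fintype.card ι * √(offDiagSum (Matrix.of fun i j => kern μ (x i - x j)) / kern μ 0) *
        A ^ Fintype.card ι := by
  have := h.isProbabilityMeasure_tilted J
  have hPae : ∀ᵐ φ ∂(ν.tilted fun φ => φ J), ∃ f : Pt d → ℝ, IsGivenBy φ f :=
    (tilted_absolutelyContinuous ν _).ae_le hν
  have hx := aemeasurable_fieldVector hPae x
  have := Measure.isProbabilityMeasure_map hx
  have key := prod_decorrelation ((ν.tilted fun φ => φ J).map (fieldVector x))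
    (WithLp.toLp 2 fun i => potential μ J (x i))
    (S := Matrix.of fun i j => kern μ (x i - x j))
    (Matrix.IsSymm.ext fun i j => by
      simp only [Matrix.of_apply]; rw [← kern_neg, neg_sub]) hs
    (fun i => by simp) (h.charFun_map_fieldVector hν J x) hV hA
  rw [integral_map hx (Measurable.aestronglyMeasurable (by fun_prop))] at key
  have e : ∀ i, ∫ y, V (y i) ∂((ν.tilted fun φ => φ J).map (fieldVector x)) =
      ∫ φ, V (fieldValue φ (x i)) ∂(ν.tilted fun φ => φ J) := fun i =>
    integral_map hx (f := fun y : EuclideanSpace ℝ ι => V (y i))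
      (Measurable.aestronglyMeasurable (by fun_prop))
  simp only [e] at key
  exact key

theorem integrable_comp_sub_pi {n : ℕ} {ρ : Measure (Pt d)} [IsFiniteMeasure ρ] {f : Pt d → ℝ}
    (hf : Continuous f) {c : ℝ} (hc : ∀ x, |f x| ≤ c) (i j : Fin n) :
    Integrable (fun x : Fin n → Pt d => f (x i - x j)) (Measure.pi fun _ => ρ) :=
  (integrable_const c).mono' (Continuous.aestronglyMeasurable (by fun_prop))
    (ae_of_all _ fun _ => hc _)

/-- Integrating out `x i` first, and enlarging its domain from `B` to the whole space, gives `∫ f`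
by translation invariance whatever `x j` is; the other `n` points contribute the volume of `B` each.
-/
theorem integral_comp_sub_pi_le {n : ℕ} {B : Set (Pt d)} (hB : volume B ≠ ⊤) {f : Pt d → ℝ}
    (hf : Continuous f) (hf0 : ∀ x, 0 ≤ f x) {c : ℝ} (hc : ∀ x, |f x| ≤ c) (hfi : Integrable f)
    {i j : Fin (n + 1)} (hij : i ≠ j) :
    ∫ x : Fin (n + 1) → Pt d, f (x i - x j) ∂(Measure.pi fun _ => volume.restrict B) ≤
      volume.real B ^ n * ∫ x, f x := by
  have : IsFiniteMeasure (volume.restrict B) := ⟨by simpa using hB.lt_top⟩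
  obtain ⟨k, rfl⟩ := Fin.exists_succAbove_eq hij.symm
  have hmp := measurePreserving_piFinSuccAbove (fun _ : Fin (n + 1) => volume.restrict B) i
  have e1 := hmp.integral_comp' (fun z : Pt d × (Fin n → Pt d) => f (z.1 - z.2 k))
  have hint : Integrable (fun z : Pt d × (Fin n → Pt d) => f (z.1 - z.2 k))
      ((volume.restrict B).prod (Measure.pi fun _ => volume.restrict B)) :=
    (integrable_const c).mono' (Continuous.aestronglyMeasurable (by fun_prop))
      (ae_of_all _ fun _ => hc _)
  rw [integral_prod_symm _ hint] at e1
  refine (le_of_eq e1).trans ?_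
  have hb : ∀ y : Fin n → Pt d, ∫ x in B, f (x - y k) ≤ ∫ x, f x := fun y => by
    rw [← integral_sub_right_eq_self f (y k)]
    exact setIntegral_le_integral (hfi.comp_sub_right (y k)) (ae_of_all _ fun x => hf0 _)
  calc _ ≤ ∫ _ : Fin n → Pt d, (∫ x, f x) ∂(Measure.pi fun _ => volume.restrict B) :=
        integral_mono hint.integral_prod_right (integrable_const _) hb
    _ = _ := by
        rw [integral_const, smul_eq_mul]
        congr 1
        simp [measureReal_def, Measure.pi_univ, ENNReal.toReal_pow]

theorem integrable_offDiagSum {n : ℕ} {ρ : Measure (Pt d)} [IsFiniteMeasure ρ] {f : Pt d → ℝ}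
    (hf : Continuous f) {c : ℝ} (hc : ∀ x, |f x| ≤ c) :
    Integrable (fun x : Fin n → Pt d => offDiagSum (Matrix.of fun i j => f (x i - x j)))
      (Measure.pi fun _ => ρ) := by
  refine integrable_finsetSum _ fun i _ => integrable_finsetSum _ fun j _ => ?_
  split_ifs
  · exact integrable_zero _ _ _
  · exact (integrable_comp_sub_pi hf hc i j).abs

theorem integral_offDiagSum_le {n : ℕ} {B : Set (Pt d)} (hB : volume B ≠ ⊤) {f : Pt d → ℝ}
    (hf : Continuous f) {c : ℝ} (hc : ∀ x, |f x| ≤ c) (hfi : Integrable f) :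
    ∫ x : Fin (n + 1) → Pt d, offDiagSum (Matrix.of fun i j => f (x i - x j))
        ∂(Measure.pi fun _ => volume.restrict B) ≤
      ((n + 1 : ℕ) : ℝ) ^ 2 * (volume.real B ^ n * ∫ x, |f x|) := by
  have : IsFiniteMeasure (volume.restrict B) := ⟨by simpa using hB.lt_top⟩
  have hi : ∀ i j : Fin (n + 1), Integrable (fun x : Fin (n + 1) → Pt d =>
      if i = j then 0 else |f (x i - x j)|) (Measure.pi fun _ => volume.restrict B) := by
    intro i j
    split_ifs
    · exact integrable_zero _ _ _
    · exact (integrable_comp_sub_pi hf hc i j).abs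
  have h0 : 0 ≤ volume.real B ^ n * ∫ x, |f x| :=
    mul_nonneg (by positivity) (integral_nonneg fun _ => abs_nonneg _)
  simp only [offDiagSum, Matrix.of_apply]
  rw [integral_finsetSum _ fun i _ => integrable_finsetSum _ fun j _ => hi i j]
  simp only [integral_finsetSum _ fun j _ => hi _ j]
  calc _ ≤ ∑ _ : Fin (n + 1), ∑ _ : Fin (n + 1), volume.real B ^ n * ∫ x, |f x| := by
        refine Finset.sum_le_sum fun i _ => Finset.sum_le_sum fun j _ => ?_
        split_ifs with hij
        · simpa using h0
        · exact integral_comp_sub_pi_le hB hf.abs (fun _ => abs_nonneg _) (c := c)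
            (fun x => by rw [abs_abs]; exact hc x) hfi.abs hij
    _ = _ := by simp; ring

/-- AM–GM makes the decorrelation bound linear in the off-diagonal weight, so that it can be
integrated term by term; `a` is optimized at the end. -/
theorem sqrt_le_half_mul_add_inv {a : ℝ} (ha : 0 < a) {δ : ℝ} (hδ : 0 ≤ δ) :
    √δ ≤ (a * δ + 1 / a) / 2 := by
  have h1 := Real.sq_sqrt hδ
  have h2 : (a * δ + 1 / a) / 2 - √δ = (a * √δ - 1) ^ 2 / (2 * a) := by
    nth_rewrite 1 [← h1]
    field_simp; ring
  have h3 : 0 ≤ (a * √δ - 1) ^ 2 / (2 * a) := by positivity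
  linarith

theorem aestronglyMeasurable_prod_fieldValue {P : Measure (FieldConfig d)} [SFinite P]
    (hP : ∀ᵐ φ ∂P, ∃ f : Pt d → ℝ, IsGivenBy φ f) {V : ℝ → ℝ} (hV : Measurable V) (n : ℕ)
    (ρ : Measure (Fin n → Pt d)) :
    AEStronglyMeasurable (fun z : (Fin n → Pt d) × FieldConfig d =>
      ∏ i, V (fieldValue z.2 (z.1 i))) (ρ.prod P) := by
  refine AEMeasurable.aestronglyMeasurable ?_
  exact Finset.aemeasurable_fun_prod _ fun i _ => hV.comp_aemeasurable
    (aemeasurable_fieldValue_prod ρ hP (continuous_apply i))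

/-- By Fubini both terms are integrals over `B ^ (n + 1)`, one of the mean of `∏ V` and one of the
product of means; the pointwise decorrelation bound is then integrated. -/
theorem IsGaussianField.abs_integral_pow_sub_pow_le [IsFiniteMeasure μ]
    (h : IsGaussianField μ ν) (hν : ∀ᵐ φ ∂ν, ∃ f : Pt d → ℝ, IsGivenBy φ f)
    (hs : 0 < kern μ 0) (hk : Integrable (kern μ)) (J : 𝓢(Pt d, ℝ)) {V : ℝ → ℝ}
    (hV : Measurable V) {A : ℝ} (hA : ∀ w, |V w| ≤ A) {B : Set (Pt d)} (hB : volume B ≠ ⊤)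
    (n : ℕ) {a : ℝ} (ha : 0 < a) :
    |∫ φ, (∫ x in B, V (fieldValue φ x)) ^ (n + 1) ∂(ν.tilted fun φ => φ J) -
        (∫ φ, (∫ x in B, V (fieldValue φ x)) ∂(ν.tilted fun φ => φ J)) ^ (n + 1)| ≤
      3 * (n + 1 : ℕ) * A ^ (n + 1) * (a * (((n + 1 : ℕ) : ℝ) ^ 2 *
        (volume.real B ^ n * ∫ x, |kern μ x|) / kern μ 0) + volume.real B ^ (n + 1) / a) := by
  have hPp := h.isProbabilityMeasure_tilted J
  have hPae : ∀ᵐ φ ∂(ν.tilted fun φ => φ J), ∃ f : Pt d → ℝ, IsGivenBy φ f :=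
    (tilted_absolutelyContinuous ν _).ae_le hν
  set P := ν.tilted fun φ => φ J with hP
  have : IsFiniteMeasure (volume.restrict B) := ⟨by simpa using hB.lt_top⟩
  set ρ := (volume : Measure (Pt d)).restrict B with hρ
  set Q : Measure (Fin (n + 1) → Pt d) := Measure.pi fun _ => ρ with hQ
  have hA0 : 0 ≤ A := (abs_nonneg _).trans (hA 0)
  have i1 : Integrable (fun z : (Fin (n + 1) → Pt d) × FieldConfig d =>
      ∏ i, V (fieldValue z.2 (z.1 i))) (Q.prod P) :=
    (integrable_const (A ^ (n + 1))).mono' (aestronglyMeasurable_prod_fieldValue hPae hV _ Q)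
      (ae_of_all _ fun z => by
        simpa only [Fintype.card_fin, Real.norm_eq_abs] using
          abs_prod_le_pow (a := fun i => V (fieldValue z.2 (z.1 i))) fun i => hA _)
  have i2 : Integrable (fun z : Pt d × FieldConfig d => V (fieldValue z.2 z.1)) (ρ.prod P) :=
    (integrable_const A).mono' (hV.comp_aemeasurable
      (aemeasurable_fieldValue_prod ρ hPae continuous_id)).aestronglyMeasurable
      (ae_of_all _ fun z => hA _)
  have e1 : ∫ φ, (∫ x, V (fieldValue φ x) ∂ρ) ^ (n + 1) ∂P =
      ∫ x, (∫ φ, ∏ i, V (fieldValue φ (x i)) ∂P) ∂Q := by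
    rw [integral_integral_swap
      (f := fun (x : Fin (n + 1) → Pt d) φ => ∏ i, V (fieldValue φ (x i))) i1]
    congr 1; ext φ
    rw [hQ, integral_fintype_prod_eq_pow (fun x => V (fieldValue φ x)), Fintype.card_fin]
  have e2 : (∫ φ, (∫ x, V (fieldValue φ x) ∂ρ) ∂P) ^ (n + 1) =
      ∫ x, (∏ i, ∫ φ, V (fieldValue φ (x i)) ∂P) ∂Q := by
    rw [← integral_integral_swap (f := fun (x : Pt d) φ => V (fieldValue φ x)) i2, hQ,
      integral_fintype_prod_eq_pow (fun x => ∫ φ, V (fieldValue φ x) ∂P), Fintype.card_fin]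
  have i3 : Integrable (fun x : Fin (n + 1) → Pt d => ∏ i, ∫ φ, V (fieldValue φ (x i)) ∂P) Q :=
    Integrable.fintype_prod (f := fun (_ : Fin (n + 1)) x => ∫ φ, V (fieldValue φ x) ∂P)
      fun _ => i2.integral_prod_left
  have hkc := continuous_kern μ
  have hkb : ∀ x, |kern μ x| ≤ μ.real Set.univ := fun x =>
    (abs_integral_le_integral_of_abs_le (integrable_const 1)
      (ae_of_all _ fun p => Real.abs_cos_le_one _)).trans (by simp)
  have i4 := integrable_offDiagSum (n := n + 1) (ρ := ρ) hkc hkb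
  rw [← hQ] at i4
  have i5 : Integrable (fun x : Fin (n + 1) → Pt d => 3 * (n + 1 : ℕ) * A ^ (n + 1) *
      (a / kern μ 0 * offDiagSum (Matrix.of fun i j => kern μ (x i - x j)) + 1 / a)) Q :=
    ((i4.const_mul _).add (integrable_const _)).const_mul _
  have hQu : Q.real Set.univ = volume.real B ^ (n + 1) := by
    simp [hQ, hρ, measureReal_def, Measure.pi_univ, ENNReal.toReal_pow]
  rw [e1, e2, ← integral_sub i1.integral_prod_left i3]
  calc _ ≤ ∫ x : Fin (n + 1) → Pt d, 3 * (n + 1 : ℕ) * A ^ (n + 1) * (a / kern μ 0 *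
        offDiagSum (Matrix.of fun i j => kern μ (x i - x j)) + 1 / a) ∂Q := by
        refine abs_integral_le_integral_of_abs_le i5 (ae_of_all _ fun x => ?_)
        refine (h.abs_integral_prod_sub_prod_le hν hs J hV hA x).trans ?_
        have h1 := sqrt_le_half_mul_add_inv ha (div_nonneg
          (offDiagSum_nonneg (Matrix.of fun i j => kern μ (x i - x j))) hs.le)
        rw [Fintype.card_fin]
        calc _ ≤ 6 * ((n + 1 : ℕ) : ℝ) * ((a * (offDiagSum (Matrix.of fun i j =>
              kern μ (x i - x j)) / kern μ 0) + 1 / a) / 2) * A ^ (n + 1) := by gcongr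
          _ = _ := by ring
    _ = 3 * (n + 1 : ℕ) * A ^ (n + 1) * (a / kern μ 0 * (∫ x : Fin (n + 1) → Pt d,
        offDiagSum (Matrix.of fun i j => kern μ (x i - x j)) ∂Q) +
          volume.real B ^ (n + 1) / a) := by
        rw [integral_const_mul, integral_add (i4.const_mul _) (integrable_const _),
          integral_const_mul, integral_const, hQu, smul_eq_mul, mul_one_div]
    _ ≤ 3 * (n + 1 : ℕ) * A ^ (n + 1) * (a / kern μ 0 * (((n + 1 : ℕ) : ℝ) ^ 2 *
        (volume.real B ^ n * ∫ x, |kern μ x|)) + volume.real B ^ (n + 1) / a) := by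
        have := integral_offDiagSum_le (n := n) hB hkc hkb hk
        rw [← hρ, ← hQ] at this
        gcongr
    _ = _ := by ring

end Decorrelation

/-! ### The box, integrability of the interaction, and moments as tilted expectations. -/

section Box

variable {d : ℕ} {L : ℝ}

theorem box_eq_preimage (d : ℕ) (L : ℝ) :
    box d L = (WithLp.ofLp : Pt d → Fin d → ℝ) ⁻¹' Set.Icc (fun _ => -(L / 2)) (fun _ => L / 2) := by
  ext x
  simp only [box, Set.mem_ofPred_eq, Set.mem_preimage, Set.mem_Icc, Pi.le_def, forall_and]

theorem volume_box (d : ℕ) (L : ℝ) : volume (box d L) = ENNReal.ofReal L ^ d := by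
  rw [box_eq_preimage, (PiLp.volume_preserving_ofLp (Fin d)).measure_preimage
    measurableSet_Icc.nullMeasurableSet, Real.volume_Icc_pi]
  simp

theorem volume_box_ne_top (d : ℕ) (L : ℝ) : volume (box d L) ≠ ⊤ := by
  rw [volume_box]; exact ENNReal.pow_ne_top ENNReal.ofReal_ne_top

theorem volumeReal_box_pos (d : ℕ) (hL : 0 < L) : 0 < volume.real (box d L) := by
  rw [measureReal_def, volume_box]
  exact ENNReal.toReal_pos (pow_ne_zero _ (by simpa using hL))
    (ENNReal.pow_ne_top ENNReal.ofReal_ne_top)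

theorem abs_interaction_le (L : ℝ) {V : ℝ → ℝ} {A : ℝ} (hA : ∀ w, |V w| ≤ A)
    (φ : FieldConfig d) : |interaction L V φ| ≤ A * volume.real (box d L) := by
  have := norm_setIntegral_le_of_norm_le_const (μ := volume) (volume_box_ne_top d L).lt_top
    (f := fun x => V (fieldValue φ x)) (C := A) fun x _ => hA _
  simpa [interaction] using this

theorem aestronglyMeasurable_interaction {ν : Measure (FieldConfig d)} [SFinite ν]
    (hν : ∀ᵐ φ ∂ν, ∃ f : Pt d → ℝ, IsGivenBy φ f) (L : ℝ) {V : ℝ → ℝ} (hV : Measurable V) :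
    AEStronglyMeasurable (interaction (d := d) L V) ν := by
  have h := (hV.comp_aemeasurable (aemeasurable_fieldValue_prod (volume.restrict (box d L)) hν
    continuous_id)).aestronglyMeasurable
  exact h.prod_swap.integral_prod_right'

theorem integrable_exp_mul_interaction_pow {μ : Measure (Pt d)} {ν : Measure (FieldConfig d)}
    (h : IsGaussianField μ ν) (hν : ∀ᵐ φ ∂ν, ∃ f : Pt d → ℝ, IsGivenBy φ f) (L : ℝ)
    {V : ℝ → ℝ} (hV : Measurable V) {A : ℝ} (hA : ∀ w, |V w| ≤ A) (J : 𝓢(Pt d, ℝ)) (ℓ : ℕ) :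
    Integrable (fun φ : FieldConfig d => Real.exp (φ J) * interaction L V φ ^ ℓ) ν := by
  have := h.isProbabilityMeasure
  refine (h.integrable_exp_eval J).mul_bdd (c := (A * volume.real (box d L)) ^ ℓ)
    ((aestronglyMeasurable_interaction hν L hV).pow ℓ) (ae_of_all _ fun φ => ?_)
  rw [norm_pow, Real.norm_eq_abs]
  exact pow_le_pow_left₀ (abs_nonneg _) (abs_interaction_le L hA φ) ℓ

theorem moment_div_normalization (ν : Measure (FieldConfig d)) (L : ℝ) (V : ℝ → ℝ)
    (J : 𝓢(Pt d, ℝ)) (ℓ : ℕ) : moment ν L V J ℓ / normalization ν J =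
      ∫ φ, interaction L V φ ^ ℓ ∂(ν.tilted fun φ => φ J) := by
  rw [integral_tilted, moment, normalization, ← integral_div]
  congr 1; ext φ
  rw [smul_eq_mul]; ring

end Box

/-! ### Constants and conclusion. -/

/-- `Z` multiplies both the integral of the covariance and its value at the origin, so it cancels;
hence the uniformity in `Z`. -/
theorem kern_specMeas_ratio_le {d : ℕ} {m Λ Z κ : ℝ} (hm : 0 < m) (hΛ : 0 < Λ) (hZ : 0 < Z)
    (hκ : 0 < κ) (hcov : κ ≤ cov d m Λ 0) :
    (∫ x, |kern (specMeas d m Λ Z) x|) / kern (specMeas d m Λ Z) 0 ≤ 1 / (m ^ 2 * κ) := by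
  obtain ⟨hci, hcl⟩ := integrable_cov_and_integral_le (d := d) hm hΛ
  simp only [kern_specMeas hm hΛ hZ, abs_of_nonneg (mul_nonneg hZ.le (cov_nonneg hm hΛ _))]
  rw [integral_const_mul]
  calc _ ≤ Z * (1 / m ^ 2) / (Z * κ) := by gcongr
    _ = _ := by field_simp

/-- The off-diagonal term carries one factor of the volume `b` fewer than claimed, which is where
`max 1 (1 / b)` comes from. The argument gives the power `N ^ 3`, relaxed to `N ^ 6`. -/
theorem decorrelation_bound_le {q b A a k I : ℝ} (hq : 0 < q) (hb : 0 < b) (hA : 0 ≤ A)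
    (ha : 0 < a) (n : ℕ) (hI0 : 0 ≤ I / k) (hI : I / k ≤ q / a ^ 2) :
    3 * (n + 1 : ℕ) * A ^ (n + 1) * (a * (((n + 1 : ℕ) : ℝ) ^ 2 * (b ^ n * I) / k) +
        b ^ (n + 1) / a) ≤
      3 * (q + 1) * max 1 (1 / b) * ((n + 1 : ℕ) : ℝ) ^ 6 * A ^ (n + 1) * b ^ (n + 1) *
        (1 / a) := by
  have hN1 : 1 ≤ ((n + 1 : ℕ) : ℝ) := by exact_mod_cast Nat.le_add_left 1 n
  generalize ((n + 1 : ℕ) : ℝ) = N at hN1 ⊢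
  have hmax1 : 1 ≤ max 1 (1 / b) := le_max_left _ _
  have hmax2 : 1 / b ≤ max 1 (1 / b) := le_max_right _ _
  generalize max 1 (1 / b) = M at hmax1 hmax2 ⊢
  have hN2 : 1 ≤ N ^ 2 := one_le_pow₀ hN1
  calc _ = 3 * N * A ^ (n + 1) * (a * (N ^ 2 * b ^ (n + 1) * (1 / b) * (I / k)) +
          b ^ (n + 1) * 1 * 1 / a) := by
        rw [pow_succ b n]; field_simp
    _ ≤ 3 * N * A ^ (n + 1) * (a * (N ^ 2 * b ^ (n + 1) * M * (q / a ^ 2)) +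
          b ^ (n + 1) * N ^ 2 * M / a) := by gcongr
    _ = 3 * (q + 1) * M * N ^ 3 * A ^ (n + 1) * b ^ (n + 1) * (1 / a) := by
        field_simp
    _ ≤ 3 * (q + 1) * M * N ^ 6 * A ^ (n + 1) * b ^ (n + 1) * (1 / a) := by
        gcongr
        norm_num

end BoundedQFT

end

open BoundedQFT in
theorem proposition2 (d : ℕ) (hd : 2 ≤ d) (m : ℝ) (hm : 0 < m) :
    ∃ c : ℝ, 0 < c ∧
      ∀ (L : ℝ), 0 < L →
      ∀ (Λ : ℝ), 0 < Λ → 1 ≤ Real.log Λ →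
      ∀ (Z : ℝ), 0 < Z →
      ∀ (ν : Measure (FieldConfig d)), IsFreeMeasure d m Λ Z ν →
      ∀ (V : ℝ → ℝ), Measurable V → (∃ K : ℝ, ∀ w, |V w| ≤ K) →
      ∀ (J : 𝓢(Pt d, ℝ)) (ℓ : ℕ),
        (∀ᵐ φ ∂ν, ∃ f : Pt d → ℝ, IsGivenBy φ f) ∧
        Integrable (fun φ : FieldConfig d => Real.exp (φ J)) ν ∧
        Integrable (fun φ : FieldConfig d => Real.exp (φ J) * interaction L V φ ^ ℓ) ν ∧
        |moment ν L V J ℓ / normalization ν J - (moment ν L V J 1 / normalization ν J) ^ ℓ| ≤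
          c * max 1 (1 / volume.real (box d L)) * (ℓ : ℝ) ^ 6 * supNorm V ^ ℓ *
            volume.real (box d L) ^ ℓ * (1 / Real.sqrt (Real.log Λ)) := by
  obtain ⟨c₀, hc₀, hcov⟩ := exists_log_le_cov_zero (d := d) (m := m) hd hm
  have hm2 : 0 < m ^ 2 := by positivity
  -- `1 / m²` bounds the integral of the covariance and `c₀ * log Λ` bounds its value at the origin
  -- from below; the factor 3 is half of the 6 in `prod_decorrelation`, the other half being used by
  -- AM–GM.
  refine ⟨3 * (1 / (m ^ 2 * c₀) + 1), by positivity, ?_⟩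
  intro L hL Λ hΛ hlog Z hZ ν hfree V hV hK J ℓ
  have hμfin := isFiniteMeasure_specMeas (d := d) (Z := Z) hm hΛ
  have h := hfree.isGaussianField hm hΛ hZ
  have hprob := h.isProbabilityMeasure
  have hν := h.ae_exists_isGivenBy (integrable_pow_specMeas hm hΛ hZ)
  have hA : ∀ w, |V w| ≤ supNorm V := by
    obtain ⟨K, hK⟩ := hK
    exact fun w => le_ciSup (f := fun w => |V w|) ⟨K, by rintro _ ⟨w, rfl⟩; exact hK w⟩ w
  refine ⟨hν, h.integrable_exp_eval J, integrable_exp_mul_interaction_pow h hν L hV hA J ℓ, ?_⟩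
  have := h.isProbabilityMeasure_tilted J
  simp only [moment_div_normalization, pow_one]
  -- For `ℓ = 0` both terms equal 1, the tilted measure being a probability measure, so the
  -- difference vanishes.
  rcases ℓ with _ | n
  · simp
  have hA0 : 0 ≤ supNorm V := (abs_nonneg _).trans (hA 0)
  have hlg0 : 0 < Real.log Λ := by linarith
  have ha0 : 0 < √(Real.log Λ) := Real.sqrt_pos.2 hlg0
  have hC0 : 0 < cov d m Λ 0 := lt_of_lt_of_le (by positivity) (hcov Λ hΛ hlog)
  have hci := (integrable_cov_and_integral_le (d := d) hm hΛ).1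
  have hkern := kern_specMeas (d := d) hm hΛ hZ
  -- With the AM–GM parameter `a = √(log Λ)` the off-diagonal term, of order `a / log Λ`, balances
  -- the term `1 / a`.
  have key := h.abs_integral_pow_sub_pow_le hν (by rw [hkern]; positivity)
    ((hci.const_mul Z).congr (ae_of_all _ fun x => (hkern x).symm)) J hV hA
    (volume_box_ne_top d L) n ha0
  refine key.trans (decorrelation_bound_le (by positivity) (volumeReal_box_pos d hL) hA0 ha0 n
    (div_nonneg (integral_nonneg fun _ => abs_nonneg _) (by rw [hkern]; positivity)) ?_)
  refine (kern_specMeas_ratio_le hm hΛ hZ (by positivity) (hcov Λ hΛ hlog)).trans (le_of_eq ?_)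
  rw [Real.sq_sqrt hlg0.le, div_div, mul_assoc]
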